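/- **Setting.** A set-valued operator $\mathsf A:\mathbb R^N\rightrightarrows\mathbb R^N$ is monotone if $\langle y-y',x-x'\rangle\ge 0$ whenever $y\in\mathsf A(x)$, $y'\in\mathsf A(x')$; it is maximal if it is non-empty and its graph is maximal for inclusion among the graphs of monotone operators. Its domain is $\mathrm{dom}(\mathsf A)=\{x:\mathsf A(x)\ne\emptyset\}$ and its set of zeros is $Z(\mathsf A)=\{x: 0\in\mathsf A(x)\}$. Let $(\Xi,\mathcal T,\mu)$ be a probability space with $\mathcal T$ $\mu$-complete. A closed-valued set-valued function $F$ on $\Xi$ is measurable if $\{\xi:F(\xi)\cap H\ne\emptyset\}\in\mathcal T$ for every Borel set $H$. For $1\le q<\infty$ let $\mathcal S^q_F$ be the set of $\varphi\in\mathcal L^q(\Xi,\mathcal T,\mu;\mathbb R^N)$ with $\varphi(\xi)\in F(\xi)$ for $\mu$-almost every $\xi$. The function $F$ is integrable if $\mathcal S^1_F\neq\emptyset$, and its Aumann integral is $\int F\,d\mu=\{\int\varphi\,d\mu:\varphi\in\mathcal S^1_F\}$. For every $\xi\in\Xi$ let $A(\xi,\cdot)$ and $B(\xi,\cdot)$ be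 maximal monotone operators on $\mathbb R^N$ whose graphs are measurable functions of $\xi$. Let $D(\xi)=\mathrm{dom}\,A(\xi,\cdot)$ and let $\mathcal D=\{x: x\in D(\xi)\text{ for }\mu\text{-a.e. }\xi\}$. Assume that $\mathcal D\ne\emptyset$, that $A(\cdot,x)$ is integrable for every $x\in\mathcal D$, that $\mathrm{dom}\,B(\xi,\cdot)=\mathbb R^N$ for a.e. $\xi$, and that $B(\cdot,x)$ is integrable for every $x\in\mathbb R^N$. Put $\mathcal A(x)=\int A(\xi,x)\,\mu(d\xi)$ (empty outside $\mathcal D$) and $\mathcal B(x)=\int B(\xi,x)\,\mu(d\xi)$. Let $b:\Xi\times\mathbb R^N\to\mathbb R^N$ be $\mathcal T\otimes\mathcal B(\mathbb R^N)$-measurable with $b(\cdot,x)\in\mathcal S^1_{B(\cdot,x)}$ for every $x$. Let $(\gamma_n)_{n\ge1}$ be a positive sequence in $\ell^2\setminus\ell^1$, let $(u_n)_{n\ge1}$ be iid $\Xi$-valued random variables with law $\mu$ on a probability space $(\Omega,\mathcal F,\mathbb P)$, and let $x_0\in\mathbb R^N$. With the resolvent $J_\gamma(\xi,\cdot)=(I+\gamma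 A(\xi,\cdot))^{-1}$, set $$x_{n+1}=J_{\gamma_{n+1}}\bigl(u_{n+1},\,x_n-\gamma_{n+1}b(u_{n+1},x_n)\bigr),\qquad n\ge 0 .$$ With $\tau_n=\sum_{k=1}^n\gamma_k$, let $$x(t)=x_n+\frac{x_{n+1}-x_n}{\gamma_{n+1}}(t-\tau_n)\quad\text{for } t\in[\tau_n,\tau_{n+1}).$$ Let $A_0(\xi,x)$ be the element of least norm of $A(\xi,x)$, let $\Pi(\xi,\cdot)$ be the projection onto $\overline{D(\xi)}$, and let $d(\xi,\cdot)$ and $\boldsymbol d$ be the distance functions to $D(\xi)$ and to $\mathcal D$. **Theorem.** Assume: 1. The monotone operator $\mathcal A$ is maximal. 2. There are an integer $p\ge1$ and a point $x_\star\in Z(\mathcal A+\mathcal B)$ for which there exist $\varphi\in\mathcal S^{2p}_{A(\cdot,x_\star)}$ and $\psi\in\mathcal S^{2p}_{B(\cdot,x_\star)}$ with $\int\varphi\,d\mu+\int\psi\,d\mu=0$. 3. For every compact $K\subset\mathbb R^N$ there is $\varepsilon\in(0,1]$ such that $\sup_{x\in K\cap\mathcal D}\int\|A_0(\xi,x)\|^{1+\varepsilon}\mu(d\xi)<\infty$,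 and there is $y_0\in\mathcal D$ with $\int\|A_0(\xi,y_0)\|^{1+1/\varepsilon}\mu(d\xi)<\infty$. 4. There is $C>0$ such that $\int d(\xi,x)^2\mu(d\xi)\ge C\,\boldsymbol d(x)^2$ for all $x\in\mathbb R^N$; moreover $\gamma_{n+1}/\gamma_n\to1$. 5. There is $C>0$ such that $\gamma^{-4}\int\|J_\gamma(\xi,x)-\Pi(\xi,x)\|^4\mu(d\xi)\le C(1+\|x\|^{2p})$ for all $x\in\mathbb R^N$ and all $\gamma>0$. 6. There is $M:\Xi\to\mathbb R_+$ with $M^{2p}$ $\mu$-integrable such that, for every $x\in\mathbb R^N$, $\|b(\xi,x)\|\le M(\xi)(1+\|x\|)$ for $\mu$-a.e. $\xi$; moreover there is $C>0$ such that $\int\|b(\xi,x)\|^4\mu(d\xi)\le C(1+\|x\|^{2p})$ for every $x\in\mathbb R^N$. Then the monotone operator $\mathcal A+\mathcal B$ is maximal. Consequently the differential inclusion $\dot z(t)\in-(\mathcal A+\mathcal B)(z(t))$ for a.e. $t\ge0$, $z(0)=z_0$, has a semiflow $\Phi:\overline{\mathcal D}\times\mathbb R_+\to\overline{\mathcal D}$: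 for $z_0\in\mathcal D$, $\Phi(z_0,\cdot)$ is its (locally absolutely continuous) solution, and each $\Phi(\cdot,t)$ is extended by continuity to $\overline{\mathcal D}$. Moreover, with probability one, the process $x(t)$, $t\ge0$, is bounded and is an asymptotic pseudo-trajectory of this differential inclusion, that is, for every $T>0$, $$\sup_{s\in[0,T]}\bigl\|x(t+s)-\Phi\bigl(\mathrm{proj}_{\overline{\mathcal D}}(x(t)),s\bigr)\bigr\|\xrightarrow[t\to\infty]{}0 .$$ -/

import Mathlib

open MeasureTheory ProbabilityTheory Filter Topology
open scoped ENNReal Pointwise RealInnerProductSpace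

noncomputable section

namespace RandomMonotone

section Operators

variable {E : Type*} [NormedAddCommGroup E] [InnerProductSpace ℝ E]

/-- The graph of a set-valued operator `A : E ⇉ E`. -/
def graph (A : E → Set E) : Set (E × E) := {q | q.2 ∈ A q.1}

/-- The domain of a set-valued operator. -/
def dom (A : E → Set E) : Set E := {x | (A x).Nonempty}

/-- The set of zeros of a set-valued operator. -/
def zeros (A : E → Set E) : Set E := {x | (0 : E) ∈ A x}

/-- Monotonicity of a subset of `E × E`, seen as the graph of an operator. -/
def IsMonotoneGraph (G : Set (E × E)) : Prop :=
  ∀ q ∈ G, ∀ q' ∈ G, 0 ≤ ⟪q.2 - q'.2, q.1 - q'.1⟫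

/-- A non-empty monotone operator whose graph is maximal for inclusion among monotone graphs. -/
def IsMaximalMonotone (A : E → Set E) : Prop :=
  (graph A).Nonempty ∧ Maximal IsMonotoneGraph (graph A)

/-- The metric projection: a nearest point of `C` to `x` (it exists and is unique if `C` is
non-empty, closed and convex and `E` is complete). -/
def proj (C : Set E) (x : E) : E :=
  Classical.epsilon fun y => y ∈ C ∧ ‖x - y‖ = Metric.infDist x C

/-- The element of least norm of `A x`. -/
def minSelection (A : E → Set E) (x : E) : E := proj (A x) 0

/-- The resolvent `(I + γ A)⁻¹`: the point `y` with `x ∈ y + γ A y`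
(it exists and is unique if `A` is maximal monotone and `γ > 0`). -/
def resolvent (γ : ℝ) (A : E → Set E) (x : E) : E :=
  Classical.epsilon fun y => ∃ v ∈ A y, x = y + γ • v

/-- `z` is a (locally absolutely continuous) solution on `ℝ₊` of `ż ∈ -A z`, `z 0 = z₀`. -/
structure IsSolution (A : E → Set E) (z₀ : E) (z : ℝ → E) : Prop where
  init : z 0 = z₀
  absCont : ∀ T : ℝ, 0 ≤ T → AbsolutelyContinuousOnInterval z 0 T
  inclusion : ∀ᵐ t ∂(volume.restrict (Set.Ici (0 : ℝ))), ∃ v ∈ A (z t), HasDerivAt z (-v) t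

/-- `Φ` is the semiflow of `ż ∈ -A z`: on `dom A` it is given by the solutions, and it is extended
by continuity to `closure (dom A)`. Only the values on `closure (dom A) × ℝ₊` matter. -/
structure IsSemiflow (A : E → Set E) (Φ : E → ℝ → E) : Prop where
  mapsTo : ∀ t : ℝ, 0 ≤ t → Set.MapsTo (fun z => Φ z t) (closure (dom A)) (closure (dom A))
  solution : ∀ z₀ ∈ dom A, IsSolution A z₀ (Φ z₀)
  continuousOn : ∀ t : ℝ, 0 ≤ t → ContinuousOn (fun z => Φ z t) (closure (dom A))

/-- `v` is an asymptotic pseudo-trajectory of the semiflow `Φ` living on the closed set `S`. -/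
def IsAPT (S : Set E) (Φ : E → ℝ → E) (v : ℝ → E) : Prop :=
  ∀ T : ℝ, 0 < T →
    Tendsto (fun t : ℝ => ⨆ s ∈ Set.Icc (0 : ℝ) T, ‖v (t + s) - Φ (proj S (v t)) s‖ₑ)
      atTop (𝓝 0)

end Operators

section SetValued

variable {Ξ : Type*} [MeasurableSpace Ξ]

/-- Measurability of a set-valued function: the inverse image of every Borel set is measurable. -/
def MeasurableSetValued {F : Type*} [MeasurableSpace F] (S : Ξ → Set F) : Prop :=
  ∀ H : Set F, MeasurableSet H → MeasurableSet {ξ | (S ξ ∩ H).Nonempty}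

variable {E : Type*} [NormedAddCommGroup E] [InnerProductSpace ℝ E]

/-- The set of `q`-integrable selections of a set-valued function. -/
def selections (μ : Measure Ξ) (q : ℝ≥0∞) (S : Ξ → Set E) : Set (Ξ → E) :=
  {φ | MemLp φ q μ ∧ ∀ᵐ ξ ∂μ, φ ξ ∈ S ξ}

/-- The Aumann integral of a set-valued function. -/
def aumannIntegral (μ : Measure Ξ) (S : Ξ → Set E) : Set E :=
  {y | ∃ φ ∈ selections μ 1 S, ∫ ξ, φ ξ ∂μ = y}

/-- The mean operator `x ↦ ∫ A(ξ, x) μ(dξ)`. -/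
def meanOperator (μ : Measure Ξ) (A : Ξ → E → Set E) : E → Set E :=
  fun x => aumannIntegral μ fun ξ => A ξ x

/-- The essential intersection of the domains of the operators `A ξ`. -/
def essDom (μ : Measure Ξ) (A : Ξ → E → Set E) : Set E :=
  {x | ∀ᵐ ξ ∂μ, x ∈ dom (A ξ)}

/-- The `q`-integrable representations of a point as a zero of the sum of the mean operators. -/
def representations (μ : Measure Ξ) (q : ℝ≥0∞) (A B : Ξ → E → Set E) (x : E) :
    Set ((Ξ → E) × (Ξ → E)) :=
  {w | w.1 ∈ selections μ q (fun ξ => A ξ x) ∧ w.2 ∈ selections μ q (fun ξ => B ξ x) ∧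
    ∫ ξ, w.1 ξ ∂μ + ∫ ξ, w.2 ξ ∂μ = 0}

end SetValued

section Algorithm

variable {E : Type*} [NormedAddCommGroup E] [InnerProductSpace ℝ E] {Ξ Ω : Type*}

/-- The iterates `x₀`, `x_{n+1} = J_{γ_{n+1}}(u_{n+1}, x_n - γ_{n+1} b(u_{n+1}, x_n))`. -/
def iterates (A : Ξ → E → Set E) (b : Ξ → E → E) (γ : ℕ → ℝ) (u : ℕ → Ω → Ξ) (x₀ : E)
    (ω : Ω) : ℕ → E
  | 0 => x₀
  | n + 1 =>
    resolvent (γ (n + 1)) (A (u (n + 1) ω))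
      (iterates A b γ u x₀ ω n - γ (n + 1) • b (u (n + 1) ω) (iterates A b γ u x₀ ω n))

/-- `τ_n = γ_1 + ⋯ + γ_n`. -/
def stepTime (γ : ℕ → ℝ) (n : ℕ) : ℝ := ∑ k ∈ Finset.Icc 1 n, γ k

/-- The index `n` with `t ∈ [τ_n, τ_{n+1})`. -/
def stepIndex (γ : ℕ → ℝ) (t : ℝ) : ℕ := sSup {k : ℕ | stepTime γ k ≤ t}

/-- The affine interpolation of a sequence:
`x_n + (t - τ_n) / γ_{n+1} • (x_{n+1} - x_n)` for `t ∈ [τ_n, τ_{n+1})`. -/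
def interpolate (γ : ℕ → ℝ) (x : ℕ → E) (t : ℝ) : E :=
  x (stepIndex γ t) +
    ((t - stepTime γ (stepIndex γ t)) / γ (stepIndex γ t + 1)) •
      (x (stepIndex γ t + 1) - x (stepIndex γ t))

end Algorithm

end RandomMonotone

end

open RandomMonotone

namespace RandomMonotone

/-! ### Maximal monotone operators: Minty's theorem, resolvents, Yosida approximations. -/

section MonotoneTheory

variable {E : Type*} [NormedAddCommGroup E] [InnerProductSpace ℝ E]

/-! The flow of a maximal monotone `H` is handled through its evolution variational inequality:
along `ż ∈ -H z`, for every `w ∈ H y`, half the squared distance to `y` grows at rate at most `⟪w, y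
- z⟫`. Solutions, the implicit Euler scheme and, up to vanishing errors, the random iterates all
satisfy it. Choosing for `(y, w)` the successive graph points visited by the Euler scheme shows that
such a curve stays close to the scheme (`IsMaximalMonotone.euler_compare`). This single comparison
yields existence and nonexpansiveness of the semiflow and the pseudo-trajectory property
(`AsymptoticTest.isAPT`). In the latter, a finite net of the domain and finitely many Euler steps
reduce the test to finitely many graph points, so it holds uniformly at large times.

Maximality of the sum (`IsMaximalMonotone.add_meanOperator`): each `B ξ` is replaced by its Yosida
approximation, whose mean is monotone and Lipschitz, so that the perturbed inclusion is solvable.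
Since the domains of the `B ξ` are full, the Yosida values at bounded points are dominated in `L²`,
and strongly convergent convex combinations identify the limit as an element of the mean operator.

The stochastic part starts from the Fejér inequality at the zero `xstar`. Its linear term is
centred, because the representation of the zero has total mean `0` and the new input is independent
of the past. Taking expectations bounds the second moments and makes the squared increments
summable; martingale convergence then gives almost sure boundedness
(`IsForwardBackward.ae_bounded`).

The mean increment satisfies the variational inequality at each graph point of the mean operator,
after truncation of a selection that is only integrable. The noise need only be tested against a
basis and against the iterate itself, so one null set serves all graph points
(`IsForwardBackward.ae_test`). Finally, the Pythagorean inequality and the comparison of distances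
make the mean squared distance to the domain contract, up to terms of order `γ²`
(`IsForwardBackward.ae_tendsto_infDist`). -/

theorem IsMaximalMonotone.inner_nonneg {A : E → Set E} (hA : IsMaximalMonotone A) {x x' v v' : E}
    (hv : v ∈ A x) (hv' : v' ∈ A x') : 0 ≤ ⟪v - v', x - x'⟫ :=
  hA.2.prop (x, v) hv (x', v') hv'

/-- A point that is monotonically related to a maximal monotone operator belongs to its graph. -/
theorem IsMaximalMonotone.mem_of_forall {A : E → Set E} (hA : IsMaximalMonotone A) {x v : E}
    (h : ∀ y, ∀ w ∈ A y, 0 ≤ ⟪v - w, x - y⟫) : v ∈ A x := by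
  have hmono : IsMonotoneGraph (insert (x, v) (graph A)) := by
    rintro q (rfl | hq) q' (rfl | hq')
    · simp
    · exact h _ _ hq'
    · have := h _ _ hq
      rwa [← neg_sub v, ← neg_sub x, inner_neg_neg]
    · exact hA.2.prop q hq q' hq'
  exact hA.2.le_of_ge hmono (Set.subset_insert _ _) (Set.mem_insert _ _)

theorem IsMaximalMonotone.dom_nonempty {A : E → Set E} (hA : IsMaximalMonotone A) :
    (dom A).Nonempty := by
  obtain ⟨q, hq⟩ := hA.1
  exact ⟨q.1, q.2, hq⟩

/-- The Debrunner–Flor inequality for finitely many points. -/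
theorem exists_forall_inner_nonpos_of_finite {ι : Type*} [Fintype ι] [Nonempty ι] (y v : ι → E)
    (hmono : ∀ i j, 0 ≤ ⟪v i - v j, y i - y j⟫) : ∃ x : E, ∀ j, ⟪v j + x, x - y j⟫ ≤ 0 := by
  classical
  -- The mean of `⟪v j + x, x - y j⟫` with weights `l` is `‖x‖² - ⟪x, c l⟫ - S l`, minimal at `x = c
  -- l / 2` with value `-‖c l‖² / 4 - S l`. The proof maximises this dual function over the simplex.
  let c : (ι → ℝ) → E := fun l => ∑ i, l i • (y i - v i)
  let S : (ι → ℝ) → ℝ := fun l => ∑ i, l i * ⟪v i, y i⟫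
  have hcont : Continuous fun l : ι → ℝ => -(‖c l‖ ^ 2) / 4 - S l := by
    simp only [c, S]
    fun_prop
  have hne : (stdSimplex ℝ ι).Nonempty := ⟨_, single_mem_stdSimplex ℝ (Classical.arbitrary ι)⟩
  obtain ⟨l, hl, hmax⟩ := (isCompact_stdSimplex ℝ ι).exists_isMaxOn hne hcont.continuousOn
  refine ⟨(1 / 2 : ℝ) • c l, fun j => ?_⟩
  have hS : ⟪∑ i, l i • v i, ∑ i, l i • y i⟫ ≤ S l := by
    have hsum : ∑ i, l i = 1 := hl.2
    have h0 : 0 ≤ ∑ i, ∑ j, l i * l j * ⟪v i - v j, y i - y j⟫ :=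
      Finset.sum_nonneg fun i _ => Finset.sum_nonneg fun j _ =>
        mul_nonneg (mul_nonneg (hl.1 i) (hl.1 j)) (hmono i j)
    have h1 : ∑ i, ∑ j, l i * l j * ⟪v i - v j, y i - y j⟫
        = 2 * (S l - ⟪∑ i, l i • v i, ∑ i, l i • y i⟫) := by
      have e1 : ∀ i j, l i * l j * ⟪v i - v j, y i - y j⟫ =
          l j * (l i * ⟪v i, y i⟫) + l i * (l j * ⟪v j, y j⟫)
            - ⟪l i • v i, l j • y j⟫ - ⟪l j • v j, l i • y i⟫ := by
        intro i j
        simp only [inner_sub_left, inner_sub_right, real_inner_smul_left, real_inner_smul_right]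
        ring
      simp only [e1, Finset.sum_sub_distrib, Finset.sum_add_distrib, ← Finset.mul_sum,
        ← Finset.sum_mul, hsum, S, ← sum_inner, ← inner_sum]
      rw [← hsum]
      simp only [sum_inner, inner_sum, hsum]
      ring
    linarith
  have hfirst : -⟪c l, (y j - v j) - c l⟫ / 2 - (⟪v j, y j⟫ - S l) ≤ 0 := by
    -- Optimality of `l` along the segment towards the vertex `j`; the right side is the quadratic
    -- remainder, which vanishes as `t → 0`.
    have key : ∀ t : ℝ, 0 < t → t ≤ 1 →
        -⟪c l, (y j - v j) - c l⟫ / 2 - (⟪v j, y j⟫ - S l)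
          ≤ t * (‖(y j - v j) - c l‖ ^ 2 / 4) := by
      intro t ht ht1
      have hmem : (1 - t) • l + t • Pi.single j (1 : ℝ) ∈ stdSimplex ℝ ι :=
        (convex_stdSimplex ℝ ι) hl (single_mem_stdSimplex ℝ j) (by linarith) ht.le (by ring)
      have h := hmax hmem
      have hc : c ((1 - t) • l + t • Pi.single j (1 : ℝ)) = c l + t • ((y j - v j) - c l) := by
        simp only [c, Pi.add_apply, Pi.smul_apply, smul_eq_mul, add_smul, mul_smul,
          Finset.sum_add_distrib, ← Finset.smul_sum]
        simp [Pi.single_apply]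
        module
      have hSS : S ((1 - t) • l + t • Pi.single j (1 : ℝ)) = S l + t * (⟪v j, y j⟫ - S l) := by
        simp only [S, Pi.add_apply, Pi.smul_apply, smul_eq_mul, add_mul, mul_assoc,
          Finset.sum_add_distrib, ← Finset.mul_sum]
        simp [Pi.single_apply]
        ring
      simp only [Set.mem_ofPred_eq, hc, hSS, norm_add_sq_real, real_inner_smul_right, norm_smul,
        Real.norm_eq_abs, abs_of_pos ht] at h
      have : t * (-⟪c l, (y j - v j) - c l⟫ / 2 - (⟪v j, y j⟫ - S l))
          ≤ t * (t * (‖(y j - v j) - c l‖ ^ 2 / 4)) := by nlinarith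
      exact le_of_mul_le_mul_left this ht
    have hlim : Tendsto (fun t : ℝ => t * (‖(y j - v j) - c l‖ ^ 2 / 4)) (𝓝[>] 0) (𝓝 0) := by
      have : Tendsto (fun t : ℝ => t * (‖(y j - v j) - c l‖ ^ 2 / 4)) (𝓝 0)
          (𝓝 (0 * (‖(y j - v j) - c l‖ ^ 2 / 4))) := tendsto_id.mul_const _
      rw [zero_mul] at this
      exact this.mono_left nhdsWithin_le_nhds
    refine ge_of_tendsto hlim ?_
    filter_upwards [Ioc_mem_nhdsGT (zero_lt_one (α := ℝ))] with t ht using key t ht.1 ht.2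
  have hcl : c l = (∑ i, l i • y i) - ∑ i, l i • v i := by
    simp [c, smul_sub, Finset.sum_sub_distrib]
  -- Polarisation together with `hS` shows that the maximal dual value is nonpositive.
  have hsq : 0 ≤ ‖(∑ i, l i • y i) + ∑ i, l i • v i‖ ^ 2 := sq_nonneg _
  have hn : ‖c l‖ ^ 2 = ‖(∑ i, l i • y i) + ∑ i, l i • v i‖ ^ 2
      - 4 * ⟪∑ i, l i • v i, ∑ i, l i • y i⟫ := by
    rw [hcl, norm_add_sq_real, norm_sub_sq_real, real_inner_comm]
    ring
  have htarget : ⟪v j + (1 / 2 : ℝ) • c l, (1 / 2 : ℝ) • c l - y j⟫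
      = ‖c l‖ ^ 2 / 4 - ⟪c l, y j - v j⟫ / 2 - ⟪v j, y j⟫ := by
    simp only [inner_sub_right, inner_add_left, real_inner_smul_left, real_inner_smul_right]
    rw [real_inner_comm (c l) (v j), real_inner_self_eq_norm_sq]
    ring
  rw [inner_sub_right, real_inner_self_eq_norm_sq] at hfirst
  rw [htarget]
  nlinarith

/-- **Minty's theorem**. -/
theorem IsMaximalMonotone.exists_resolvent [FiniteDimensional ℝ E] {A : E → Set E}
    (hA : IsMaximalMonotone A) {γ : ℝ} (hγ : 0 < γ) (z : E) : ∃ y, ∃ v ∈ A y, z = y + γ • v := by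
  -- A common point `x` of these sets makes `γ⁻¹ • (z - x)` monotonically related to the whole
  -- graph. One of the sets is compact, so finite intersections suffice.
  let T : graph A → Set E := fun q => {x | ⟪γ • q.1.2 - z + x, x - q.1.1⟫ ≤ 0}
  obtain ⟨q₀⟩ := hA.1.to_subtype
  have hclosed : ∀ q, IsClosed (T q) := fun q =>
    isClosed_le (by fun_prop) continuous_const
  have hcomp : IsCompact (T q₀) := by
    refine Metric.isCompact_of_isClosed_isBounded (hclosed _) ?_
    refine (Metric.isBounded_closedBall (x := q₀.1.1)
      (r := ‖γ • q₀.1.2 - z + q₀.1.1‖)).subset fun x hx => ?_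
    rw [mem_closedBall_iff_norm]
    have hx' : ⟪γ • q₀.1.2 - z + x, x - q₀.1.1⟫ ≤ 0 := hx
    have e : γ • q₀.1.2 - z + x = (γ • q₀.1.2 - z + q₀.1.1) + (x - q₀.1.1) := by abel
    rw [e, inner_add_left, real_inner_self_eq_norm_sq] at hx'
    have h2 := abs_real_inner_le_norm (γ • q₀.1.2 - z + q₀.1.1) (x - q₀.1.1)
    have h3 := neg_abs_le ⟪γ • q₀.1.2 - z + q₀.1.1, x - q₀.1.1⟫
    by_contra! hlt
    nlinarith [norm_nonneg (γ • q₀.1.2 - z + q₀.1.1)]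
  have hfin : ∀ s : Finset (graph A), (T q₀ ∩ ⋂ q ∈ s, T q).Nonempty := by
    classical
    intro s
    let s' := insert q₀ s
    have : Nonempty s' := ⟨⟨q₀, Finset.mem_insert_self _ _⟩⟩
    obtain ⟨x, hx⟩ := exists_forall_inner_nonpos_of_finite (ι := s')
      (fun q => q.1.1.1) (fun q => γ • q.1.1.2 - z) (fun i j => by
        have := hA.2.prop _ i.1.2 _ j.1.2
        rw [sub_sub_sub_cancel_right, ← smul_sub, real_inner_smul_left]
        positivity)
    refine ⟨x, hx ⟨q₀, Finset.mem_insert_self _ _⟩, ?_⟩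
    simp only [Set.mem_iInter]
    exact fun q hq => hx ⟨q, Finset.mem_insert_of_mem hq⟩
  obtain ⟨x, -, hx⟩ := hcomp.inter_iInter_nonempty T hclosed hfin
  rw [Set.mem_iInter] at hx
  refine ⟨x, γ⁻¹ • (z - x), hA.mem_of_forall fun y w hw => ?_, ?_⟩
  · have h : ⟪γ • w - z + x, x - y⟫ ≤ 0 := hx ⟨(y, w), hw⟩
    have e : γ⁻¹ • (z - x) - w = -(γ⁻¹ • (γ • w - z + x)) := by
      have hw' : w = γ⁻¹ • γ • w := by rw [smul_smul, inv_mul_cancel₀ hγ.ne', one_smul]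
      nth_rewrite 1 [hw']
      module
    rw [e, inner_neg_left, real_inner_smul_left]
    have := mul_nonneg (inv_nonneg.2 hγ.le) (neg_nonneg.2 h)
    linarith
  · rw [smul_smul, mul_inv_cancel₀ hγ.ne']
    simp

/-- A monotone operator `A` such that `I + A` is onto is maximal. -/
theorem isMaximalMonotone_of_surjective {A : E → Set E}
    (hmono : ∀ x x' v v', v ∈ A x → v' ∈ A x' → 0 ≤ ⟪v - v', x - x'⟫)
    (hsurj : ∀ z, ∃ y, ∃ v ∈ A y, z = y + v) : IsMaximalMonotone A := by
  obtain ⟨y, v, hv, -⟩ := hsurj 0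
  refine ⟨⟨(y, v), hv⟩, fun q hq q' hq' => hmono _ _ _ _ hq hq', fun G hG hle => ?_⟩
  rintro ⟨x, w⟩ hxw
  -- Solving at `x + w` gives a graph point with `w - v = -(x - y)`; monotonicity then forces the
  -- two pairs to coincide.
  obtain ⟨y, v, hv, hz⟩ := hsurj (x + w)
  have h : 0 ≤ ⟪w - v, x - y⟫ := hG (x, w) hxw (y, v) (hle hv)
  have e : w - v = -(x - y) := by
    rw [neg_sub, sub_eq_sub_iff_add_eq_add, add_comm w, hz]
  rw [e, inner_neg_left, real_inner_self_eq_norm_sq] at h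
  have hxy : x = y := by
    rw [← sub_eq_zero, ← norm_eq_zero]
    nlinarith [norm_nonneg (x - y)]
  subst hxy
  obtain rfl : w = v := by simpa using hz
  exact hv

/-- The Yosida approximation. -/
noncomputable def yosida (γ : ℝ) (A : E → Set E) (x : E) : E := γ⁻¹ • (x - resolvent γ A x)

variable {A : E → Set E} {γ : ℝ}

theorem resolvent_add_smul_yosida (hγ : 0 < γ) (x : E) :
    resolvent γ A x + γ • yosida γ A x = x := by
  rw [yosida, smul_smul, mul_inv_cancel₀ hγ.ne']
  simp

theorem resolvent_eq_sub (hγ : 0 < γ) (x : E) : resolvent γ A x = x - γ • yosida γ A x :=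
  eq_sub_of_add_eq (resolvent_add_smul_yosida hγ x)

theorem resolvent_forward_eq (hγ : 0 < γ) (x β : E) :
    resolvent γ A (x - γ • β) = x - γ • (yosida γ A (x - γ • β) + β) := by
  rw [resolvent_eq_sub hγ, smul_add]
  abel

theorem IsMaximalMonotone.yosida_mem [FiniteDimensional ℝ E] (hA : IsMaximalMonotone A)
    (hγ : 0 < γ) (x : E) : yosida γ A x ∈ A (resolvent γ A x) := by
  have h : ∃ y, ∃ v ∈ A y, x = y + γ • v := hA.exists_resolvent hγ x
  obtain ⟨v, hv, hx⟩ : ∃ v ∈ A (resolvent γ A x), x = resolvent γ A x + γ • v :=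
    Classical.epsilon_spec h
  have e : yosida γ A x = v := by
    rw [yosida, sub_eq_of_eq_add' hx, smul_smul, inv_mul_cancel₀ hγ.ne', one_smul]
  rwa [e]

/-- The base points differ by `-γ` times the difference of the values, so monotonicity makes both
differences vanish. Any decomposition `x = y + γ • v` on the graph therefore identifies the chosen
resolvent. -/
theorem IsMaximalMonotone.eq_of_add_smul_eq (hA : IsMaximalMonotone A) (hγ : 0 < γ)
    {y y' v v' : E} (hv : v ∈ A y) (hv' : v' ∈ A y') (h : y + γ • v = y' + γ • v') :
    y = y' ∧ v = v' := by
  have h0 := hA.inner_nonneg hv hv'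
  have e : y - y' = -(γ • (v - v')) := by
    rw [smul_sub, neg_sub, sub_eq_sub_iff_add_eq_add, h, add_comm]
  have hvv : v = v' := by
    rw [e, inner_neg_right, real_inner_smul_right, real_inner_self_eq_norm_sq] at h0
    rw [← sub_eq_zero, ← norm_eq_zero]
    have : ‖v - v'‖ ^ 2 ≤ 0 := by
      by_contra! hlt
      nlinarith [mul_pos hγ hlt]
    nlinarith [norm_nonneg (v - v')]
  subst hvv
  exact ⟨by simpa using h, rfl⟩

/-- The graph of a maximal monotone operator is closed. -/
theorem IsMaximalMonotone.mem_of_tendsto (hA : IsMaximalMonotone A) {ι : Type*} {l : Filter ι}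
    [l.NeBot] {x v : ι → E} {x' v' : E} (hx : Tendsto x l (𝓝 x')) (hv : Tendsto v l (𝓝 v'))
    (h : ∀ᶠ i in l, v i ∈ A (x i)) : v' ∈ A x' := by
  refine hA.mem_of_forall fun y w hw => ?_
  refine ge_of_tendsto ((hv.sub_const w).inner (hx.sub_const y)) ?_
  filter_upwards [h] with i hi using hA.inner_nonneg hi hw

variable [FiniteDimensional ℝ E]

theorem IsMaximalMonotone.resolvent_add_smul (hA : IsMaximalMonotone A) (hγ : 0 < γ) {y v : E}
    (hv : v ∈ A y) : resolvent γ A (y + γ • v) = y :=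
  (hA.eq_of_add_smul_eq hγ (hA.yosida_mem hγ _) hv (resolvent_add_smul_yosida hγ _)).1

theorem IsMaximalMonotone.yosida_add_smul (hA : IsMaximalMonotone A) (hγ : 0 < γ) {y v : E}
    (hv : v ∈ A y) : yosida γ A (y + γ • v) = v :=
  (hA.eq_of_add_smul_eq hγ (hA.yosida_mem hγ _) hv (resolvent_add_smul_yosida hγ _)).2

/-- Cocoercivity of the Yosida approximation. -/
theorem IsMaximalMonotone.yosida_cocoercive (hA : IsMaximalMonotone A) (hγ : 0 < γ) (x x' : E) :
    γ * ‖yosida γ A x - yosida γ A x'‖ ^ 2 ≤ ⟪yosida γ A x - yosida γ A x', x - x'⟫ := by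
  have h := hA.inner_nonneg (hA.yosida_mem hγ x) (hA.yosida_mem hγ x')
  rw [resolvent_eq_sub hγ, resolvent_eq_sub hγ, sub_sub_sub_comm, ← smul_sub, inner_sub_right,
    real_inner_smul_right, real_inner_self_eq_norm_sq] at h
  linarith

theorem IsMaximalMonotone.norm_resolvent_sub_le (hA : IsMaximalMonotone A) (hγ : 0 < γ)
    (x x' : E) : ‖resolvent γ A x - resolvent γ A x'‖ ≤ ‖x - x'‖ := by
  have h := hA.yosida_cocoercive hγ x x'
  have e : resolvent γ A x - resolvent γ A x'
      = (x - x') - γ • (yosida γ A x - yosida γ A x') := by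
    rw [resolvent_eq_sub hγ, resolvent_eq_sub hγ, smul_sub]
    abel
  have h2 : ‖resolvent γ A x - resolvent γ A x'‖ ^ 2 ≤ ‖x - x'‖ ^ 2 := by
    rw [e, norm_sub_sq_real, real_inner_smul_right, norm_smul, Real.norm_eq_abs, abs_of_pos hγ,
      real_inner_comm]
    nlinarith [sq_nonneg (‖yosida γ A x - yosida γ A x'‖)]
  exact le_of_sq_le_sq h2 (norm_nonneg _)

theorem IsMaximalMonotone.norm_yosida_sub_le (hA : IsMaximalMonotone A) (hγ : 0 < γ)
    (x x' : E) : ‖yosida γ A x - yosida γ A x'‖ ≤ γ⁻¹ * ‖x - x'‖ := by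
  have h := (hA.yosida_cocoercive hγ x x').trans (real_inner_le_norm _ _)
  rw [inv_mul_eq_div, le_div_iff₀ hγ]
  rcases (norm_nonneg (yosida γ A x - yosida γ A x')).eq_or_lt with h0 | h0
  · rw [← h0]; simp
  · refine le_of_mul_le_mul_left ?_ h0
    linarith

/-- Monotonicity between `(x, v)` and the graph point of the resolvent, whose base point differs
from `x` by `γ` times the Yosida value, gives `‖yosida γ A x‖² ≤ ⟪v, yosida γ A x⟫`. The bound is
uniform in `γ`. -/
theorem IsMaximalMonotone.norm_yosida_le (hA : IsMaximalMonotone A) (hγ : 0 < γ) {x v : E}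
    (hv : v ∈ A x) : ‖yosida γ A x‖ ≤ ‖v‖ := by
  have h := hA.inner_nonneg hv (hA.yosida_mem hγ x)
  rw [resolvent_eq_sub hγ, sub_sub_cancel, real_inner_smul_right, inner_sub_left,
    real_inner_self_eq_norm_sq] at h
  have h1 : ‖yosida γ A x‖ ^ 2 ≤ ⟪v, yosida γ A x⟫ := by
    have := nonneg_of_mul_nonneg_right h hγ
    linarith
  have h2 := real_inner_le_norm v (yosida γ A x)
  rcases (norm_nonneg (yosida γ A x)).eq_or_lt with h0 | h0
  · rw [← h0]; exact norm_nonneg _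
  · refine le_of_mul_le_mul_right ?_ h0
    nlinarith

theorem IsMaximalMonotone.continuous_resolvent (hA : IsMaximalMonotone A) (hγ : 0 < γ) :
    Continuous (resolvent γ A) :=
  (LipschitzWith.of_dist_le_mul (K := 1) fun x y => by
    simpa [dist_eq_norm] using hA.norm_resolvent_sub_le hγ x y).continuous

end MonotoneTheory

end RandomMonotone

namespace RandomMonotone

/-! ### Projections onto closed convex sets and closures of domains. -/

section Projection

variable {E : Type*} [NormedAddCommGroup E] [InnerProductSpace ℝ E] [FiniteDimensional ℝ E]

theorem proj_spec {C : Set E} (hC : IsClosed C) (hne : C.Nonempty) (x : E) :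
    proj C x ∈ C ∧ ‖x - proj C x‖ = Metric.infDist x C := by
  obtain ⟨y, hy, h⟩ := hC.exists_infDist_eq_dist hne x
  exact Classical.epsilon_spec (p := fun y => y ∈ C ∧ ‖x - y‖ = Metric.infDist x C)
    ⟨y, hy, by rw [h, dist_eq_norm]⟩

theorem inner_sub_proj_nonpos {C : Set E} (hC : IsClosed C) (hne : C.Nonempty) (hconv : Convex ℝ C)
    (x : E) {y : E} (hy : y ∈ C) : ⟪x - proj C x, y - proj C x⟫ ≤ 0 := by
  obtain ⟨hm, hd⟩ := proj_spec hC hne x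
  refine (norm_eq_iInf_iff_real_inner_le_zero hconv hm).1 ?_ y hy
  rw [hd, Metric.infDist_eq_iInf]
  simp [dist_eq_norm]

theorem proj_eq_of_forall {C : Set E} (hC : IsClosed C) (hconv : Convex ℝ C)
    {x p : E} (hp : p ∈ C) (h : ∀ y ∈ C, 0 ≤ ⟪x - p, p - y⟫) : proj C x = p := by
  have hm := (proj_spec hC ⟨p, hp⟩ x).1
  have h1 := inner_sub_proj_nonpos hC ⟨p, hp⟩ hconv x hp
  have h2 := h _ hm
  have h3 : ‖p - proj C x‖ ^ 2 ≤ 0 := by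
    rw [← real_inner_self_eq_norm_sq]
    have e : ⟪p - proj C x, p - proj C x⟫ =
      ⟪x - proj C x, p - proj C x⟫ - ⟪x - p, p - proj C x⟫ := by
      rw [← inner_sub_left]; congr 1; abel
    linarith
  have : ‖p - proj C x‖ = 0 := by nlinarith [norm_nonneg (p - proj C x)]
  rw [norm_eq_zero, sub_eq_zero] at this
  exact this.symm

/-- Pythagorean inequality for the projection onto a closed convex set. -/
theorem norm_proj_sub_sq_le {C : Set E} (hC : IsClosed C) (hconv : Convex ℝ C) (x : E) {y : E}
    (hy : y ∈ C) : ‖proj C x - y‖ ^ 2 ≤ ‖x - y‖ ^ 2 - Metric.infDist x C ^ 2 := by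
  have h1 := inner_sub_proj_nonpos hC ⟨y, hy⟩ hconv x hy
  rw [← (proj_spec hC ⟨y, hy⟩ x).2]
  have e : x - y = (x - proj C x) - (y - proj C x) := by abel
  rw [norm_sub_rev (proj C x) y, e, norm_sub_sq_real (x - proj C x)]
  linarith

end Projection

section Domain

variable {E : Type*} [NormedAddCommGroup E] [InnerProductSpace ℝ E] [FiniteDimensional ℝ E]
  {A : E → Set E}

/-- In the monotonicity inequality multiplied by the step, the term `g n • v` vanishes in the limit,
so every cluster point of the bounded sequence of resolvents solves the variational inequality of a
projection. Adding the inequalities of two cluster points shows that they agree. Convexity of the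
closure is not needed here; it is deduced afterwards. -/
theorem IsMaximalMonotone.exists_tendsto_resolvent (hA : IsMaximalMonotone A) (x : E) :
    ∃ p ∈ closure (dom A), (∀ y ∈ closure (dom A), 0 ≤ ⟪x - p, p - y⟫) ∧
      Tendsto (fun n : ℕ => resolvent (1 / ((n : ℝ) + 1)) A x) atTop (𝓝 p) := by
  set g : ℕ → ℝ := fun n => 1 / ((n : ℝ) + 1) with hg
  have hgpos : ∀ n, 0 < g n := fun n => by positivity
  have hg0 : Tendsto g atTop (𝓝 0) := tendsto_one_div_add_atTop_nhds_zero_nat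
  have hineq : ∀ n y v, v ∈ A y →
      0 ≤ ⟪(x - resolvent (g n) A x) - g n • v, resolvent (g n) A x - y⟫ := by
    intro n y v hv
    have h := hA.inner_nonneg (hA.yosida_mem (hgpos n) x) hv
    have e : (x - resolvent (g n) A x) - g n • v = g n • (yosida (g n) A x - v) := by
      rw [smul_sub, resolvent_eq_sub (hgpos n), sub_sub_cancel]
    rw [e, real_inner_smul_left]
    exact mul_nonneg (hgpos n).le h
  have hbdd : Bornology.IsBounded (Set.range fun n => resolvent (g n) A x) := by
    obtain ⟨y, v, hv⟩ := hA.dom_nonempty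
    refine (Metric.isBounded_closedBall (x := y) (r := ‖x - y‖ + ‖v‖)).subset ?_
    rintro _ ⟨n, rfl⟩
    rw [mem_closedBall_iff_norm]
    dsimp only
    have h := hineq n y v hv
    have e : (x - resolvent (g n) A x) - g n • v
        = ((x - y) - g n • v) - (resolvent (g n) A x - y) := by abel
    rw [e, inner_sub_left, real_inner_self_eq_norm_sq] at h
    have h2 := real_inner_le_norm ((x - y) - g n • v) (resolvent (g n) A x - y)
    have h3 : ‖(x - y) - g n • v‖ ≤ ‖x - y‖ + ‖v‖ := by
      refine (norm_sub_le _ _).trans ?_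
      rw [norm_smul, Real.norm_eq_abs, abs_of_pos (hgpos n)]
      have : g n ≤ 1 := by
        rw [hg]
        refine (div_le_one (by positivity)).2 ?_
        simp
      nlinarith [norm_nonneg v]
    by_contra! hlt
    nlinarith [norm_nonneg (x - y), norm_nonneg v]
  have hlimit : ∀ (s : ℕ → ℕ) (p : E), Tendsto s atTop atTop →
      Tendsto (fun n => resolvent (g (s n)) A x) atTop (𝓝 p) →
      p ∈ closure (dom A) ∧ ∀ y ∈ closure (dom A), 0 ≤ ⟪x - p, p - y⟫ := by
    intro s p hs hp
    refine ⟨mem_closure_of_tendsto hp (Eventually.of_forall fun n =>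
      ⟨_, hA.yosida_mem (hgpos _) x⟩), ?_⟩
    have hcl : IsClosed {y : E | 0 ≤ ⟪x - p, p - y⟫} := isClosed_le continuous_const (by fun_prop)
    refine fun y hy => closure_minimal (fun y hy => ?_) hcl hy
    obtain ⟨v, hv⟩ := hy
    have ht : Tendsto (fun n => ⟪(x - resolvent (g (s n)) A x) - g (s n) • v,
        resolvent (g (s n)) A x - y⟫) atTop (𝓝 ⟪(x - p) - (0 : ℝ) • v, p - y⟫) :=
      ((hp.const_sub x).sub ((hg0.comp hs).smul_const v)).inner (hp.sub_const y)
    rw [zero_smul, sub_zero] at ht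
    exact ge_of_tendsto' ht fun n => hineq _ y v hv
  obtain ⟨p, -, s, hs, hsp⟩ := tendsto_subseq_of_bounded hbdd (fun n => Set.mem_range_self n)
  obtain ⟨hp1, hp2⟩ := hlimit s p hs.tendsto_atTop hsp
  refine ⟨p, hp1, hp2, tendsto_of_subseq_tendsto fun ns hns => ?_⟩
  obtain ⟨p', -, s', hs', hsp'⟩ := tendsto_subseq_of_bounded hbdd
    (x := fun n => resolvent (g (ns n)) A x) (fun n => Set.mem_range_self (ns n))
  obtain ⟨hp1', hp2'⟩ := hlimit (ns ∘ s') p' (hns.comp hs'.tendsto_atTop) hsp'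
  have hpp : p' = p := by
    have h1 := hp2 _ hp1'
    have h2 := hp2' _ hp1
    rw [← sub_eq_zero, ← norm_eq_zero]
    have e : ‖p' - p‖ ^ 2 = - (⟪x - p, p - p'⟫ + ⟪x - p', p' - p⟫) := by
      rw [← real_inner_self_eq_norm_sq]
      simp only [inner_sub_left, inner_sub_right]
      ring
    nlinarith [norm_nonneg (p' - p)]
  exact ⟨s', hpp ▸ hsp'⟩

/-- The limit `p` of the resolvents at a convex combination `z` satisfies the variational inequality
at both endpoints, hence by linearity at `z` itself, which gives `z = p`. -/
theorem IsMaximalMonotone.convex_closure_dom (hA : IsMaximalMonotone A) :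
    Convex ℝ (closure (dom A)) := by
  intro a ha b hb s t hs ht hst
  obtain ⟨p, hp, hin, -⟩ := hA.exists_tendsto_resolvent (s • a + t • b)
  set z := s • a + t • b with hz
  have e : ⟪z - p, p - z⟫ = s * ⟪z - p, p - a⟫ + t * ⟪z - p, p - b⟫ := by
    rw [← real_inner_smul_right, ← real_inner_smul_right, ← inner_add_right]
    congr 1
    rw [smul_sub, smul_sub, sub_add_sub_comm, ← add_smul, hst, one_smul]
  have h0 : 0 ≤ ⟪z - p, p - z⟫ := by
    rw [e]
    have := hin a ha
    have := hin b hb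
    positivity
  rw [← neg_sub z p, inner_neg_right, real_inner_self_eq_norm_sq] at h0
  have : ‖z - p‖ = 0 := by nlinarith [norm_nonneg (z - p)]
  rw [norm_eq_zero, sub_eq_zero] at this
  rwa [this]

theorem IsMaximalMonotone.tendsto_resolvent_proj (hA : IsMaximalMonotone A) (x : E) :
    Tendsto (fun n : ℕ => resolvent (1 / ((n : ℝ) + 1)) A x) atTop
      (𝓝 (proj (closure (dom A)) x)) := by
  obtain ⟨p, hp, hin, ht⟩ := hA.exists_tendsto_resolvent x
  rwa [proj_eq_of_forall isClosed_closure hA.convex_closure_dom hp hin]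

theorem IsMaximalMonotone.infDist_dom_eq (hA : IsMaximalMonotone A) (x : E) :
    Metric.infDist x (dom A) = ‖x - proj (closure (dom A)) x‖ := by
  rw [(proj_spec isClosed_closure hA.dom_nonempty.closure x).2, Metric.infDist_closure]

end Domain

/-! ### Local boundedness and Lipschitz perturbations. -/

section Sum

variable {E : Type*} [NormedAddCommGroup E] [InnerProductSpace ℝ E] [FiniteDimensional ℝ E]
  {A : E → Set E}

/-- A vector that is monotonically related to vectors attached to the vertices of a large
cross-polytope is bounded in terms of these vectors. -/
theorem norm_le_of_monotone_at_points {R : ℝ} (w₁ w₂ : Fin (Module.finrank ℝ E) → E) {x v : E}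
    (hx : ‖x‖ ≤ R)
    (h₁ : ∀ i, 0 ≤ ⟪v - w₁ i, x - (Module.finrank ℝ E * R + 1) • stdOrthonormalBasis ℝ E i⟫)
    (h₂ : ∀ i, 0 ≤ ⟪v - w₂ i, x - (-(Module.finrank ℝ E * R + 1)) • stdOrthonormalBasis ℝ E i⟫) :
    ‖v‖ ≤ Module.finrank ℝ E * (Module.finrank ℝ E * R + 1 + R) *
      ∑ i, (‖w₁ i‖ + ‖w₂ i‖) := by
  set e := stdOrthonormalBasis ℝ E
  set N : ℝ := (Module.finrank ℝ E : ℝ) with hN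
  have hR : 0 ≤ R := (norm_nonneg x).trans hx
  have hN0 : 0 ≤ N := by positivity
  set m := ∑ i, (‖w₁ i‖ + ‖w₂ i‖)
  have hm : ∀ i, ‖w₁ i‖ + ‖w₂ i‖ ≤ m := fun i =>
    Finset.single_le_sum (f := fun i => ‖w₁ i‖ + ‖w₂ i‖) (fun i _ => by positivity)
      (Finset.mem_univ i)
  -- Testing at the vertices `±(N R + 1) e i` bounds each coordinate. After summation over the `N`
  -- coordinates, `N R ‖v‖` is absorbed by `(N R + 1) ‖v‖`, which leaves exactly `‖v‖`.
  have hcoord : ∀ i, (N * R + 1) * |⟪e i, v⟫| ≤ R * ‖v‖ + (N * R + 1 + R) * m := by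
    intro i
    have aux : ∀ (c : ℝ) (w : E), |c| = N * R + 1 → ‖w‖ ≤ m → 0 ≤ ⟪v - w, x - c • e i⟫ →
        c * ⟪e i, v⟫ ≤ R * ‖v‖ + (N * R + 1 + R) * m := by
      intro c w hc hw h
      have h3 : ⟪v, x⟫ ≤ R * ‖v‖ := by
        have := real_inner_le_norm v x
        nlinarith [norm_nonneg v]
      have h4 : -⟪w, x - c • e i⟫ ≤ (N * R + 1 + R) * m := by
        have h5 := neg_le_of_abs_le (abs_real_inner_le_norm w (x - c • e i))
        have h6 : ‖x - c • e i‖ ≤ N * R + 1 + R := by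
          refine (norm_sub_le _ _).trans ?_
          rw [norm_smul, Real.norm_eq_abs, hc, e.norm_eq_one]
          linarith
        have : ‖w‖ * ‖x - c • e i‖ ≤ m * (N * R + 1 + R) :=
          mul_le_mul hw h6 (norm_nonneg _) ((norm_nonneg _).trans hw)
        linarith
      rw [inner_sub_left, inner_sub_right v, real_inner_smul_right, real_inner_comm (e i) v] at h
      linarith
    have p0 : 0 ≤ N * R + 1 := by positivity
    have a1 := aux (N * R + 1) (w₁ i) (abs_of_nonneg p0)
      (by linarith [hm i, norm_nonneg (w₂ i)]) (h₁ i)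
    have a2 := aux (-(N * R + 1)) (w₂ i) (by rw [abs_neg, abs_of_nonneg p0])
      (by linarith [hm i, norm_nonneg (w₁ i)]) (h₂ i)
    rcases abs_cases ⟪e i, v⟫ with ⟨h, -⟩ | ⟨h, -⟩ <;> rw [h] <;> linarith
  have hsum : ‖v‖ ≤ ∑ i, |⟪e i, v⟫| := by
    nth_rewrite 1 [← e.sum_repr' v]
    refine (norm_sum_le _ _).trans (Finset.sum_le_sum fun i _ => ?_)
    rw [norm_smul, e.norm_eq_one, mul_one, Real.norm_eq_abs]
  have htot : (N * R + 1) * ‖v‖ ≤ N * (R * ‖v‖ + (N * R + 1 + R) * m) := by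
    calc (N * R + 1) * ‖v‖ ≤ (N * R + 1) * ∑ i, |⟪e i, v⟫| := by gcongr
      _ = ∑ i, (N * R + 1) * |⟪e i, v⟫| := Finset.mul_sum _ _ _
      _ ≤ ∑ _i : Fin (Module.finrank ℝ E), (R * ‖v‖ + (N * R + 1 + R) * m) :=
        Finset.sum_le_sum fun i _ => hcoord i
      _ = N * (R * ‖v‖ + (N * R + 1 + R) * m) := by
        rw [Finset.sum_const, Finset.card_univ, Fintype.card_fin, nsmul_eq_mul]
  linarith

/-- The sum of a maximal monotone operator, the identity and a Lipschitz monotone map is onto. -/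
theorem IsMaximalMonotone.exists_add_lipschitz (hA : IsMaximalMonotone A) {T : E → E} {L : ℝ}
    (hL : 0 ≤ L) (hmono : ∀ x y, 0 ≤ ⟪T x - T y, x - y⟫)
    (hlip : ∀ x y, ‖T x - T y‖ ≤ L * ‖x - y‖) (z : E) : ∃ x, ∃ a ∈ A x, z = x + a + T x := by
  -- Solutions are the fixed points of a forward-backward map. The identity makes the forward part
  -- strongly monotone, and this `s` turns the squared ratio `1 - 2 s + s² (1 + L)²` into `1 - s`.
  set s : ℝ := 1 / (1 + L) ^ 2 with hs
  have hs0 : 0 < s := by positivity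
  have hs1 : s * (1 + L) ^ 2 = 1 := by rw [hs]; field_simp
  have hsle : s ≤ 1 := by nlinarith [mul_nonneg hs0.le hL, mul_nonneg hs0.le (mul_nonneg hL hL)]
  let F : E → E := fun x => resolvent s A (x - s • (x + T x - z))
  have hF : ∀ x y, ‖F x - F y‖ ≤ Real.sqrt (1 - s) * ‖x - y‖ := by
    intro x y
    refine (hA.norm_resolvent_sub_le hs0 _ _).trans ?_
    have e : x - s • (x + T x - z) - (y - s • (y + T y - z))
        = (x - y) - s • ((x - y) + (T x - T y)) := by
      module
    have h1 : ‖(x - y) + (T x - T y)‖ ≤ (1 + L) * ‖x - y‖ := by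
      refine (norm_add_le _ _).trans ?_
      linarith [hlip x y]
    have h2 : ‖(x - y) + (T x - T y)‖ ^ 2 ≤ (1 + L) ^ 2 * ‖x - y‖ ^ 2 := by
      rw [← mul_pow]; gcongr
    refine le_of_sq_le_sq ?_ (by positivity)
    rw [e, mul_pow, Real.sq_sqrt (by linarith), norm_sub_sq_real, real_inner_smul_right,
      inner_add_right, real_inner_self_eq_norm_sq, norm_smul, Real.norm_eq_abs, abs_of_pos hs0,
      real_inner_comm]
    have h3 := mul_nonneg hs0.le (hmono x y)
    have h4 : s ^ 2 * ‖(x - y) + (T x - T y)‖ ^ 2 ≤ s * ‖x - y‖ ^ 2 := by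
      calc s ^ 2 * ‖(x - y) + (T x - T y)‖ ^ 2 ≤ s ^ 2 * ((1 + L) ^ 2 * ‖x - y‖ ^ 2) := by gcongr
        _ = s * (s * (1 + L) ^ 2) * ‖x - y‖ ^ 2 := by ring
        _ = s * ‖x - y‖ ^ 2 := by rw [hs1, mul_one]
    nlinarith
  have hc : ContractingWith (Real.toNNReal (Real.sqrt (1 - s))) F := by
    constructor
    · rw [Real.toNNReal_lt_one, Real.sqrt_lt' one_pos]
      linarith
    · refine LipschitzWith.of_dist_le_mul fun x y => ?_
      rw [Real.coe_toNNReal _ (Real.sqrt_nonneg _), dist_eq_norm, dist_eq_norm]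
      exact hF x y
  obtain ⟨x, hx⟩ : ∃ x, F x = x := ⟨_, hc.fixedPoint_isFixedPt⟩
  refine ⟨x, yosida s A (x - s • (x + T x - z)), ?_, ?_⟩
  · have := hA.yosida_mem hs0 (x - s • (x + T x - z))
    rwa [show resolvent s A (x - s • (x + T x - z)) = x from hx] at this
  · rw [yosida, show resolvent s A (x - s • (x + T x - z)) = x from hx, sub_sub_cancel_left,
      smul_neg, smul_smul, inv_mul_cancel₀ hs0.ne', one_smul]
    abel

end Sum

end RandomMonotone

namespace RandomMonotone

/-! ### The implicit Euler scheme and its comparison with solutions. -/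

section Euler

variable {E : Type*} [NormedAddCommGroup E] [InnerProductSpace ℝ E]

/-- The implicit Euler scheme with step `h`. -/
noncomputable def euler (H : E → Set E) (h : ℝ) (z : E) (k : ℕ) : E := (resolvent h H)^[k] z

@[simp]
theorem euler_zero (H : E → Set E) (h : ℝ) (z : E) : euler H h z 0 = z := rfl

theorem euler_succ (H : E → Set E) (h : ℝ) (z : E) (k : ℕ) :
    euler H h z (k + 1) = resolvent h H (euler H h z k) := Function.iterate_succ_apply' _ _ _

variable [FiniteDimensional ℝ E] {H : E → Set E} {h : ℝ}

theorem IsMaximalMonotone.yosida_euler_mem (hH : IsMaximalMonotone H) (hh : 0 < h) (z : E)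
    (k : ℕ) : yosida h H (euler H h z k) ∈ H (euler H h z (k + 1)) := by
  rw [euler_succ]
  exact hH.yosida_mem hh _

theorem IsMaximalMonotone.norm_yosida_euler_le (hH : IsMaximalMonotone H) (hh : 0 < h) {z v : E}
    (hv : v ∈ H z) (k : ℕ) : ‖yosida h H (euler H h z k)‖ ≤ ‖v‖ := by
  induction k with
  | zero => exact hH.norm_yosida_le hh hv
  | succ k ih => exact (hH.norm_yosida_le hh (hH.yosida_euler_mem hh z k)).trans ih

theorem IsMaximalMonotone.norm_euler_sub_euler_le (hH : IsMaximalMonotone H) (hh : 0 < h)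
    (z z' : E) (k : ℕ) : ‖euler H h z k - euler H h z' k‖ ≤ ‖z - z'‖ := by
  induction k with
  | zero => exact le_rfl
  | succ k ih =>
    rw [euler_succ, euler_succ]
    exact (hH.norm_resolvent_sub_le hh _ _).trans ih

theorem IsMaximalMonotone.norm_euler_add_sub_le (hH : IsMaximalMonotone H) (hh : 0 < h) {z v : E}
    (hv : v ∈ H z) (j m : ℕ) : ‖euler H h z (j + m) - euler H h z j‖ ≤ m * h * ‖v‖ := by
  induction m with
  | zero => simp
  | succ m ih =>
    rw [← add_assoc, euler_succ, resolvent_eq_sub hh]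
    have h1 := hH.norm_yosida_euler_le hh hv (j + m)
    rw [sub_right_comm]
    refine (norm_sub_le _ _).trans ?_
    rw [norm_smul, Real.norm_eq_abs, abs_of_pos hh]
    push_cast
    nlinarith

/-- The implicit Euler scheme satisfies the evolution variational inequality. -/
theorem IsMaximalMonotone.euler_test (hH : IsMaximalMonotone H) (hh : 0 < h) {z v : E}
    (hv : v ∈ H z) {y w : E} (hw : w ∈ H y) (j m : ℕ) :
    ‖euler H h z (j + m) - y‖ ^ 2 / 2 ≤ ‖euler H h z j - y‖ ^ 2 / 2
      + m * h * ⟪w, y - euler H h z j⟫ + (m * h) ^ 2 * (‖w‖ * ‖v‖) := by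
  induction m with
  | zero => simp
  | succ m ih =>
    have h1 : ‖euler H h z (j + m + 1) - y‖ ^ 2 / 2 ≤ ‖euler H h z (j + m) - y‖ ^ 2 / 2
        + h * ⟪w, y - euler H h z (j + m + 1)⟫ := by
      have h2 := hH.inner_nonneg (hH.yosida_euler_mem hh z (j + m)) hw
      have e : euler H h z (j + m) - y = (euler H h z (j + m + 1) - y)
          + h • yosida h H (euler H h z (j + m)) := by
        rw [euler_succ, sub_add_eq_add_sub, resolvent_add_smul_yosida hh]
      rw [e, norm_add_sq_real, real_inner_smul_right, real_inner_comm,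
        ← neg_sub (euler H h z (j + m + 1)) y, inner_neg_right]
      rw [inner_sub_left] at h2
      nlinarith [sq_nonneg ‖h • yosida h H (euler H h z (j + m))‖]
    -- The pairing is frozen at time `j`. The displacement since then is at most `(m + 1) h ‖v‖`,
    -- and these errors, each multiplied by `h`, sum to the quadratic term.
    have h3 : ⟪w, y - euler H h z (j + m + 1)⟫ ≤ ⟪w, y - euler H h z j⟫
        + ‖w‖ * ((m + 1) * h * ‖v‖) := by
      have e : y - euler H h z (j + m + 1) = (y - euler H h z j)
          - (euler H h z (j + (m + 1)) - euler H h z j) := by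
        rw [← add_assoc]; abel
      have h4 := hH.norm_euler_add_sub_le hh hv j (m + 1)
      push_cast at h4
      have h5 := neg_le_of_abs_le
        (abs_real_inner_le_norm w (euler H h z (j + (m + 1)) - euler H h z j))
      have h6 := mul_le_mul_of_nonneg_left h4 (norm_nonneg w)
      rw [e, inner_sub_right]
      linarith
    rw [← add_assoc]
    push_cast
    have h7 := mul_le_mul_of_nonneg_left h3 hh.le
    have h8 : 0 ≤ (m : ℝ) * h * h * (‖w‖ * ‖v‖) := by positivity
    nlinarith

/-- A sequence satisfying a perturbed evolution variational inequality stays close to the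
implicit Euler scheme. -/
theorem IsMaximalMonotone.euler_compare (hH : IsMaximalMonotone H) (hh : 0 < h) (z : E)
    (x : ℕ → E) {κ : ℝ} {n : ℕ}
    (hx : ∀ k < n, ∀ y, y = euler H h z (k + 1) → ∀ w ∈ H y, w = yosida h H (euler H h z k) →
      ‖x (k + 1) - y‖ ^ 2 / 2 ≤ ‖x k - y‖ ^ 2 / 2 + h * ⟪w, y - x k⟫ + κ) :
    ‖x n - euler H h z n‖ ^ 2 / 2 ≤ ‖x 0 - z‖ ^ 2 / 2 + n * κ := by
  induction n with
  | zero => simp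
  | succ n ih =>
    have h1 := ih fun k hk => hx k (hk.trans (Nat.lt_succ_self n))
    have h2 := hx n (Nat.lt_succ_self n) _ rfl _ (hH.yosida_euler_mem hh z n) rfl
    set w := yosida h H (euler H h z n)
    have e : euler H h z (n + 1) = euler H h z n - h • w := by
      rw [euler_succ, resolvent_eq_sub hh]
    -- Since the scheme moves by `-h • w`, moving the centre back to its previous position produces
    -- exactly the linear term of the test, plus a square of favourable sign.
    have h3 : ‖x n - euler H h z (n + 1)‖ ^ 2 / 2 + h * ⟪w, euler H h z (n + 1) - x n⟫
        ≤ ‖x n - euler H h z n‖ ^ 2 / 2 := by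
      rw [e, ← sub_add, norm_add_sq_real, real_inner_smul_right, norm_smul, Real.norm_eq_abs,
        abs_of_pos hh, sub_right_comm, inner_sub_right, real_inner_smul_right,
        real_inner_self_eq_norm_sq, ← neg_sub (x n), inner_neg_right, real_inner_comm]
      nlinarith [sq_nonneg (h * ‖w‖)]
    push_cast
    linarith

end Euler

section Solutions

variable {E : Type*} [NormedAddCommGroup E] [InnerProductSpace ℝ E]

theorem le_of_absolutelyContinuous_of_ae_hasDerivAt_nonpos {f : ℝ → ℝ} {a b : ℝ}
    (hab : a ≤ b) (hf : AbsolutelyContinuousOnInterval f a b)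
    (h : ∀ᵐ t, t ∈ Set.Icc a b → ∃ d ≤ 0, HasDerivAt f d t) : f b ≤ f a := by
  have h1 := hf.integral_deriv_eq_sub
  have h2 : ∫ t in a..b, deriv f t ≤ 0 := by
    rw [intervalIntegral.integral_of_le hab]
    refine setIntegral_nonpos_ae measurableSet_Ioc ?_
    filter_upwards [h] with t ht hmem
    obtain ⟨d, hd, hder⟩ := ht (Set.Ioc_subset_Icc_self hmem)
    rwa [hder.deriv]
  linarith

/-- On the interval the curve is bounded, and on a bounded set the squared distance to `y` is
Lipschitz. -/
theorem absolutelyContinuousOnInterval_norm_sub_sq {F : Type*} [NormedAddCommGroup F] {z : ℝ → F}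
    {a b : ℝ} (hz : AbsolutelyContinuousOnInterval z a b) (y : F) :
    AbsolutelyContinuousOnInterval (fun t => ‖z t - y‖ ^ 2) a b := by
  obtain ⟨C, hC⟩ := hz.exists_bound
  have hlip : ∀ s ∈ Set.uIcc a b, ∀ t ∈ Set.uIcc a b,
      dist (‖z s - y‖ ^ 2) (‖z t - y‖ ^ 2) ≤ (2 * (C + ‖y‖)) * dist (z s) (z t) := by
    intro s hs t ht
    rw [Real.dist_eq, dist_eq_norm, sq_sub_sq, abs_mul]
    have h1 := (norm_sub_le (z s) y).trans (add_le_add_left (hC s hs) ‖y‖)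
    have h2 := (norm_sub_le (z t) y).trans (add_le_add_left (hC t ht) ‖y‖)
    have h3 := abs_norm_sub_norm_le (z s - y) (z t - y)
    rw [sub_sub_sub_cancel_right] at h3
    rw [abs_of_nonneg (by positivity)]
    exact mul_le_mul (by linarith) h3 (abs_nonneg _)
      (by linarith [norm_nonneg (z s - y)])
  have hmul := Tendsto.const_mul (2 * (C + ‖y‖)) hz
  rw [mul_zero] at hmul
  refine squeeze_zero' (Eventually.of_forall fun I => Finset.sum_nonneg fun i _ => dist_nonneg)
    ?_ hmul
  have hmem : ∀ᶠ I in AbsolutelyContinuousOnInterval.totalLengthFilter ⊓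
      𝓟 (AbsolutelyContinuousOnInterval.disjWithin a b),
      I ∈ AbsolutelyContinuousOnInterval.disjWithin a b :=
    eventually_inf_principal.2 (Eventually.of_forall fun _ h => h)
  filter_upwards [hmem] with I hI
  rw [Finset.mul_sum]
  exact Finset.sum_le_sum fun i hi => hlip _ (hI.1 i hi).1 _ (hI.1 i hi).2

variable {H : E → Set E}

/-- A solution of the differential inclusion satisfies the evolution variational inequality. -/
theorem IsMaximalMonotone.solution_test (hH : IsMaximalMonotone H) {z₀ : E} {z : ℝ → E}
    (hz : IsSolution H z₀ z) {y w : E} (hw : w ∈ H y) {r s δ : ℝ} (hr : 0 ≤ r) (hrs : r ≤ s)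
    (hδ : ∀ t ∈ Set.Icc r s, ‖z t - z r‖ ≤ δ) :
    ‖z s - y‖ ^ 2 / 2 ≤ ‖z r - y‖ ^ 2 / 2 + (s - r) * ⟪w, y - z r⟫ + (s - r) * (‖w‖ * δ) := by
  have hac : AbsolutelyContinuousOnInterval z r s :=
    (hz.absCont s (hr.trans hrs)).mono (by
      rw [Set.uIcc_of_le hrs, Set.uIcc_of_le (hr.trans hrs)]
      exact Set.Icc_subset_Icc_left hr)
  -- `c` bounds `⟪w, y - z t⟫` on `[r, s]`, so half the squared distance minus `c * t` has
  -- nonpositive derivative almost everywhere.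
  set c := ⟪w, y - z r⟫ + ‖w‖ * δ with hc
  have hid : AbsolutelyContinuousOnInterval (fun t : ℝ => t) r s :=
    ((LipschitzWith.id (α := ℝ)).lipschitzOnWith).absolutelyContinuousOnInterval
  have hf := ((absolutelyContinuousOnInterval_norm_sub_sq hac y).const_mul (1 / 2)).fun_sub
    (hid.const_mul c)
  have hae : ∀ᵐ t, t ∈ Set.Icc r s → ∃ d ≤ 0,
      HasDerivAt (fun t => 1 / 2 * ‖z t - y‖ ^ 2 - c * t) d t := by
    have h1 := (ae_restrict_iff' measurableSet_Ici).1 hz.inclusion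
    filter_upwards [h1] with t ht hmem
    obtain ⟨v, hv, hder⟩ := ht (Set.mem_Ici.2 (hr.trans hmem.1))
    refine ⟨1 / 2 * (2 * ⟪z t - y, -v⟫) - c * 1, ?_,
      (((hder.sub_const y).norm_sq).const_mul (1 / 2)).sub ((hasDerivAt_id t).const_mul c)⟩
    have h2 := hH.inner_nonneg hv hw
    have h3 : ⟪w, y - z t⟫ ≤ c := by
      have e : y - z t = (y - z r) - (z t - z r) := by abel
      have h4 := neg_le_of_abs_le (abs_real_inner_le_norm w (z t - z r))
      have h5 := mul_le_mul_of_nonneg_left (hδ t hmem) (norm_nonneg w)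
      rw [e, inner_sub_right, hc]
      linarith
    rw [inner_neg_right, real_inner_comm]
    rw [inner_sub_left] at h2
    rw [← neg_sub (z t) y, inner_neg_right] at h3
    linarith
  have := le_of_absolutelyContinuous_of_ae_hasDerivAt_nonpos hrs hf hae
  simp only [hc] at this
  linarith

theorem IsSolution.continuousOn {z₀ : E} {z : ℝ → E} (hz : IsSolution H z₀ z) {T : ℝ}
    (hT : 0 ≤ T) : UniformContinuousOn z (Set.Icc 0 T) := by
  have := (hz.absCont T hT).uniformContinuousOn
  rwa [Set.uIcc_of_le hT] at this

variable [FiniteDimensional ℝ E]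

/-- A solution is approximated by the implicit Euler scheme. -/
theorem IsMaximalMonotone.exists_norm_solution_sub_euler_le (hH : IsMaximalMonotone H) {z₀ : E}
    (hz₀ : z₀ ∈ dom H) {z : ℝ → E} (hz : IsSolution H z₀ z) {T ε : ℝ} (hT : 0 ≤ T) (hε : 0 < ε) :
    ∃ h₀ > 0, ∀ h, 0 < h → h < h₀ → ∀ k : ℕ, k * h ≤ T → ‖z (k * h) - euler H h z₀ k‖ ≤ ε := by
  obtain ⟨v, hv⟩ := hz₀
  -- At most `T / h` comparison steps, each with error `h ‖v‖ δ`, must cost at most `ε² / 2` in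
  -- total.
  set δ := ε ^ 2 / (2 * (T * ‖v‖ + 1)) with hδ
  have hδ0 : 0 < δ := by positivity
  obtain ⟨h₀, hh₀, hunif⟩ := Metric.uniformContinuousOn_iff.1 (hz.continuousOn hT) δ hδ0
  refine ⟨h₀, hh₀, fun h hh hlt k hk => ?_⟩
  have hcmp := hH.euler_compare hh z₀ (fun j => z (j * h)) (κ := h * (‖v‖ * δ)) (n := k) (by
    rintro j hj y - w hw hweq
    have hj1 : ((j : ℝ) + 1) * h ≤ T := by
      refine le_trans (mul_le_mul_of_nonneg_right ?_ hh.le) hk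
      exact_mod_cast hj
    have hj0 : 0 ≤ (j : ℝ) * h := by positivity
    have ht := hH.solution_test hz hw (r := j * h) (s := (j + 1) * h) (δ := δ) hj0
      (by nlinarith) (fun t ht => by
        rw [← dist_eq_norm]
        refine (hunif t ⟨hj0.trans ht.1, ht.2.trans hj1⟩ (j * h) ⟨hj0, by nlinarith⟩ ?_).le
        rw [Real.dist_eq, abs_of_nonneg (by linarith [ht.1])]
        nlinarith [ht.2])
    have e : ((j : ℝ) + 1) * h - j * h = h := by ring
    rw [e] at ht
    have hwv : ‖w‖ ≤ ‖v‖ := hweq ▸ hH.norm_yosida_euler_le hh hv j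
    have : h * (‖w‖ * δ) ≤ h * (‖v‖ * δ) := by gcongr
    push_cast
    linarith)
  simp only [Nat.cast_zero, zero_mul, hz.init, sub_self, norm_zero] at hcmp
  have h1 : (k : ℝ) * (h * (‖v‖ * δ)) ≤ T * (‖v‖ * δ) := by
    rw [← mul_assoc]; gcongr
  have h2 : T * (‖v‖ * δ) ≤ ε ^ 2 / 2 := by
    have : (T * ‖v‖ + 1) * δ = ε ^ 2 / 2 := by rw [hδ]; field_simp
    nlinarith
  refine le_of_sq_le_sq ?_ hε.le
  norm_num at hcmp
  linarith

/-- The solutions depend on the initial value in a nonexpansive way. -/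
theorem IsMaximalMonotone.norm_solution_sub_le (hH : IsMaximalMonotone H) {a b : E}
    (ha : a ∈ dom H) (hb : b ∈ dom H) {z z' : ℝ → E} (hz : IsSolution H a z)
    (hz' : IsSolution H b z') {t : ℝ} (ht : 0 ≤ t) : ‖z t - z' t‖ ≤ ‖a - b‖ := by
  refine le_of_forall_pos_le_add fun ε hε => ?_
  obtain ⟨h₁, hh₁, H₁⟩ := hH.exists_norm_solution_sub_euler_le ha hz ht (half_pos hε)
  obtain ⟨h₂, hh₂, H₂⟩ := hH.exists_norm_solution_sub_euler_le hb hz' ht (half_pos hε)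
  rcases ht.eq_or_lt with rfl | ht
  · rw [hz.init, hz'.init]; linarith
  -- With the step `t / n` both schemes reach time `t` exactly after `n` iterations, and they are
  -- nonexpansive in the initial point.
  obtain ⟨n, hn⟩ := exists_nat_gt (t / min h₁ h₂)
  have hmin : 0 < min h₁ h₂ := lt_min hh₁ hh₂
  have hn0 : (0 : ℝ) < n := lt_of_le_of_lt (by positivity) hn
  have hlt : t / n < min h₁ h₂ := by
    rw [div_lt_iff₀ hn0]
    rw [div_lt_iff₀ hmin] at hn
    linarith
  have e : (n : ℝ) * (t / n) = t := by field_simp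
  have A₁ := H₁ (t / n) (by positivity) (hlt.trans_le (min_le_left _ _)) n e.le
  have A₂ := H₂ (t / n) (by positivity) (hlt.trans_le (min_le_right _ _)) n e.le
  have A₃ := hH.norm_euler_sub_euler_le (h := t / n) (by positivity) a b n
  rw [e] at A₁ A₂
  have e2 : z t - z' t = (z t - euler H (t / n) a n) + (euler H (t / n) a n - euler H (t / n) b n)
      - (z' t - euler H (t / n) b n) := by abel
  rw [e2]
  refine (norm_sub_le _ _).trans ?_
  linarith [norm_add_le (z t - euler H (t / n) a n) (euler H (t / n) a n - euler H (t / n) b n)]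

end Solutions

end RandomMonotone

namespace RandomMonotone

/-! ### Existence of solutions and of the semiflow. -/

section Existence

variable {E : Type*} [NormedAddCommGroup E] [InnerProductSpace ℝ E] [FiniteDimensional ℝ E]
  {H : E → Set E}

theorem tendsto_floor_div_mul {h : ℕ → ℝ} (hpos : ∀ n, 0 < h n) (h0 : Tendsto h atTop (𝓝 0))
    {t : ℝ} (ht : 0 ≤ t) : Tendsto (fun n => (⌊t / h n⌋₊ : ℝ) * h n) atTop (𝓝 t) := by
  have hl : Tendsto (fun n => t - h n) atTop (𝓝 t) := by
    simpa using h0.const_sub t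
  refine tendsto_of_tendsto_of_tendsto_of_le_of_le hl tendsto_const_nhds (fun n => ?_) fun n => ?_
  · have h1 := (Nat.lt_floor_add_one (t / h n)).le
    rw [div_le_iff₀ (hpos n)] at h1
    dsimp only
    linarith
  · have h1 := Nat.floor_le (div_nonneg ht (hpos n).le)
    rwa [le_div_iff₀ (hpos n)] at h1

/-- Refining the step of the implicit Euler scheme. -/
theorem IsMaximalMonotone.norm_euler_refine_le (hH : IsMaximalMonotone H) {z v : E}
    (hv : v ∈ H z) {h : ℝ} (hh : 0 < h) {m : ℕ} (hm : 0 < m) {t : ℝ} (ht : 0 ≤ t) :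
    ‖euler H (h / m) z ⌊t / (h / m)⌋₊ - euler H h z ⌊t / h⌋₊‖
      ≤ ‖v‖ * (h + Real.sqrt (2 * t * h)) := by
  have hm0 : (0 : ℝ) < m := by exact_mod_cast hm
  have hh' : 0 < h / m := by positivity
  set k := ⌊t / h⌋₊ with hk
  set j := ⌊t / (h / m)⌋₊ with hj
  have htdiv : t / (h / m) = m * (t / h) := by field_simp
  have hkt : (k : ℝ) ≤ t / h := Nat.floor_le (by positivity)
  have hkt' : t / h < k + 1 := Nat.lt_floor_add_one _
  have h1 : m * k ≤ j := by
    refine Nat.le_floor ?_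
    rw [htdiv]
    push_cast
    gcongr
  have h2 : j < m * (k + 1) := by
    rw [hj, Nat.floor_lt (by positivity), htdiv]
    push_cast
    gcongr
  obtain ⟨r, hr⟩ := Nat.exists_eq_add_of_le h1
  have hrm : (r : ℝ) ≤ m := by
    have : r ≤ m := by
      rw [hr, mul_add, mul_one] at h2
      omega
    exact_mod_cast this
  -- The `r ≤ m` fine steps left after the last full coarse step cover a time of at most `h`.
  have hA : ‖euler H (h / m) z j - euler H (h / m) z (m * k)‖ ≤ ‖v‖ * h := by
    rw [hr]
    refine (hH.norm_euler_add_sub_le hh' hv (m * k) r).trans ?_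
    have : (r : ℝ) * (h / m) ≤ h := by
      calc (r : ℝ) * (h / m) ≤ m * (h / m) := by gcongr
        _ = h := by field_simp
    rw [mul_comm]
    gcongr
  -- Blocks of `m` fine steps are tested at the graph points of the coarse scheme. The error is `h²
  -- ‖v‖²` per block, over at most `t / h` blocks.
  have hB : ‖euler H (h / m) z (m * k) - euler H h z k‖ ≤ ‖v‖ * Real.sqrt (2 * t * h) := by
    have hcmp := hH.euler_compare hh z (fun i => euler H (h / m) z (m * i))
      (κ := h ^ 2 * (‖v‖ * ‖v‖)) (n := k) (by
        rintro i - y - w hw hweq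
        have h3 := hH.euler_test hh' hv hw (m * i) m
        have e : (m : ℝ) * (h / m) = h := by field_simp
        have hwv : ‖w‖ ≤ ‖v‖ := hweq ▸ hH.norm_yosida_euler_le hh hv i
        have h4 : h ^ 2 * (‖w‖ * ‖v‖) ≤ h ^ 2 * (‖v‖ * ‖v‖) := by gcongr
        rw [e] at h3
        rw [mul_add, mul_one]
        linarith)
    simp only [mul_zero, euler_zero, sub_self, norm_zero] at hcmp
    have h5 : (k : ℝ) * (h ^ 2 * (‖v‖ * ‖v‖)) ≤ t * h * ‖v‖ ^ 2 := by
      rw [le_div_iff₀ hh] at hkt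
      calc (k : ℝ) * (h ^ 2 * (‖v‖ * ‖v‖)) = (k * h) * (h * ‖v‖ ^ 2) := by ring
        _ ≤ t * (h * ‖v‖ ^ 2) := by gcongr
        _ = t * h * ‖v‖ ^ 2 := by ring
    refine le_of_sq_le_sq ?_ (by positivity)
    rw [mul_pow, Real.sq_sqrt (by positivity)]
    norm_num at hcmp
    linarith
  have e : euler H (h / m) z j - euler H h z k = (euler H (h / m) z j - euler H (h / m) z (m * k))
      + (euler H (h / m) z (m * k) - euler H h z k) := by abel
  rw [e]
  refine (norm_add_le _ _).trans ?_
  linarith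

/-- Along the steps `2⁻ⁿ`, the implicit Euler scheme converges. -/
theorem IsMaximalMonotone.exists_tendsto_euler (hH : IsMaximalMonotone H) {z : E}
    (hz : z ∈ dom H) {t : ℝ} (ht : 0 ≤ t) :
    ∃ x, Tendsto (fun n : ℕ => euler H ((1 / 2) ^ n) z ⌊t / (1 / 2) ^ n⌋₊) atTop (𝓝 x) := by
  obtain ⟨v, hv⟩ := hz
  have h0 : Tendsto (fun n : ℕ => ((1 : ℝ) / 2) ^ n) atTop (𝓝 0) :=
    tendsto_pow_atTop_nhds_zero_of_lt_one (by norm_num) (by norm_num)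
  have hb : Tendsto (fun n : ℕ => ‖v‖ * ((1 / 2 : ℝ) ^ n + Real.sqrt (2 * t * (1 / 2) ^ n))) atTop
      (𝓝 0) := by
    have := (h0.add ((h0.const_mul (2 * t)).sqrt)).const_mul ‖v‖
    simpa using this
  refine cauchySeq_tendsto_of_complete (cauchySeq_of_le_tendsto_0
    (fun N : ℕ => ‖v‖ * ((1 / 2 : ℝ) ^ N + Real.sqrt (2 * t * (1 / 2) ^ N))
      + ‖v‖ * ((1 / 2 : ℝ) ^ N + Real.sqrt (2 * t * (1 / 2) ^ N))) (fun n m N hn hm => ?_)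
    (by rw [← add_zero (0 : ℝ)]; exact hb.add hb))
  have key : ∀ n, N ≤ n →
      dist (euler H ((1 / 2) ^ n) z ⌊t / (1 / 2) ^ n⌋₊)
        (euler H ((1 / 2) ^ N) z ⌊t / (1 / 2) ^ N⌋₊) ≤
      ‖v‖ * ((1 / 2 : ℝ) ^ N + Real.sqrt (2 * t * (1 / 2) ^ N)) := by
    intro n hn
    obtain ⟨p, rfl⟩ := Nat.exists_eq_add_of_le hn
    have e : ((1 : ℝ) / 2) ^ (N + p) = (1 / 2) ^ N / ((2 ^ p : ℕ) : ℝ) := by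
      rw [pow_add, div_eq_mul_inv ((1 / 2 : ℝ) ^ N)]
      congr 1
      push_cast
      rw [one_div, inv_pow]
    rw [e, dist_eq_norm]
    exact hH.norm_euler_refine_le hv (by positivity) (by positivity) ht
  exact (dist_triangle_right _ _ _).trans (add_le_add (key n hn) (key m hm))

/-- Existence of solutions of the differential inclusion. -/
theorem IsMaximalMonotone.exists_solution (hH : IsMaximalMonotone H) {z₀ : E} (hz₀ : z₀ ∈ dom H) :
    ∃ z : ℝ → E, IsSolution H z₀ z ∧ (∀ t, z t ∈ closure (dom H)) ∧ ∀ t, z t = z (max t 0) := by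
  have hpos : ∀ n : ℕ, (0 : ℝ) < (1 / 2) ^ n := fun n => by positivity
  have h0 : Tendsto (fun n : ℕ => ((1 : ℝ) / 2) ^ n) atTop (𝓝 0) :=
    tendsto_pow_atTop_nhds_zero_of_lt_one (by norm_num) (by norm_num)
  choose! ζ hζ using fun t (ht : (0 : ℝ) ≤ t) => hH.exists_tendsto_euler hz₀ ht
  obtain ⟨v, hv⟩ := hz₀
  -- The variational inequality of the scheme survives the limit of the steps; it is all that is
  -- needed to recover the inclusion.
  have htest : ∀ r s, 0 ≤ r → r ≤ s → ∀ y, ∀ w ∈ H y,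
      ‖ζ s - y‖ ^ 2 / 2 ≤ ‖ζ r - y‖ ^ 2 / 2 + (s - r) * ⟪w, y - ζ r⟫
        + (s - r) ^ 2 * (‖w‖ * ‖v‖) := by
    intro r s hr hrs y w hw
    have hs := hr.trans hrs
    have hfl := (tendsto_floor_div_mul hpos h0 hs).sub (tendsto_floor_div_mul hpos h0 hr)
    refine le_of_tendsto_of_tendsto' ((((hζ s hs).sub_const y).norm.pow 2).div_const 2)
      (((((hζ r hr).sub_const y).norm.pow 2).div_const 2).add
        (hfl.mul (tendsto_const_nhds.inner ((hζ r hr).const_sub y))) |>.add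
          ((hfl.pow 2).mul_const (‖w‖ * ‖v‖))) fun n => ?_
    have hle : ⌊r / (1 / 2 : ℝ) ^ n⌋₊ ≤ ⌊s / (1 / 2 : ℝ) ^ n⌋₊ := by gcongr
    obtain ⟨m, hm⟩ := Nat.exists_eq_add_of_le hle
    have h3 := hH.euler_test (hpos n) hv hw ⌊r / (1 / 2 : ℝ) ^ n⌋₊ m
    rw [hm]
    push_cast
    rw [add_mul, add_sub_cancel_left]
    exact h3
  have hlip : ∀ r s, 0 ≤ r → r ≤ s → ‖ζ s - ζ r‖ ≤ ‖v‖ * (s - r) := by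
    intro r s hr hrs
    have hs := hr.trans hrs
    have hfl := (tendsto_floor_div_mul hpos h0 hs).sub (tendsto_floor_div_mul hpos h0 hr)
    refine le_of_tendsto_of_tendsto' ((hζ s hs).sub (hζ r hr)).norm (hfl.const_mul ‖v‖)
      fun n => ?_
    have hle : ⌊r / (1 / 2 : ℝ) ^ n⌋₊ ≤ ⌊s / (1 / 2 : ℝ) ^ n⌋₊ := by gcongr
    obtain ⟨m, hm⟩ := Nat.exists_eq_add_of_le hle
    have h3 := hH.norm_euler_add_sub_le (hpos n) hv ⌊r / (1 / 2 : ℝ) ^ n⌋₊ m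
    rw [hm]
    push_cast
    rw [add_mul, add_sub_cancel_left, mul_comm ‖v‖]
    exact h3
  -- Freezing the curve at negative times makes it Lipschitz on the whole line, hence absolutely
  -- continuous and almost everywhere differentiable.
  have hlipZ : LipschitzWith (Real.toNNReal ‖v‖) fun t => ζ (max t 0) := by
    refine LipschitzWith.of_dist_le_mul fun s t => ?_
    rw [Real.coe_toNNReal _ (norm_nonneg _), dist_eq_norm, Real.dist_eq]
    have h1 := abs_max_sub_max_le_abs s t 0
    refine le_trans ?_ (mul_le_mul_of_nonneg_left h1 (norm_nonneg v))
    rcases le_total (max s 0) (max t 0) with h | h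
    · rw [norm_sub_rev, abs_sub_comm, abs_of_nonneg (sub_nonneg.2 h)]
      exact hlip _ _ (le_max_right _ _) h
    · rw [abs_of_nonneg (sub_nonneg.2 h)]
      exact hlip _ _ (le_max_right _ _) h
  refine ⟨fun t => ζ (max t 0), ⟨?_, ?_, ?_⟩, fun t => ?_, fun t => by simp⟩
  · have h1 := hζ 0 le_rfl
    simp only [zero_div, Nat.floor_zero, euler_zero] at h1
    rw [max_self]
    exact tendsto_nhds_unique h1 tendsto_const_nhds
  · exact fun T _ => hlipZ.lipschitzOnWith.absolutelyContinuousOnInterval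
  · rw [ae_restrict_iff' measurableSet_Ici]
    filter_upwards [hlipZ.ae_differentiableAt_real] with t hdiff ht
    refine ⟨-deriv (fun t => ζ (max t 0)) t, hH.mem_of_forall fun y w hw => ?_, by
      rw [neg_neg]; exact hdiff.hasDerivAt⟩
    set Z := fun t => ζ (max t 0) with hZ
    have ht0 : max t 0 = t := max_eq_left ht
    have hder : HasDerivAt (fun s => ‖Z s - y‖ ^ 2) (2 * ⟪Z t - y, deriv Z t⟫) t :=
      (hdiff.hasDerivAt.sub_const y).norm_sq
    -- Dividing `htest` by `s - t` and letting `s ↓ t` shows that minus the derivative is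
    -- monotonically related to the graph; maximality then yields the inclusion.
    have hslope : Tendsto (slope (fun s => ‖Z s - y‖ ^ 2) t) (𝓝[>] t)
        (𝓝 (2 * ⟪Z t - y, deriv Z t⟫)) :=
      hder.tendsto_slope.mono_left (nhdsWithin_mono _ fun s hs => ne_of_gt hs)
    have hbound : Tendsto (fun s => 2 * (⟪w, y - Z t⟫ + (s - t) * (‖w‖ * ‖v‖))) (𝓝[>] t)
        (𝓝 (2 * (⟪w, y - Z t⟫ + (t - t) * (‖w‖ * ‖v‖)))) := by
      refine Tendsto.mono_left (Continuous.tendsto (by fun_prop) t) nhdsWithin_le_nhds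
    have hle := le_of_tendsto_of_tendsto hslope hbound (by
      filter_upwards [self_mem_nhdsWithin] with s hs
      have hs' : t < s := hs
      have h1 := htest t s ht hs'.le y w hw
      have es : Z s = ζ s := by simp [hZ, max_eq_left (ht.out.trans hs'.le)]
      have et : Z t = ζ t := by simp [hZ, ht0]
      rw [slope_def_field, div_le_iff₀ (sub_pos.2 hs'), es, et]
      nlinarith)
    rw [sub_self, zero_mul, add_zero] at hle
    have h2 : ⟪deriv Z t, Z t - y⟫ ≤ ⟪w, y - Z t⟫ := by
      rw [real_inner_comm]; linarith
    rw [inner_sub_left, inner_neg_left]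
    rw [← neg_sub (Z t) y, inner_neg_right] at h2
    linarith
  · refine mem_closure_of_tendsto ((tendsto_add_atTop_iff_nat 1).2
      (hζ (max t 0) (le_max_right _ _))) (Eventually.of_forall fun n => ?_)
    rcases Nat.eq_zero_or_pos ⌊max t 0 / (1 / 2 : ℝ) ^ (n + 1)⌋₊ with h | h
    · rw [h]; exact ⟨v, hv⟩
    · obtain ⟨k, hk⟩ := Nat.exists_eq_add_of_lt h
      rw [hk, zero_add]
      exact ⟨_, hH.yosida_euler_mem (hpos _) z₀ k⟩

/-- A maximal monotone operator generates a semiflow. -/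
theorem IsMaximalMonotone.exists_semiflow (hH : IsMaximalMonotone H) : ∃ Φ, IsSemiflow H Φ := by
  classical
  choose! S hS hSmem hSmax using fun z₀ (hz₀ : z₀ ∈ dom H) => hH.exists_solution hz₀
  have hcontr : ∀ t, ∀ a ∈ dom H, ∀ b ∈ dom H, ‖S a t - S b t‖ ≤ ‖a - b‖ := by
    intro t a ha b hb
    rw [hSmax a ha t, hSmax b hb t]
    exact hH.norm_solution_sub_le ha hb (hS a ha) (hS b hb) (le_max_right _ _)
  have hunif : ∀ t, UniformContinuousOn (fun z => S z t) (dom H) := fun t =>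
    (LipschitzOnWith.of_dist_le_mul (K := 1) fun a ha b hb => by
      simpa [dist_eq_norm] using hcontr t a ha b hb).uniformContinuousOn
  -- Nonexpansiveness makes each time-`t` map uniformly continuous on the domain, so it has limits
  -- at all points of the closure.
  have hlim : ∀ t, ∀ x ∈ closure (dom H), ∃ y, Tendsto (fun z => S z t) (𝓝[dom H] x) (𝓝 y) := by
    intro t x hx
    have hne : (𝓝[dom H] x).NeBot := mem_closure_iff_nhdsWithin_neBot.1 hx
    have hc : Cauchy (𝓝[dom H] x) := cauchy_nhds.mono inf_le_left
    exact cauchy_iff_exists_le_nhds.1 (hc.map_of_le (hunif t) inf_le_right)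
  have heq : ∀ z ∈ dom H, ∀ t, extendFrom (dom H) (fun z => S z t) z = S z t := fun z hz t =>
    extendFrom_eq (subset_closure hz) ((hunif t).continuousOn z hz)
  refine ⟨fun z t => extendFrom (dom H) (fun z => S z t) z, fun t _ x hx => ?_, fun z hz => ?_,
    fun t _ => continuousOn_extendFrom subset_rfl (hlim t)⟩
  · have hne : (𝓝[dom H] x).NeBot := mem_closure_iff_nhdsWithin_neBot.1 hx
    refine isClosed_closure.mem_of_tendsto (tendsto_extendFrom (hlim t x hx)) ?_
    filter_upwards [self_mem_nhdsWithin] with z hz using hSmem z hz t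
  · have : (fun t => extendFrom (dom H) (fun z => S z t) z) = S z := funext fun t => heq z hz t
    rw [this]
    exact hS z hz

/-- Every semiflow of a maximal monotone operator is nonexpansive. -/
theorem IsMaximalMonotone.norm_semiflow_sub_le (hH : IsMaximalMonotone H) {Φ : E → ℝ → E}
    (hΦ : IsSemiflow H Φ) {a b : E} (ha : a ∈ closure (dom H)) (hb : b ∈ dom H) {t : ℝ}
    (ht : 0 ≤ t) : ‖Φ a t - Φ b t‖ ≤ ‖a - b‖ := by
  have hne : (𝓝[dom H] a).NeBot := mem_closure_iff_nhdsWithin_neBot.1 ha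
  have h1 : Tendsto (fun z => Φ z t) (𝓝[dom H] a) (𝓝 (Φ a t)) :=
    (hΦ.continuousOn t ht a ha).mono_left (nhdsWithin_mono _ subset_closure)
  have h2 : Tendsto (fun z => z) (𝓝[dom H] a) (𝓝 a) := nhdsWithin_le_nhds
  refine le_of_tendsto_of_tendsto (h1.sub_const _).norm (h2.sub_const b).norm ?_
  filter_upwards [self_mem_nhdsWithin] with z hz
  exact hH.norm_solution_sub_le hz hb (hΦ.solution z hz) (hΦ.solution b hb) ht

end Existence

end RandomMonotone

namespace RandomMonotone

/-! ### From asymptotic variational inequalities to asymptotic pseudo-trajectories. -/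

section PseudoTrajectory

variable {E : Type*} [NormedAddCommGroup E] [InnerProductSpace ℝ E]

/-- The curve `X` asymptotically satisfies the evolution variational inequalities of
`ż ∈ -H z`. -/
def AsymptoticTest (H : E → Set E) (X : ℝ → E) : Prop :=
  ∀ y, ∀ w ∈ H y, ∀ η > 0, ∀ᶠ r : ℝ in atTop, ∀ s δ : ℝ, r ≤ s →
    (∀ t ∈ Set.Icc r s, ‖X t - X r‖ ≤ δ) →
      ‖X s - y‖ ^ 2 / 2 ≤ ‖X r - y‖ ^ 2 / 2 + (s - r) * ⟪w, y - X r⟫ + (s - r) * (‖w‖ * δ)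
        + η * (1 + (s - r))

variable [FiniteDimensional ℝ E] {H : E → Set E} {X : ℝ → E} {R : ℝ}

/-- The net lies in `D` itself, so that when `D` is a domain each of its points carries a value of
the operator, while the points approximated need only be near `D`. This costs the factor `2`. -/
theorem exists_finite_net {E : Type*} [NormedAddCommGroup E] [ProperSpace E] {D : Set E}
    (hD : D.Nonempty) (R : ℝ) {δ : ℝ}
    (hδ : 0 < δ) :
    ∃ F ⊆ D, F.Finite ∧ ∀ p, ‖p‖ ≤ R → Metric.infDist p D < δ → ∃ y ∈ F, ‖p - y‖ < 2 * δ := by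
  have htb : TotallyBounded (D ∩ Metric.closedBall 0 (R + δ)) :=
    (isCompact_closedBall (0 : E) (R + δ)).totallyBounded.subset Set.inter_subset_right
  obtain ⟨F, hF, hfin, hcov⟩ := Metric.finite_approx_of_totallyBounded htb δ hδ
  refine ⟨F, hF.trans Set.inter_subset_left, hfin, fun p hp hpD => ?_⟩
  obtain ⟨q, hq, hpq⟩ := (Metric.infDist_lt_iff hD).1 hpD
  have hqmem : q ∈ D ∩ Metric.closedBall 0 (R + δ) := by
    refine ⟨hq, ?_⟩
    rw [mem_closedBall_zero_iff]
    have := norm_le_norm_add_norm_sub' q p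
    rw [dist_comm, dist_eq_norm] at hpq
    linarith
  obtain ⟨y, hy, hqy⟩ := Set.mem_iUnion₂.1 (hcov hqmem)
  refine ⟨y, hy, ?_⟩
  rw [← dist_eq_norm]
  rw [Metric.mem_ball] at hqy
  linarith [dist_triangle p q y]

/-- Asymptotic equicontinuity. -/
theorem AsymptoticTest.equicontinuous (hX : AsymptoticTest H X) (hne : (dom H).Nonempty)
    (hR : ∀ t, 0 ≤ t → ‖X t‖ ≤ R)
    (hdist : Tendsto (fun t => Metric.infDist (X t) (dom H)) atTop (𝓝 0)) {ε : ℝ} (hε : 0 < ε) :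
    ∃ h > 0, ∀ᶠ t : ℝ in atTop, ∀ s ∈ Set.Icc t (t + h), ‖X s - X t‖ ≤ ε := by
  have hR0 : 0 ≤ R := (norm_nonneg _).trans (hR 0 le_rfl)
  set δ := ε / 5 with hδ
  have hδ0 : 0 < δ := by positivity
  obtain ⟨F, hF, hfin, hnet⟩ := exists_finite_net hne R hδ0
  choose! v hv using fun y (hy : y ∈ dom H) => (show (H y).Nonempty from hy)
  obtain ⟨C, hC⟩ : ∃ C, ∀ y ∈ F, ‖v y‖ * (‖y‖ + 3 * R) ≤ C := by
    obtain ⟨C, hC⟩ := (hfin.image fun y => ‖v y‖ * (‖y‖ + 3 * R)).bddAbove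
    exact ⟨C, fun y hy => hC (Set.mem_image_of_mem _ hy)⟩
  refine ⟨min 1 (δ ^ 2 / (2 * (|C| + 1))), by positivity, ?_⟩
  -- Only the finitely many net points are tested, so one threshold works for all of them. The crude
  -- oscillation `2 * R` suffices, since the time increment is chosen small.
  have htests : ∀ᶠ r : ℝ in atTop, ∀ y ∈ F, ∀ s δ' : ℝ, r ≤ s →
      (∀ t ∈ Set.Icc r s, ‖X t - X r‖ ≤ δ') →
      ‖X s - y‖ ^ 2 / 2 ≤ ‖X r - y‖ ^ 2 / 2 + (s - r) * ⟪v y, y - X r⟫ + (s - r) * (‖v y‖ * δ')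
        + δ ^ 2 / 2 * (1 + (s - r)) :=
    (eventually_all_finite hfin).2 fun y hy => hX y (v y) (hv y (hF hy)) _ (by positivity)
  filter_upwards [htests, hdist.eventually_lt_const hδ0, eventually_ge_atTop 0]
    with t htest htd ht0 s hs
  obtain ⟨y, hy, hty⟩ := hnet (X t) (hR t ht0) htd
  have h1 := htest y hy s (2 * R) hs.1 (fun t' ht' => by
    refine (norm_sub_le _ _).trans ?_
    linarith [hR t' (ht0.trans ht'.1), hR t ht0])
  have hst1 : s - t ≤ 1 := by linarith [hs.2, min_le_left 1 (δ ^ 2 / (2 * (|C| + 1)))]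
  have hst2 : s - t ≤ δ ^ 2 / (2 * (|C| + 1)) := by
    linarith [hs.2, min_le_right 1 (δ ^ 2 / (2 * (|C| + 1)))]
  have hst0 : 0 ≤ s - t := by linarith [hs.1]
  have h2 : ⟪v y, y - X t⟫ + ‖v y‖ * (2 * R) ≤ |C| := by
    have h3 := real_inner_le_norm (v y) (y - X t)
    have h4 : ‖y - X t‖ ≤ ‖y‖ + R := (norm_sub_le _ _).trans (by linarith [hR t ht0])
    have h5 := mul_le_mul_of_nonneg_left h4 (norm_nonneg (v y))
    have h6 := hC y hy
    have h7 := le_abs_self C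
    nlinarith
  have h3 : (s - t) * (⟪v y, y - X t⟫ + ‖v y‖ * (2 * R)) ≤ δ ^ 2 / 2 := by
    calc (s - t) * (⟪v y, y - X t⟫ + ‖v y‖ * (2 * R)) ≤ (s - t) * |C| := by gcongr
      _ ≤ (s - t) * (|C| + 1) := by nlinarith
      _ ≤ δ ^ 2 / (2 * (|C| + 1)) * (|C| + 1) := by gcongr
      _ = δ ^ 2 / 2 := by field_simp
  have h4 : ‖X t - y‖ ^ 2 ≤ (2 * δ) ^ 2 := by gcongr
  have h5 : ‖X s - y‖ ≤ 3 * δ := by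
    refine le_of_sq_le_sq ?_ (by positivity)
    nlinarith
  have e : X s - X t = (X s - y) - (X t - y) := by abel
  rw [e]
  refine (norm_sub_le _ _).trans ?_
  linarith

/-- A bounded curve that approaches the domain and asymptotically satisfies the evolution
variational inequalities is an asymptotic pseudo-trajectory. -/
theorem AsymptoticTest.isAPT (hX : AsymptoticTest H X) (hH : IsMaximalMonotone H)
    (hR : ∀ t, 0 ≤ t → ‖X t‖ ≤ R)
    (hdist : Tendsto (fun t => Metric.infDist (X t) (dom H)) atTop (𝓝 0)) {Y : ℝ → E}
    (hY : Tendsto (fun t => ‖Y t - X t‖) atTop (𝓝 0)) {Φ : E → ℝ → E} (hΦ : IsSemiflow H Φ) :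
    IsAPT (closure (dom H)) Φ Y := by
  have hne := hH.dom_nonempty
  intro T hT
  rw [ENNReal.tendsto_nhds_zero]
  intro ε' hε'
  obtain ⟨ε, hε, hεε'⟩ : ∃ ε : ℝ, 0 < ε ∧ ENNReal.ofReal ε ≤ ε' := by
    rcases eq_or_ne ε' ∞ with rfl | h
    · exact ⟨1, one_pos, le_top⟩
    · exact ⟨ε'.toReal, ENNReal.toReal_pos hε'.ne' h, ENNReal.ofReal_toReal_le⟩
  -- The final error consists of five terms equal to `δ`, `δ`, `4 δ`, `δ`, `δ`, and of `5 δ` from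
  -- the change of the initial point of the semiflow.
  set δ := ε / 13 with hδ
  have hδ0 : 0 < δ := by positivity
  obtain ⟨F, hF, hfin, hnet⟩ := exists_finite_net hne R hδ0
  choose! v hv using fun y (hy : y ∈ dom H) => (show (H y).Nonempty from hy)
  obtain ⟨V', hV'⟩ : ∃ C, ∀ y ∈ F, ‖v y‖ ≤ C := by
    obtain ⟨C, hC⟩ := (hfin.image fun y => ‖v y‖).bddAbove
    exact ⟨C, fun y hy => hC (Set.mem_image_of_mem _ hy)⟩
  set V := |V'|
  have hV : ∀ y ∈ F, ‖v y‖ ≤ V := fun y hy => (hV' y hy).trans (le_abs_self _)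
  set ε₁ := min δ (δ ^ 2 / (2 * (T * V + 1))) with hε₁
  have hTV : 0 ≤ T * V := by positivity
  have hε₁0 : 0 < ε₁ := by positivity
  obtain ⟨h₂, hh₂, hosc⟩ := hX.equicontinuous hne hR hdist hε₁0
  -- One step `h` is fixed for which the scheme follows the semiflow from every net point, and the
  -- semiflow varies little within a step.
  have hev : ∀ᶠ h : ℝ in 𝓝[>] 0, ∀ y ∈ F,
      (∀ k : ℕ, k * h ≤ T → ‖Φ y (k * h) - euler H h y k‖ ≤ δ) ∧
      ∀ s ∈ Set.Icc 0 T, ∀ s' ∈ Set.Icc 0 T, |s - s'| < h → ‖Φ y s - Φ y s'‖ ≤ δ := by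
    refine (eventually_all_finite hfin).2 fun y hy => ?_
    have hsol := hΦ.solution y (hF hy)
    obtain ⟨h₀, hh₀, H₀⟩ := hH.exists_norm_solution_sub_euler_le (hF hy) hsol hT.le hδ0
    obtain ⟨h₁, hh₁, H₁⟩ := Metric.uniformContinuousOn_iff.1 (hsol.continuousOn hT.le) δ hδ0
    filter_upwards [Ioo_mem_nhdsGT (lt_min hh₀ hh₁)] with h hh
    refine ⟨H₀ h hh.1 (hh.2.trans_le (min_le_left _ _)), fun s hs s' hs' hlt => ?_⟩
    rw [← dist_eq_norm]
    exact (H₁ s hs s' hs' (hlt.trans (hh.2.trans_le (min_le_right _ _)))).le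
  obtain ⟨h, ⟨hh, hhlt⟩, hhF⟩ :=
    ((eventually_mem_set.2 (Ioo_mem_nhdsGT (lt_min hh₂ one_pos))).and hev).exists
  have hhh₂ : h ≤ h₂ := hhlt.le.trans (min_le_left _ _)
  have hh1 : h ≤ 1 := hhlt.le.trans (min_le_right _ _)
  set n := ⌊T / h⌋₊ + 1
  -- The at most `T / h` steps each cost `η (1 + h) ≤ 2 η`, hence at most `δ² / 2` together.
  set η := δ ^ 2 * h / (4 * T) with hη
  have hη0 : 0 < η := by positivity
  have htests : ∀ᶠ r : ℝ in atTop, ∀ y ∈ F, ∀ k ∈ Finset.range n, ∀ s δ' : ℝ, r ≤ s →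
      (∀ t ∈ Set.Icc r s, ‖X t - X r‖ ≤ δ') →
      ‖X s - euler H h y (k + 1)‖ ^ 2 / 2 ≤ ‖X r - euler H h y (k + 1)‖ ^ 2 / 2
        + (s - r) * ⟪yosida h H (euler H h y k), euler H h y (k + 1) - X r⟫
        + (s - r) * (‖yosida h H (euler H h y k)‖ * δ') + η * (1 + (s - r)) :=
    (eventually_all_finite hfin).2 fun y hy => (eventually_all_finset _).2 fun k hk =>
      hX _ _ (hH.yosida_euler_mem hh y k) _ hη0
  obtain ⟨t₁, ht₁⟩ := eventually_atTop.1 (htests.and hosc)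
  filter_upwards [hdist.eventually_lt_const hδ0, hY.eventually_le_const hδ0,
    eventually_ge_atTop 0, eventually_ge_atTop t₁,
    (eventually_atTop.1 (hY.eventually_le_const hδ0)).elim fun a ha =>
      eventually_atTop.2 ⟨a, fun t ht s (hs : t ≤ s) => ha s (ht.trans hs)⟩]
    with t htd hYt ht0 htt₁ hYlarge
  obtain ⟨y, hy, hty⟩ := hnet (X t) (hR t ht0) htd
  refine iSup₂_le fun s hs => ?_
  rw [← ofReal_norm]
  refine (ENNReal.ofReal_le_ofReal ?_).trans hεε'
  set k := ⌊s / h⌋₊ with hk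
  have hks : (k : ℝ) * h ≤ s := by
    have := Nat.floor_le (div_nonneg hs.1 hh.le)
    rwa [le_div_iff₀ hh] at this
  have hks' : s < k * h + h := by
    have := Nat.lt_floor_add_one (s / h)
    rw [div_lt_iff₀ hh] at this
    linarith
  have hkT : (k : ℝ) * h ≤ T := hks.trans hs.2
  have hkh0 : 0 ≤ (k : ℝ) * h := by positivity
  -- The curve, sampled at times `t + j h`, is compared with the scheme issued from the net point
  -- near `X t`.
  have hcmp := hH.euler_compare hh y (fun j => X (t + j * h))
    (κ := h * (V * ε₁) + η * 2) (n := k) (by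
      rintro j hj y' rfl w - rfl
      have hjn : j ∈ Finset.range n := by
        rw [Finset.mem_range]
        have : k ≤ ⌊T / h⌋₊ := by rw [hk]; gcongr; exact hs.2
        omega
      have hjh : 0 ≤ (j : ℝ) * h := by positivity
      obtain ⟨g1, g2⟩ := ht₁ (t + j * h) (by linarith)
      have g3 := g1 y hy j hjn (t + (j + 1) * h) ε₁ (by nlinarith) fun t' ht' =>
        g2 t' ⟨ht'.1, by nlinarith [ht'.2]⟩
      have e : t + ((j : ℝ) + 1) * h - (t + j * h) = h := by ring
      rw [e] at g3
      have hwv : ‖yosida h H (euler H h y j)‖ ≤ V :=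
        (hH.norm_yosida_euler_le hh (hv y (hF hy)) j).trans (hV y hy)
      have g4 : h * (‖yosida h H (euler H h y j)‖ * ε₁) ≤ h * (V * ε₁) := by gcongr
      have g5 : η * (1 + h) ≤ η * 2 := by gcongr; linarith
      push_cast
      linarith)
  simp only [Nat.cast_zero, zero_mul, add_zero] at hcmp
  have b1 : ‖X (t + k * h) - euler H h y k‖ ≤ 4 * δ := by
    have c1 : (k : ℝ) * (h * (V * ε₁)) ≤ δ ^ 2 / 2 := by
      calc (k : ℝ) * (h * (V * ε₁)) = (k * h) * (V * ε₁) := by ring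
        _ ≤ T * (V * ε₁) := by gcongr
        _ ≤ (T * V + 1) * ε₁ := by nlinarith
        _ ≤ (T * V + 1) * (δ ^ 2 / (2 * (T * V + 1))) := by gcongr; exact min_le_right _ _
        _ = δ ^ 2 / 2 := by field_simp
    have c2 : (k : ℝ) * (η * 2) ≤ δ ^ 2 / 2 := by
      calc (k : ℝ) * (η * 2) = (k * h) * (δ ^ 2 / (2 * T)) := by rw [hη]; ring
        _ ≤ T * (δ ^ 2 / (2 * T)) := by gcongr
        _ = δ ^ 2 / 2 := by field_simp
    have c3 : ‖X t - y‖ ^ 2 ≤ (2 * δ) ^ 2 := by gcongr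
    refine le_of_sq_le_sq ?_ (by positivity)
    nlinarith
  obtain ⟨f1, f2⟩ := hhF y hy
  have b2 := f1 k hkT
  have b3 := f2 (k * h) ⟨hkh0, hkT⟩ s hs (by rw [abs_lt]; constructor <;> linarith)
  have b4 : ‖X (t + s) - X (t + k * h)‖ ≤ δ :=
    ((ht₁ (t + k * h) (by linarith)).2 (t + s) ⟨by linarith, by linarith⟩).trans (min_le_left _ _)
  have b5 : ‖Y (t + s) - X (t + s)‖ ≤ δ := hYlarge (t + s) (by linarith [hs.1])
  obtain ⟨p1, p2⟩ := proj_spec isClosed_closure hne.closure (Y t)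
  have b6 : ‖Y t - proj (closure (dom H)) (Y t)‖ ≤ 2 * δ := by
    rw [p2, Metric.infDist_closure]
    have := Metric.infDist_le_infDist_add_dist (s := dom H) (x := Y t) (y := X t)
    rw [dist_eq_norm] at this
    linarith
  have b7 := hH.norm_semiflow_sub_le hΦ p1 (hF hy) hs.1
  have b8 : ‖proj (closure (dom H)) (Y t) - y‖ ≤ 5 * δ := by
    have e : proj (closure (dom H)) (Y t) - y
        = (Y t - X t) - (Y t - proj (closure (dom H)) (Y t)) + (X t - y) := by abel
    rw [e]
    refine (norm_add_le _ _).trans ?_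
    linarith [norm_sub_le (Y t - X t) (Y t - proj (closure (dom H)) (Y t))]
  have e : Y (t + s) - Φ (proj (closure (dom H)) (Y t)) s
      = (Y (t + s) - X (t + s)) + (X (t + s) - X (t + k * h))
        + (X (t + k * h) - euler H h y k) - (Φ y (k * h) - euler H h y k)
        + (Φ y (k * h) - Φ y s) - (Φ (proj (closure (dom H)) (Y t)) s - Φ y s) := by abel
  rw [e]
  refine (norm_sub_le _ _).trans ?_
  have n1 := norm_add_le ((Y (t + s) - X (t + s)) + (X (t + s) - X (t + k * h))
        + (X (t + k * h) - euler H h y k) - (Φ y (k * h) - euler H h y k)) (Φ y (k * h) - Φ y s)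
  have n2 := norm_sub_le ((Y (t + s) - X (t + s)) + (X (t + s) - X (t + k * h))
        + (X (t + k * h) - euler H h y k)) (Φ y (k * h) - euler H h y k)
  have n3 := norm_add_le ((Y (t + s) - X (t + s)) + (X (t + s) - X (t + k * h)))
    (X (t + k * h) - euler H h y k)
  have n4 := norm_add_le (Y (t + s) - X (t + s)) (X (t + s) - X (t + k * h))
  linarith

end PseudoTrajectory

end RandomMonotone

namespace RandomMonotone

/-! ### Step times, interpolation, and the passage from sequences to curves. -/

section Interpolation

variable {γ : ℕ → ℝ}

theorem stepTime_zero (γ : ℕ → ℝ) : stepTime γ 0 = 0 := by simp [stepTime]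

theorem stepTime_succ (γ : ℕ → ℝ) (n : ℕ) : stepTime γ (n + 1) = stepTime γ n + γ (n + 1) := by
  rw [stepTime, stepTime, Finset.sum_Icc_succ_top (Nat.le_add_left 1 n)]

theorem strictMono_stepTime (hγ : ∀ n, 1 ≤ n → 0 < γ n) : StrictMono (stepTime γ) :=
  strictMono_nat_of_lt_succ fun n => by
    rw [stepTime_succ]
    linarith [hγ (n + 1) (Nat.le_add_left 1 n)]

theorem tendsto_stepTime (hγ : ∀ n, 1 ≤ n → 0 < γ n) (hγ1 : ¬ Summable γ) :
    Tendsto (stepTime γ) atTop atTop := by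
  have h1 : ¬ Summable fun n => γ (n + 1) := fun h => hγ1 ((summable_nat_add_iff 1).1 h)
  have h2 := (not_summable_iff_tendsto_nat_atTop_of_nonneg
    (fun n => (hγ (n + 1) (Nat.le_add_left 1 n)).le)).1 h1
  refine h2.congr fun n => ?_
  induction n with
  | zero => simp [stepTime]
  | succ n ih => rw [Finset.sum_range_succ, stepTime_succ, ih]

theorem stepIndex_spec (hγ : ∀ n, 1 ≤ n → 0 < γ n) (hγ1 : ¬ Summable γ) {t : ℝ} (ht : 0 ≤ t) :
    stepTime γ (stepIndex γ t) ≤ t ∧ t < stepTime γ (stepIndex γ t + 1) := by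
  have hne : {k : ℕ | stepTime γ k ≤ t}.Nonempty := ⟨0, by
    rw [Set.mem_ofPred_eq, stepTime_zero]; exact ht⟩
  obtain ⟨N, hN⟩ := ((tendsto_stepTime hγ hγ1).eventually_gt_atTop t).exists
  have hbdd : BddAbove {k : ℕ | stepTime γ k ≤ t} := ⟨N, fun k hk => by
    by_contra! hlt
    have := (strictMono_stepTime hγ) hlt
    have hk' : stepTime γ k ≤ t := hk
    linarith⟩
  refine ⟨Nat.sSup_mem hne hbdd, ?_⟩
  by_contra! hle
  have := le_csSup hbdd (show stepIndex γ t + 1 ∈ {k : ℕ | stepTime γ k ≤ t} from hle)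
  have h2 : stepIndex γ t + 1 ≤ stepIndex γ t := this
  omega

theorem stepIndex_eq (hγ : ∀ n, 1 ≤ n → 0 < γ n) (hγ1 : ¬ Summable γ) {t : ℝ} {n : ℕ}
    (h1 : stepTime γ n ≤ t) (h2 : t < stepTime γ (n + 1)) : stepIndex γ t = n := by
  have hmono := strictMono_stepTime hγ
  have ht : 0 ≤ t := by
    have := hmono.monotone (Nat.zero_le n)
    rw [stepTime_zero] at this
    linarith
  obtain ⟨h3, h4⟩ := stepIndex_spec hγ hγ1 ht
  have a := hmono.lt_iff_lt.1 (h1.trans_lt h4)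
  have b := hmono.lt_iff_lt.1 (h3.trans_lt h2)
  omega

theorem stepIndex_stepTime (hγ : ∀ n, 1 ≤ n → 0 < γ n) (hγ1 : ¬ Summable γ) (n : ℕ) :
    stepIndex γ (stepTime γ n) = n :=
  stepIndex_eq hγ hγ1 le_rfl (strictMono_stepTime hγ (Nat.lt_succ_self n))

theorem tendsto_stepIndex (hγ : ∀ n, 1 ≤ n → 0 < γ n) (hγ1 : ¬ Summable γ) :
    Tendsto (stepIndex γ) atTop atTop := by
  refine tendsto_atTop.2 fun n => ?_
  filter_upwards [eventually_ge_atTop (stepTime γ n), eventually_ge_atTop 0] with t ht ht0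
  have h := (stepIndex_spec hγ hγ1 ht0).2
  have := (strictMono_stepTime hγ).lt_iff_lt.1 (ht.trans_lt h)
  omega

variable {E : Type*} [NormedAddCommGroup E] [InnerProductSpace ℝ E]

theorem norm_interpolate_sub_le (hγ : ∀ n, 1 ≤ n → 0 < γ n) (hγ1 : ¬ Summable γ) (x : ℕ → E)
    {t : ℝ} (ht : 0 ≤ t) :
    ‖interpolate γ x t - x (stepIndex γ t)‖ ≤ ‖x (stepIndex γ t + 1) - x (stepIndex γ t)‖ := by
  obtain ⟨h1, h2⟩ := stepIndex_spec hγ hγ1 ht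
  have hg := hγ (stepIndex γ t + 1) (Nat.le_add_left 1 _)
  rw [stepTime_succ] at h2
  rw [interpolate, add_sub_cancel_left, norm_smul, Real.norm_eq_abs,
    abs_of_nonneg (div_nonneg (sub_nonneg.2 h1) hg.le)]
  refine mul_le_of_le_one_left (norm_nonneg _) ?_
  rw [div_le_one hg]
  linarith

theorem sum_Ico_stepTime (γ : ℕ → ℝ) {n m : ℕ} (h : n ≤ m) :
    ∑ k ∈ Finset.Ico n m, γ (k + 1) = stepTime γ m - stepTime γ n := by
  induction m, h using Nat.le_induction with
  | base => simp
  | succ m hm ih => rw [Finset.sum_Ico_succ_top hm, ih, stepTime_succ]; ring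

/-- The evolution variational inequalities for a sequence yield those of the associated step
function. -/
theorem asymptoticTest_of_sequence {H : E → Set E} (hγ : ∀ n, 1 ≤ n → 0 < γ n)
    (hγ1 : ¬ Summable γ) (hγ0 : Tendsto γ atTop (𝓝 0)) {x : ℕ → E} {R : ℝ}
    (hR : ∀ n, ‖x n‖ ≤ R)
    (htest : ∀ y, ∀ w ∈ H y, ∀ η > 0, ∀ᶠ n : ℕ in atTop, ∀ m, n ≤ m →
      ‖x m - y‖ ^ 2 / 2 ≤ ‖x n - y‖ ^ 2 / 2 + ∑ k ∈ Finset.Ico n m, γ (k + 1) * ⟪w, y - x k⟫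
        + η * (1 + (stepTime γ m - stepTime γ n))) :
    AsymptoticTest H fun t => x (stepIndex γ t) := by
  intro y w hw η hη
  have hR0 : 0 ≤ R := (norm_nonneg _).trans (hR 0)
  have hmono := strictMono_stepTime hγ
  set Q := ‖w‖ * (‖y‖ + 3 * R) with hQ
  have hQ0 : 0 ≤ Q := by positivity
  -- `θ` will bound the late steps, hence the discrepancy between `s - r` and the elapsed grid time.
  set θ := min (1 / 2) (η / (4 * (Q + 1))) with hθ
  have hθ0 : 0 < θ := by positivity
  have hsmall : ∀ᶠ n : ℕ in atTop, ∀ k, n ≤ k → γ (k + 1) ≤ θ := by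
    obtain ⟨a, ha⟩ := eventually_atTop.1 (hγ0.eventually_le_const hθ0)
    exact eventually_atTop.2 ⟨a, fun n hn k hk => ha _ (by omega)⟩
  have hev := (htest y w hw (η / 4) (by positivity)).and hsmall
  filter_upwards [(tendsto_stepIndex hγ hγ1).eventually hev, eventually_ge_atTop 0]
    with r ⟨hr, hrθ⟩ hr0 s δ hrs hδ
  have hs0 := hr0.trans hrs
  obtain ⟨r1, r2⟩ := stepIndex_spec hγ hγ1 hr0
  obtain ⟨s1, s2⟩ := stepIndex_spec hγ hγ1 hs0
  set n := stepIndex γ r with hn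
  set m := stepIndex γ s with hm
  have hnm : n ≤ m := by
    have := hmono.lt_iff_lt.1 ((r1.trans hrs).trans_lt s2)
    omega
  -- The given `δ` is arbitrary; capping it by `2 * R` keeps the rate `q` below the fixed constant
  -- `Q`.
  set δ' := min δ (2 * R)
  have hδ0 : 0 ≤ δ := (norm_nonneg _).trans (hδ r ⟨le_rfl, hrs⟩)
  have hδ'0 : 0 ≤ δ' := le_min hδ0 (by positivity)
  have hk : ∀ k ∈ Finset.Ico n m, ‖x k - x n‖ ≤ δ' := by
    intro k hk
    rw [Finset.mem_Ico] at hk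
    refine le_min ?_ ((norm_sub_le _ _).trans (by linarith [hR k, hR n]))
    rcases hk.1.eq_or_lt with rfl | hlt
    · simpa using hδ0
    · have h1 : r ≤ stepTime γ k := r2.le.trans (hmono.monotone hlt)
      have h2 : stepTime γ k ≤ s := (hmono.monotone hk.2.le).trans s1
      have := hδ (stepTime γ k) ⟨h1, h2⟩
      rwa [stepIndex_stepTime hγ hγ1] at this
  set q := ⟪w, y - x n⟫ + ‖w‖ * δ' with hq
  have hsum : ∑ k ∈ Finset.Ico n m, γ (k + 1) * ⟪w, y - x k⟫
      ≤ (stepTime γ m - stepTime γ n) * q := by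
    rw [← sum_Ico_stepTime γ hnm, Finset.sum_mul]
    refine Finset.sum_le_sum fun k hkm => ?_
    refine mul_le_mul_of_nonneg_left ?_ (hγ _ (Nat.le_add_left 1 k)).le
    have e : y - x k = (y - x n) - (x k - x n) := by abel
    have h4 := neg_le_of_abs_le (abs_real_inner_le_norm w (x k - x n))
    have h5 := mul_le_mul_of_nonneg_left (hk k hkm) (norm_nonneg w)
    rw [e, inner_sub_right, hq]
    linarith
  have hqQ : |q| ≤ Q := by
    have h1 := abs_real_inner_le_norm w (y - x n)
    have h2 : ‖y - x n‖ ≤ ‖y‖ + R := (norm_sub_le _ _).trans (by linarith [hR n])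
    have h3 := mul_le_mul_of_nonneg_left h2 (norm_nonneg w)
    have h4 : ‖w‖ * δ' ≤ ‖w‖ * (2 * R) := by gcongr; exact min_le_right _ _
    have h5 : |‖w‖ * δ'| = ‖w‖ * δ' := abs_of_nonneg (by positivity)
    refine (abs_add_le _ _).trans ?_
    rw [h5, hQ]
    nlinarith
  have hγn := hrθ n le_rfl
  have hγm := hrθ m hnm
  rw [stepTime_succ] at r2 s2
  have hdiff : |stepTime γ m - stepTime γ n - (s - r)| ≤ θ := by
    rw [abs_le]; constructor <;> linarith
  have hprod : (stepTime γ m - stepTime γ n) * q ≤ (s - r) * q + θ * Q := by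
    have h1 : (stepTime γ m - stepTime γ n - (s - r)) * q ≤ θ * Q := by
      refine (le_abs_self _).trans ?_
      rw [abs_mul]
      exact mul_le_mul hdiff hqQ (abs_nonneg _) hθ0.le
    linarith
  have hθQ : θ * Q ≤ η / 4 := by
    calc θ * Q ≤ θ * (Q + 1) := by nlinarith
      _ ≤ η / (4 * (Q + 1)) * (Q + 1) := by gcongr; exact min_le_right _ _
      _ = η / 4 := by field_simp
  have hθ2 : θ ≤ 1 / 2 := min_le_left _ _
  have hmain := hr m hnm
  have hsr : 0 ≤ s - r := sub_nonneg.2 hrs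
  have h6 : (s - r) * (‖w‖ * δ') ≤ (s - r) * (‖w‖ * δ) := by gcongr; exact min_le_left _ _
  have h7 : stepTime γ m - stepTime γ n ≤ (s - r) + 1 / 2 := by
    have := (abs_le.1 hdiff).2; linarith
  have h8 : η / 4 * (1 + (stepTime γ m - stepTime γ n)) ≤ η / 4 * (1 + ((s - r) + 1 / 2)) := by
    gcongr
  rw [hq, mul_add] at hprod
  nlinarith

/-- Sufficient conditions for the interpolation of a sequence to be a bounded asymptotic
pseudo-trajectory. -/
theorem isAPT_interpolate [FiniteDimensional ℝ E] {H : E → Set E} (hH : IsMaximalMonotone H)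
    (hγ : ∀ n, 1 ≤ n → 0 < γ n) (hγ1 : ¬ Summable γ) (hγ0 : Tendsto γ atTop (𝓝 0)) {x : ℕ → E}
    {R : ℝ} (hR : ∀ n, ‖x n‖ ≤ R) (hincr : Tendsto (fun n => ‖x (n + 1) - x n‖) atTop (𝓝 0))
    (hdist : Tendsto (fun n => Metric.infDist (x n) (dom H)) atTop (𝓝 0))
    (htest : ∀ y, ∀ w ∈ H y, ∀ η > 0, ∀ᶠ n : ℕ in atTop, ∀ m, n ≤ m →
      ‖x m - y‖ ^ 2 / 2 ≤ ‖x n - y‖ ^ 2 / 2 + ∑ k ∈ Finset.Ico n m, γ (k + 1) * ⟪w, y - x k⟫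
        + η * (1 + (stepTime γ m - stepTime γ n))) {Φ : E → ℝ → E} (hΦ : IsSemiflow H Φ) :
    Bornology.IsBounded (interpolate γ x '' Set.Ici (0 : ℝ)) ∧
      IsAPT (closure (dom H)) Φ (interpolate γ x) := by
  constructor
  · refine (Metric.isBounded_closedBall (x := (0 : E)) (r := 3 * R)).subset ?_
    rintro _ ⟨t, ht, rfl⟩
    rw [mem_closedBall_zero_iff]
    have h1 := norm_interpolate_sub_le hγ hγ1 x ht
    have h2 := norm_sub_le (x (stepIndex γ t + 1)) (x (stepIndex γ t))
    have h3 := norm_le_norm_add_norm_sub' (interpolate γ x t) (x (stepIndex γ t))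
    linarith [hR (stepIndex γ t), hR (stepIndex γ t + 1)]
  · refine (asymptoticTest_of_sequence hγ hγ1 hγ0 hR htest).isAPT hH (fun t _ => hR _)
      (hdist.comp (tendsto_stepIndex hγ hγ1)) ?_ hΦ
    refine squeeze_zero' (Eventually.of_forall fun t => norm_nonneg _) ?_
      (hincr.comp (tendsto_stepIndex hγ hγ1))
    filter_upwards [eventually_ge_atTop 0] with t ht using norm_interpolate_sub_le hγ hγ1 x ht

end Interpolation

end RandomMonotone

namespace RandomMonotone

/-! ### Strong convergence of convex combinations. -/

section ConvexCombinations

variable {F : Type*} [NormedAddCommGroup F] [InnerProductSpace ℝ F]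

/-- In a Hilbert space, some forward convex combinations of a bounded sequence converge. -/
theorem exists_tendsto_convexHull [CompleteSpace F] {f : ℕ → F} {C : ℝ} (hf : ∀ n, ‖f n‖ ≤ C) :
    ∃ g : ℕ → F, (∀ n, g n ∈ convexHull ℝ (f '' Set.Ici n)) ∧ ∃ l, Tendsto g atTop (𝓝 l) := by
  set K : ℕ → Set F := fun n => closure (convexHull ℝ (f '' Set.Ici n)) with hK
  have hconv : ∀ n, Convex ℝ (K n) := fun n => (convex_convexHull ℝ _).closure
  have hmem : ∀ n, f n ∈ K n := fun n =>
    subset_closure (subset_convexHull ℝ _ ⟨n, Set.self_mem_Ici, rfl⟩)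
  have hanti : ∀ n m, n ≤ m → K m ⊆ K n := fun n m h =>
    closure_mono (convexHull_mono (Set.image_mono (Set.Ici_subset_Ici.2 h)))
  -- `p` is the point of least norm in the closed convex hull of a tail. As the hulls decrease, the
  -- norms increase and stay bounded, and the projection inequality turns convergence of the norms
  -- into the Cauchy property.
  have hex : ∀ n, ∃ p ∈ K n, ∀ w ∈ K n, ‖p‖ ^ 2 ≤ ⟪p, w⟫ := by
    intro n
    obtain ⟨p, hp, h⟩ := exists_norm_eq_iInf_of_complete_convex ⟨_, hmem n⟩
      isClosed_closure.isComplete (hconv n) (0 : F)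
    refine ⟨p, hp, fun w hw => ?_⟩
    have h2 := (norm_eq_iInf_iff_real_inner_le_zero (hconv n) hp).1 h w hw
    rw [zero_sub, inner_neg_left, inner_sub_right, real_inner_self_eq_norm_sq] at h2
    linarith
  choose p hpK hp using hex
  have hle : ∀ n m, n ≤ m → ‖p m - p n‖ ^ 2 ≤ ‖p m‖ ^ 2 - ‖p n‖ ^ 2 := by
    intro n m h
    have h1 := hp n (p m) (hanti n m h (hpK m))
    rw [norm_sub_sq_real, real_inner_comm]
    linarith
  have hmono : Monotone fun n => ‖p n‖ ^ 2 := fun n m h => by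
    have := hle n m h
    have := sq_nonneg ‖p m - p n‖
    dsimp only
    linarith
  have hbdd : BddAbove (Set.range fun n => ‖p n‖ ^ 2) := by
    refine ⟨C ^ 2, ?_⟩
    rintro _ ⟨n, rfl⟩
    have h1 := (hp n (f n) (hmem n)).trans (real_inner_le_norm _ _)
    have h2 : ‖p n‖ ≤ ‖f n‖ := by
      by_contra! hlt
      nlinarith [norm_nonneg (f n)]
    have h3 := h2.trans (hf n)
    dsimp only
    gcongr
  have hlim := tendsto_atTop_ciSup hmono hbdd
  set L := ⨆ n, ‖p n‖ ^ 2
  have hcauchy : CauchySeq p := by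
    refine cauchySeq_of_le_tendsto_0' (fun n => Real.sqrt (L - ‖p n‖ ^ 2)) (fun n m h => ?_) ?_
    · rw [dist_comm, dist_eq_norm]
      refine Real.le_sqrt_of_sq_le ((hle n m h).trans ?_)
      have := le_ciSup hbdd m
      linarith
    · have := (hlim.const_sub L).sqrt
      simpa using this
  obtain ⟨l, hl⟩ := cauchySeq_tendsto_of_complete hcauchy
  have hg : ∀ n, ∃ g ∈ convexHull ℝ (f '' Set.Ici n), dist (p n) g < 1 / ((n : ℝ) + 1) := fun n =>
    Metric.mem_closure_iff.1 (hpK n) _ (by positivity)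
  choose g hg1 hg2 using hg
  refine ⟨g, hg1, l, hl.congr_dist ?_⟩
  exact squeeze_zero (fun n => dist_nonneg) (fun n => (hg2 n).le)
    tendsto_one_div_add_atTop_nhds_zero_nat

end ConvexCombinations

/-! ### Measurability of resolvents, projections and distances. -/

section MeasurableOperators

variable {E : Type*} [NormedAddCommGroup E] [InnerProductSpace ℝ E] [FiniteDimensional ℝ E]
  [MeasurableSpace E] [BorelSpace E] {Ξ : Type*} [MeasurableSpace Ξ] {A : Ξ → E → Set E}

/-- The resolvent falls in `S` exactly when the graph meets the Borel set of pairs `(y, v)` with `y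
∈ S` and `y + γ • v = x`. Joint measurability follows from continuity in `x`. -/
theorem measurable_resolvent (hA : ∀ ξ, IsMaximalMonotone (A ξ))
    (hAmeas : MeasurableSetValued fun ξ => graph (A ξ)) {γ : ℝ} (hγ : 0 < γ) (x : E) :
    Measurable fun ξ => resolvent γ (A ξ) x := by
  intro S hS
  have hset : MeasurableSet {q : E × E | q.1 ∈ S ∧ q.1 + γ • q.2 = x} := by
    refine (measurable_fst hS).inter ?_
    have : Measurable fun q : E × E => q.1 + γ • q.2 := by fun_prop
    exact this (measurableSet_singleton x)
  convert hAmeas _ hset using 1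
  ext ξ
  constructor
  · intro h
    exact ⟨(resolvent γ (A ξ) x, yosida γ (A ξ) x), (hA ξ).yosida_mem hγ x, h,
      resolvent_add_smul_yosida hγ x⟩
  · rintro ⟨⟨y, v⟩, hv, hy, hx⟩
    dsimp only at hx hy
    have := (hA ξ).resolvent_add_smul hγ (show v ∈ A ξ y from hv)
    rw [hx] at this
    simpa [this] using hy

theorem measurable_uncurry_resolvent (hA : ∀ ξ, IsMaximalMonotone (A ξ))
    (hAmeas : MeasurableSetValued fun ξ => graph (A ξ)) {γ : ℝ} (hγ : 0 < γ) :
    Measurable fun q : E × Ξ => resolvent γ (A q.2) q.1 :=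
  measurable_uncurry_of_continuous_of_measurable (u := fun x ξ => resolvent γ (A ξ) x)
    (fun ξ => (hA ξ).continuous_resolvent hγ) (fun x => measurable_resolvent hA hAmeas hγ x)

theorem measurable_uncurry_yosida (hA : ∀ ξ, IsMaximalMonotone (A ξ))
    (hAmeas : MeasurableSetValued fun ξ => graph (A ξ)) {γ : ℝ} (hγ : 0 < γ) :
    Measurable fun q : E × Ξ => yosida γ (A q.2) q.1 :=
  (measurable_fst.sub (measurable_uncurry_resolvent hA hAmeas hγ)).const_smul γ⁻¹

/-- The projection is the pointwise limit of resolvents with steps tending to `0`. -/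
theorem measurable_uncurry_proj (hA : ∀ ξ, IsMaximalMonotone (A ξ))
    (hAmeas : MeasurableSetValued fun ξ => graph (A ξ)) :
    Measurable fun q : E × Ξ => proj (closure (dom (A q.2))) q.1 :=
  measurable_of_tendsto_metrizable
    (fun n : ℕ => measurable_uncurry_resolvent hA hAmeas (γ := 1 / ((n : ℝ) + 1)) (by positivity))
    (tendsto_pi_nhds.2 fun q => (hA q.2).tendsto_resolvent_proj q.1)

theorem measurable_uncurry_infDist_dom (hA : ∀ ξ, IsMaximalMonotone (A ξ))
    (hAmeas : MeasurableSetValued fun ξ => graph (A ξ)) :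
    Measurable fun q : E × Ξ => Metric.infDist q.1 (dom (A q.2)) := by
  simp_rw [fun q : E × Ξ => (hA q.2).infDist_dom_eq q.1]
  exact (measurable_fst.sub (measurable_uncurry_proj hA hAmeas)).norm

end MeasurableOperators

/-! ### Mean operators and maximality of the sum. -/

section MeanOperator

variable {E : Type*} [NormedAddCommGroup E] [InnerProductSpace ℝ E] [FiniteDimensional ℝ E]
  {Ξ : Type*} [MeasurableSpace Ξ] {μ : Measure Ξ} {B : Ξ → E → Set E}

theorem inner_integral_sub_nonneg {φ φ' : Ξ → E} {x x' : E} (hφ : Integrable φ μ)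
    (hφ' : Integrable φ' μ) (h : ∀ᵐ ξ ∂μ, 0 ≤ ⟪φ ξ - φ' ξ, x - x'⟫) :
    0 ≤ ⟪∫ ξ, φ ξ ∂μ - ∫ ξ, φ' ξ ∂μ, x - x'⟫ := by
  have e : ∫ ξ, ⟪x - x', φ ξ - φ' ξ⟫ ∂μ = ⟪x - x', ∫ ξ, (φ ξ - φ' ξ) ∂μ⟫ :=
    integral_inner (hφ.sub hφ') (x - x')
  rw [← integral_sub hφ hφ', real_inner_comm, ← e]
  refine integral_nonneg_of_ae ?_
  filter_upwards [h] with ξ hξ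
  rw [Pi.zero_apply, real_inner_comm]
  exact hξ

theorem meanOperator_inner_nonneg (hB : ∀ ξ, IsMaximalMonotone (B ξ)) {x x' v v' : E}
    (hv : v ∈ meanOperator μ B x) (hv' : v' ∈ meanOperator μ B x') : 0 ≤ ⟪v - v', x - x'⟫ := by
  obtain ⟨φ, ⟨hφ, hφB⟩, rfl⟩ := hv
  obtain ⟨φ', ⟨hφ', hφB'⟩, rfl⟩ := hv'
  refine inner_integral_sub_nonneg (memLp_one_iff_integrable.1 hφ)
    (memLp_one_iff_integrable.1 hφ') ?_
  filter_upwards [hφB, hφB'] with ξ h h' using (hB ξ).inner_nonneg h h'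

/-- Closedness of the graph of a mean operator along square-dominated sequences. -/
theorem mem_meanOperator_of_tendsto [IsProbabilityMeasure μ] (hB : ∀ ξ, IsMaximalMonotone (B ξ))
    {m : Ξ → ℝ} (hm : MemLp m 2 μ) {v y : ℕ → Ξ → E} (hvmeas : ∀ n, AEStronglyMeasurable (v n) μ)
    (hvm : ∀ n, ∀ᵐ ξ ∂μ, ‖v n ξ‖ ≤ m ξ) (hvB : ∀ n, ∀ᵐ ξ ∂μ, v n ξ ∈ B ξ (y n ξ)) {x β : E}
    (hy : ∀ᵐ ξ ∂μ, Tendsto (fun n => y n ξ) atTop (𝓝 x))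
    (hβ : Tendsto (fun n => ∫ ξ, v n ξ ∂μ) atTop (𝓝 β)) : β ∈ meanOperator μ B x := by
  have hvL : ∀ n, MemLp (v n) 2 μ := fun n => hm.mono (hvmeas n) (by
    filter_upwards [hvm n] with ξ h using h.trans (le_abs_self _))
  -- The integrals converge but the functions need not. Convex combinations of tails converge
  -- strongly in `L²`, keep the limit of the integrals, and converge almost everywhere along a
  -- subsequence.
  set f : ℕ → Lp E 2 μ := fun n => (hvL n).toLp with hf
  have hfb : ∀ n, ‖f n‖ ≤ (eLpNorm m 2 μ).toReal := by
    intro n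
    rw [hf, Lp.norm_toLp]
    refine ENNReal.toReal_mono hm.2.ne (eLpNorm_mono_ae ?_)
    filter_upwards [hvm n] with ξ h using h.trans (le_abs_self _)
  obtain ⟨g, hg, l, hl⟩ := exists_tendsto_convexHull hfb
  have hfv : ∀ᵐ ξ ∂μ, ∀ n, f n ξ = v n ξ := ae_all_iff.2 fun n => (hvL n).coeFn_toLp
  have hgpt : ∀ᵐ ξ ∂μ, ∀ n, g n ξ ∈ convexHull ℝ ((fun k => v k ξ) '' Set.Ici n) := by
    refine ae_all_iff.2 fun n => ?_
    have hsub : convexHull ℝ (f '' Set.Ici n) ⊆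
        {q : Lp E 2 μ | ∀ᵐ ξ ∂μ, q ξ ∈ convexHull ℝ ((fun k => v k ξ) '' Set.Ici n)} := by
      refine convexHull_min ?_ ?_
      · rintro _ ⟨k, hk, rfl⟩
        filter_upwards [hfv] with ξ hξ
        rw [hξ k]
        exact subset_convexHull ℝ _ ⟨k, hk, rfl⟩
      · intro q hq q' hq' a b ha hb hab
        filter_upwards [hq, hq', Lp.coeFn_add (a • q) (b • q'), Lp.coeFn_smul a q,
          Lp.coeFn_smul b q'] with ξ h1 h2 h3 h4 h5
        rw [h3, Pi.add_apply, h4, h5]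
        exact (convex_convexHull ℝ _) h1 h2 ha hb hab
    exact hsub (hg n)
  have h_int : ∀ q : Lp E 2 μ, Integrable q μ := fun q => (Lp.memLp q).integrable one_le_two
  have hgint : ∀ n, ∫ ξ, g n ξ ∂μ ∈ convexHull ℝ ((fun k => ∫ ξ, v k ξ ∂μ) '' Set.Ici n) := by
    intro n
    have hsub : convexHull ℝ (f '' Set.Ici n) ⊆
        {q : Lp E 2 μ | ∫ ξ, q ξ ∂μ ∈ convexHull ℝ ((fun k => ∫ ξ, v k ξ ∂μ) '' Set.Ici n)} := by
      refine convexHull_min ?_ ?_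
      · rintro _ ⟨k, hk, rfl⟩
        refine subset_convexHull ℝ _ ⟨k, hk, integral_congr_ae ?_⟩
        filter_upwards [hfv] with ξ hξ using (hξ k).symm
      · intro q hq q' hq' a b ha hb hab
        have e : ∫ ξ, (a • q + b • q' : Lp E 2 μ) ξ ∂μ = a • ∫ ξ, q ξ ∂μ + b • ∫ ξ, q' ξ ∂μ := by
          rw [← integral_smul, ← integral_smul,
            ← integral_add (f := fun ξ => a • q ξ) (g := fun ξ => b • q' ξ) ((h_int q).smul a)
              ((h_int q').smul b)]
          refine integral_congr_ae ?_
          filter_upwards [Lp.coeFn_add (a • q) (b • q'), Lp.coeFn_smul a q,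
            Lp.coeFn_smul b q'] with ξ h3 h4 h5
          rw [h3, Pi.add_apply, h4, h5, Pi.smul_apply, Pi.smul_apply]
        rw [Set.mem_ofPred_eq, e]
        exact (convex_convexHull ℝ _) hq hq' ha hb hab
    exact hsub (hg n)
  have hlim1 : Tendsto (fun n => ∫ ξ, g n ξ ∂μ) atTop (𝓝 β) := by
    refine Metric.tendsto_atTop.2 fun ε hε => ?_
    obtain ⟨N, hN⟩ := Metric.tendsto_atTop.1 hβ ε hε
    refine ⟨N, fun n hn => ?_⟩
    have hsub : convexHull ℝ ((fun k => ∫ ξ, v k ξ ∂μ) '' Set.Ici n) ⊆ Metric.ball β ε := by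
      refine convexHull_min ?_ (convex_ball β ε)
      rintro _ ⟨k, hk, rfl⟩
      exact hN k (hn.trans hk)
    exact hsub (hgint n)
  have hlim2 : Tendsto (fun n => ∫ ξ, g n ξ ∂μ) atTop (𝓝 (∫ ξ, l ξ ∂μ)) := by
    refine tendsto_integral_of_L1' _ (h_int l).aestronglyMeasurable
      (Eventually.of_forall fun n => h_int (g n)) ?_
    refine tendsto_of_tendsto_of_tendsto_of_le_of_le tendsto_const_nhds
      ((Lp.tendsto_Lp_iff_tendsto_eLpNorm' g l).1 hl) (fun _ => zero_le) fun n => ?_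
    exact eLpNorm_le_eLpNorm_of_exponent_le one_le_two
      ((h_int (g n)).aestronglyMeasurable.sub (h_int l).aestronglyMeasurable)
  obtain ⟨ns, hns, hae⟩ := (tendstoInMeasure_of_tendsto_Lp hl).exists_seq_tendsto_ae
  refine ⟨l, ⟨memLp_one_iff_integrable.2 (h_int l), ?_⟩, tendsto_nhds_unique hlim2 hlim1⟩
  filter_upwards [hae, hgpt, ae_all_iff.2 hvm, ae_all_iff.2 hvB, hy] with ξ h1 h2 h3 h4 h5
  refine (hB ξ).mem_of_forall fun z w hw => ?_
  refine le_of_forall_pos_le_add fun ε hε => ?_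
  have hsmall : ∀ᶠ k in atTop, (m ξ + ‖w‖) * ‖y k ξ - x‖ < ε := by
    have : Tendsto (fun k => (m ξ + ‖w‖) * ‖y k ξ - x‖) atTop (𝓝 ((m ξ + ‖w‖) * ‖x - x‖)) :=
      ((h5.sub_const x).norm).const_mul _
    rw [sub_self, norm_zero, mul_zero] at this
    exact this.eventually_lt_const hε
  obtain ⟨N, hN⟩ := eventually_atTop.1 hsmall
  -- Each test against `(z, w)` defines a half-space, so it passes from late values `v k ξ` to their
  -- convex combinations. The slack `ε` absorbs the displacement of the base points.
  have hhalf : ∀ n, N ≤ n → 0 ≤ ⟪g n ξ - w, x - z⟫ + ε := by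
    intro n hn
    have hsub : convexHull ℝ ((fun k => v k ξ) '' Set.Ici n) ⊆ {q | 0 ≤ ⟪q - w, x - z⟫ + ε} := by
      refine convexHull_min ?_ ?_
      · rintro _ ⟨k, hk, rfl⟩
        have a1 := (hB ξ).inner_nonneg (h4 k) hw
        have e : y k ξ - z = (x - z) + (y k ξ - x) := by abel
        rw [e, inner_add_right] at a1
        have a2 := (real_inner_le_norm (v k ξ - w) (y k ξ - x)).trans
          (mul_le_mul_of_nonneg_right ((norm_sub_le _ _).trans
            (add_le_add_left (h3 k) ‖w‖)) (norm_nonneg _))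
        have a3 := hN k (hn.trans hk)
        rw [Set.mem_ofPred_eq]
        linarith
      · intro q hq q' hq' a b ha hb hab
        rw [Set.mem_ofPred_eq] at hq hq' ⊢
        have e : a • q + b • q' - w = a • (q - w) + b • (q' - w) := by
          have : w = (a + b) • w := by rw [hab, one_smul]
          nth_rewrite 1 [this]
          module
        rw [e, inner_add_left, real_inner_smul_left, real_inner_smul_left]
        have := mul_nonneg ha hq
        have := mul_nonneg hb hq'
        have e2 : ε = a * ε + b * ε := by rw [← add_mul, hab, one_mul]
        linarith
    exact hsub (h2 n)
  have hlim3 : Tendsto (fun i => ⟪g (ns i) ξ - w, x - z⟫ + ε) atTop (𝓝 (⟪l ξ - w, x - z⟫ + ε)) :=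
    ((h1.sub_const w).inner tendsto_const_nhds).add_const ε
  refine ge_of_tendsto hlim3 ?_
  filter_upwards [hns.tendsto_atTop.eventually_ge_atTop N] with i hi using hhalf _ hi

variable [MeasurableSpace E] [BorelSpace E]

/-- The sum of a maximal monotone operator and the mean of random maximal monotone operators with
full domain is maximal monotone. -/
theorem IsMaximalMonotone.add_meanOperator [IsProbabilityMeasure μ] {A : E → Set E}
    (hA : IsMaximalMonotone A)
    (hB : ∀ ξ, IsMaximalMonotone (B ξ)) (hBmeas : MeasurableSetValued fun ξ => graph (B ξ))
    (hdom : ∀ᵐ ξ ∂μ, dom (B ξ) = Set.univ)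
    (hsel : ∀ x, (selections μ 2 fun ξ => B ξ x).Nonempty) :
    IsMaximalMonotone (fun x => A x + meanOperator μ B x) := by
  choose b hbL hbB using hsel
  refine isMaximalMonotone_of_surjective ?_ fun z => ?_
  · rintro x x' _ _ ⟨a, ha, c, hc, rfl⟩ ⟨a', ha', c', hc', rfl⟩
    have h1 := hA.inner_nonneg ha ha'
    have h2 := meanOperator_inner_nonneg hB hc hc'
    dsimp only
    rw [add_sub_add_comm, inner_add_left]
    positivity
  set g : ℕ → ℝ := fun n => 1 / ((n : ℝ) + 1) with hg
  have hgpos : ∀ n, 0 < g n := fun n => by positivity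
  have hg0 : Tendsto g atTop (𝓝 0) := tendsto_one_div_add_atTop_nhds_zero_nat
  have hYmeas : ∀ n x, AEStronglyMeasurable (fun ξ => yosida (g n) (B ξ) x) μ := fun n x =>
    (((measurable_uncurry_yosida hB hBmeas (hgpos n)).comp
      (measurable_const.prodMk measurable_id)).stronglyMeasurable).aestronglyMeasurable
  have hYle : ∀ n x, ∀ᵐ ξ ∂μ, ‖yosida (g n) (B ξ) x‖ ≤ ‖b x ξ‖ := fun n x => by
    filter_upwards [hbB x] with ξ h using (hB ξ).norm_yosida_le (hgpos n) h
  have hYint : ∀ n x, Integrable (fun ξ => yosida (g n) (B ξ) x) μ := fun n x =>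
    ((hbL x).integrable one_le_two).mono (hYmeas n x) (hYle n x)
  -- The mean Yosida approximation is monotone and `(g n)⁻¹`-Lipschitz; the inclusion with it in
  -- place of the mean operator of `B` is solvable.
  set T : ℕ → E → E := fun n x => ∫ ξ, yosida (g n) (B ξ) x ∂μ with hT
  have hTmono : ∀ n x y, 0 ≤ ⟪T n x - T n y, x - y⟫ := fun n x y =>
    inner_integral_sub_nonneg (hYint n x) (hYint n y) (Eventually.of_forall fun ξ =>
      (by have := hgpos n; positivity : (0 : ℝ) ≤ _).trans
        ((hB ξ).yosida_cocoercive (hgpos n) x y))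
  have hTlip : ∀ n x y, ‖T n x - T n y‖ ≤ (g n)⁻¹ * ‖x - y‖ := by
    intro n x y
    rw [hT]
    dsimp only
    rw [← integral_sub (hYint n x) (hYint n y)]
    have := norm_integral_le_of_norm_le_const (μ := μ) (C := (g n)⁻¹ * ‖x - y‖)
      (Eventually.of_forall fun ξ => (hB ξ).norm_yosida_sub_le (hgpos n) x y)
    simpa using this
  have hex : ∀ n, ∃ x, ∃ a ∈ A x, z = x + a + T n x := fun n =>
    hA.exists_add_lipschitz (inv_nonneg.2 (hgpos n).le) (hTmono n) (hTlip n) z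
  choose x a ha hz using hex
  obtain ⟨y, α, hα⟩ := hA.dom_nonempty
  set R := ‖z - y - α‖ + ∫ ξ, ‖b y ξ‖ ∂μ
  have hTy : ∀ n, ‖T n y‖ ≤ ∫ ξ, ‖b y ξ‖ ∂μ := fun n =>
    norm_integral_le_of_norm_le ((hbL y).integrable one_le_two).norm (hYle n y)
  have hI0 : 0 ≤ ∫ ξ, ‖b y ξ‖ ∂μ := integral_nonneg fun ξ => norm_nonneg _
  -- Monotonicity of `A` and `T n` relative to the fixed point `y` bounds the approximate solutions
  -- uniformly in `n`.
  have hx : ∀ n, ‖x n - y‖ ≤ R := by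
    intro n
    have h1 := hA.inner_nonneg (ha n) hα
    have h2 := hTmono n (x n) y
    have h3 := hTy n
    have e : a n - α = (z - y - α) - (x n - y) - (T n (x n) - T n y) - T n y := by
      nth_rewrite 1 [hz n]
      abel
    rw [e, inner_sub_left, inner_sub_left, inner_sub_left _ (x n - y),
      real_inner_self_eq_norm_sq] at h1
    have h4 := real_inner_le_norm (z - y - α) (x n - y)
    have h5 := neg_le_of_abs_le (abs_real_inner_le_norm (T n y) (x n - y))
    by_contra! hlt
    have hp : 0 < ‖x n - y‖ := lt_of_le_of_lt (by positivity) hlt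
    nlinarith
  have hxR : ∀ n, ‖x n‖ ≤ R + ‖y‖ := fun n => by
    have := norm_add_le (x n - y) y
    rw [sub_add_cancel] at this
    linarith [hx n]
  set e := stdOrthonormalBasis ℝ E
  set N : ℝ := (Module.finrank ℝ E : ℝ)
  set R' := R + ‖y‖
  -- Square-integrable bound of all values of `B ξ` on a ball containing the approximate solutions,
  -- built from selections at the vertices of a cross-polytope.
  set m : Ξ → ℝ := fun ξ => N * (N * R' + 1 + R') *
    ∑ i, (‖b ((N * R' + 1) • e i) ξ‖ + ‖b ((-(N * R' + 1)) • e i) ξ‖) with hm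
  have hmL : MemLp m 2 μ :=
    (memLp_finsetSum _ fun i _ => (hbL _).norm.add (hbL _).norm).const_mul _
  have hYm : ∀ n, ∀ᵐ ξ ∂μ, ‖yosida (g n) (B ξ) (x n)‖ ≤ m ξ := by
    intro n
    have h1 : ∀ᵐ ξ ∂μ, ∀ i, b ((N * R' + 1) • e i) ξ ∈ B ξ ((N * R' + 1) • e i) :=
      ae_all_iff.2 fun i => hbB _
    have h2 : ∀ᵐ ξ ∂μ, ∀ i, b ((-(N * R' + 1)) • e i) ξ ∈ B ξ ((-(N * R' + 1)) • e i) :=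
      ae_all_iff.2 fun i => hbB _
    filter_upwards [hdom, h1, h2] with ξ hξ h1 h2
    have hxn : x n ∈ dom (B ξ) := hξ ▸ Set.mem_univ _
    obtain ⟨v, hv⟩ := hxn
    refine ((hB ξ).norm_yosida_le (hgpos n) hv).trans ?_
    exact norm_le_of_monotone_at_points (fun i => b _ ξ) (fun i => b _ ξ) (hxR n)
      (fun i => (hB ξ).inner_nonneg hv (h1 i)) (fun i => (hB ξ).inner_nonneg hv (h2 i))
  have hTb : ∀ n, ‖T n (x n)‖ ≤ ∫ ξ, m ξ ∂μ := fun n =>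
    norm_integral_le_of_norm_le (hmL.integrable one_le_two) (hYm n)
  have hb1 : Bornology.IsBounded
      (Metric.closedBall y R ×ˢ Metric.closedBall (0 : E) (∫ ξ, m ξ ∂μ)) :=
    Metric.isBounded_closedBall.prod Metric.isBounded_closedBall
  obtain ⟨⟨x', β'⟩, -, s, hs, hlim⟩ := tendsto_subseq_of_bounded hb1
    (x := fun n => (x n, T n (x n)))
    (fun n => ⟨by rw [mem_closedBall_iff_norm]; exact hx n, by
      rw [mem_closedBall_zero_iff]; exact hTb n⟩)
  have hx' : Tendsto (fun n => x (s n)) atTop (𝓝 x') := (continuous_fst.tendsto _).comp hlim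
  have hβ' : Tendsto (fun n => T (s n) (x (s n))) atTop (𝓝 β') :=
    (continuous_snd.tendsto _).comp hlim
  have hBmem : β' ∈ meanOperator μ B x' := by
    refine mem_meanOperator_of_tendsto hB hmL
      (v := fun n ξ => yosida (g (s n)) (B ξ) (x (s n)))
      (y := fun n ξ => resolvent (g (s n)) (B ξ) (x (s n)))
      (fun n => hYmeas _ _) (fun n => hYm (s n))
      (fun n => Eventually.of_forall fun ξ => (hB ξ).yosida_mem (hgpos _) _) ?_ hβ'
    filter_upwards [ae_all_iff.2 hYm] with ξ hξ
    have h0 : Tendsto (fun n => g (s n) • yosida (g (s n)) (B ξ) (x (s n))) atTop (𝓝 0) := by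
      refine squeeze_zero_norm (a := fun n => g (s n) * m ξ) (fun n => ?_) ?_
      · rw [norm_smul, Real.norm_eq_abs, abs_of_pos (hgpos _)]
        exact mul_le_mul_of_nonneg_left (hξ (s n)) (hgpos _).le
      · have := (hg0.comp hs.tendsto_atTop).mul_const (m ξ)
        rwa [zero_mul] at this
    have := hx'.sub h0
    rw [sub_zero] at this
    refine this.congr fun n => ?_
    rw [resolvent_eq_sub (hgpos _)]
  have hAmem : z - x' - β' ∈ A x' := by
    refine hA.mem_of_tendsto hx' ((hx'.const_sub z).sub hβ') (Eventually.of_forall fun n => ?_)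
    have e : z - x (s n) - T (s n) (x (s n)) = a (s n) := by
      nth_rewrite 1 [hz (s n)]
      abel
    rw [e]
    exact ha _
  exact ⟨x', (z - x' - β') + β', Set.add_mem_add hAmem hBmem, by abel⟩

end MeanOperator

end RandomMonotone

namespace RandomMonotone

/-! ### Independent inputs and martingale convergence. -/

section IndependentSequence

variable {Ω Ξ : Type*} [mΩ : MeasurableSpace Ω] [mΞ : MeasurableSpace Ξ]

/-- The filtration of the past: `U 0, …, U (n - 1)` are known at time `n`. -/
def pastFiltration (U : ℕ → Ω → Ξ) (hU : ∀ n, Measurable (U n)) : Filtration ℕ mΩ where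
  seq n := ⨆ k ∈ Set.Iio n, MeasurableSpace.comap (U k) mΞ
  mono' _ _ h := biSup_mono fun _ hk => lt_of_lt_of_le hk h
  le' _ := iSup₂_le fun k _ => (hU k).comap_le

variable {P : Measure Ω} {μ : Measure Ξ} {U : ℕ → Ω → Ξ} {hU : ∀ n, Measurable (U n)}

theorem measurable_pastFiltration_succ (n : ℕ) :
    Measurable[pastFiltration U hU (n + 1)] (U n) := by
  rw [measurable_iff_comap_le]
  exact le_iSup₂_of_le (f := fun k (_ : k ∈ Set.Iio (n + 1)) => MeasurableSpace.comap (U k) mΞ)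
    n (Set.mem_Iio.2 n.lt_succ_self) le_rfl

variable {F : Type*} [MeasurableSpace F] {Y : Ω → F} {n : ℕ}

theorem indepFun_of_past (hind : iIndepFun U P) (hY : Measurable[pastFiltration U hU n] Y) :
    IndepFun Y (U n) P := by
  have h1 : Indep (⨆ k ∈ Set.Iio n, MeasurableSpace.comap (U k) mΞ)
      (⨆ k ∈ ({n} : Set ℕ), MeasurableSpace.comap (U k) mΞ) P :=
    indep_iSup_of_disjoint (fun k => (hU k).comap_le) hind.iIndep (by simp)
  refine indep_of_indep_of_le_left (indep_of_indep_of_le_right h1 ?_) hY.comap_le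
  simp

theorem map_prodMk_eq_prod [IsProbabilityMeasure P] [IsProbabilityMeasure μ]
    (hind : iIndepFun U P) (hlaw : ∀ n, P.map (U n) = μ)
    (hY : Measurable[pastFiltration U hU n] Y) :
    P.map (fun ω => (Y ω, U n ω)) = (P.map Y).prod μ := by
  have hY' : Measurable Y := hY.mono ((pastFiltration U hU).le n) le_rfl
  rw [(indepFun_iff_map_prod_eq_prod_map_map hY'.aemeasurable (hU n).aemeasurable).1
    (indepFun_of_past hind hY), hlaw]

/-- The null set of `ξ` may depend on `y`. Independence makes the joint law a product, and Fubini
allows the random point `Y` to be substituted. -/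
theorem ae_of_forall_ae_prod [IsProbabilityMeasure P] [IsProbabilityMeasure μ]
    (hind : iIndepFun U P) (hlaw : ∀ n, P.map (U n) = μ)
    (hY : Measurable[pastFiltration U hU n] Y) {p : F × Ξ → Prop} (hp : MeasurableSet {q | p q})
    (h : ∀ y, ∀ᵐ ξ ∂μ, p (y, ξ)) : ∀ᵐ ω ∂P, p (Y ω, U n ω) := by
  have hY' : Measurable Y := hY.mono ((pastFiltration U hU).le n) le_rfl
  refine ae_of_ae_map (f := fun ω => (Y ω, U n ω)) (hY'.prodMk (hU n)).aemeasurable ?_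
  rw [map_prodMk_eq_prod hind hlaw hY]
  exact (Measure.ae_prod_mem_iff_ae_ae_mem hp).2 (Eventually.of_forall h)

theorem lintegral_prodMk_eq [IsProbabilityMeasure P] [IsProbabilityMeasure μ]
    (hind : iIndepFun U P) (hlaw : ∀ n, P.map (U n) = μ)
    (hY : Measurable[pastFiltration U hU n] Y) {f : F × Ξ → ℝ≥0∞} (hf : Measurable f) :
    ∫⁻ ω, f (Y ω, U n ω) ∂P = ∫⁻ ω, ∫⁻ ξ, f (Y ω, ξ) ∂μ ∂P := by
  have hY' : Measurable Y := hY.mono ((pastFiltration U hU).le n) le_rfl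
  rw [← lintegral_map (g := fun ω => (Y ω, U n ω)) hf (hY'.prodMk (hU n)),
    map_prodMk_eq_prod hind hlaw hY, lintegral_prod _ hf.aemeasurable,
    lintegral_map hf.lintegral_prod_right' hY']

theorem integral_prodMk_eq [IsProbabilityMeasure P] [IsProbabilityMeasure μ]
    (hind : iIndepFun U P) (hlaw : ∀ n, P.map (U n) = μ)
    (hY : Measurable[pastFiltration U hU n] Y) {f : F × Ξ → ℝ} (hf : Measurable f)
    (h_int : Integrable (fun ω => f (Y ω, U n ω)) P) :
    ∫ ω, f (Y ω, U n ω) ∂P = ∫ ω, ∫ ξ, f (Y ω, ξ) ∂μ ∂P := by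
  have hY' : Measurable Y := hY.mono ((pastFiltration U hU).le n) le_rfl
  have hm := map_prodMk_eq_prod hind hlaw hY
  have hpair : AEMeasurable (fun ω => (Y ω, U n ω)) P := (hY'.prodMk (hU n)).aemeasurable
  have h_int' : Integrable f ((P.map Y).prod μ) := by
    rw [← hm]
    exact (integrable_map_measure hf.aestronglyMeasurable hpair).2 h_int
  rw [← integral_map (φ := fun ω => (Y ω, U n ω)) hpair hf.aestronglyMeasurable, hm,
    integral_prod _ h_int', integral_map hY'.aemeasurable]
  exact hf.stronglyMeasurable.integral_prod_right'.aestronglyMeasurable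

theorem integrable_integral_prodMk [IsProbabilityMeasure P] [IsProbabilityMeasure μ]
    (hind : iIndepFun U P) (hlaw : ∀ n, P.map (U n) = μ)
    (hY : Measurable[pastFiltration U hU n] Y) {f : F × Ξ → ℝ} (hf : Measurable f)
    (h_int : Integrable (fun ω => f (Y ω, U n ω)) P) :
    Integrable (fun ω => ∫ ξ, f (Y ω, ξ) ∂μ) P := by
  have hY' : Measurable Y := hY.mono ((pastFiltration U hU).le n) le_rfl
  have hpair : AEMeasurable (fun ω => (Y ω, U n ω)) P := (hY'.prodMk (hU n)).aemeasurable
  have h_int' : Integrable f ((P.map Y).prod μ) := by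
    rw [← map_prodMk_eq_prod hind hlaw hY]
    exact (integrable_map_measure hf.aestronglyMeasurable hpair).2 h_int
  exact (integrable_map_measure hf.stronglyMeasurable.integral_prod_right'.aestronglyMeasurable
    hY'.aemeasurable).1 h_int'.integral_prod_left

theorem integrable_mul_of_past [IsProbabilityMeasure P] [IsProbabilityMeasure μ]
    (hind : iIndepFun U P) (hlaw : ∀ n, P.map (U n) = μ) {Z : Ω → ℝ}
    (hZ : Measurable[pastFiltration U hU n] Z) (hZint : Integrable Z P) {h : Ξ → ℝ}
    (hh : Measurable h) (h_int : Integrable h μ) :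
    Integrable (fun ω => Z ω * h (U n ω)) P ∧
      ∫ ω, Z ω * h (U n ω) ∂P = (∫ ω, Z ω ∂P) * ∫ ξ, h ξ ∂μ := by
  have hi : IndepFun Z (fun ω => h (U n ω)) P := (indepFun_of_past hind hZ).comp measurable_id hh
  have h_int' : Integrable (fun ω => h (U n ω)) P := by
    rw [← hlaw n] at h_int
    exact (integrable_map_measure hh.aestronglyMeasurable (hU n).aemeasurable).1 h_int
  refine ⟨hi.integrable_mul hZint h_int', ?_⟩
  have h1 := hi.integral_mul_eq_mul_integral hZint.aestronglyMeasurable h_int'.aestronglyMeasurable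
  rw [← hlaw n, integral_map (hU n).aemeasurable hh.aestronglyMeasurable]
  exact h1

/-- Sums of centered square-integrable functions of the past and of the present converge. -/
theorem ae_exists_tendsto_sum [IsProbabilityMeasure P] [IsProbabilityMeasure μ]
    (hind : iIndepFun U P) (hlaw : ∀ n, P.map (U n) = μ) {X : ℕ → Ω → F}
    (hX : ∀ n, Measurable[pastFiltration U hU n] (X n)) {f : ℕ → F × Ξ → ℝ}
    (hf : ∀ n, Measurable (f n)) (hzero : ∀ n x, ∫ ξ, f n (x, ξ) ∂μ = 0)
    (hL2 : ∀ n, MemLp (fun ω => f n (X n ω, U n ω)) 2 P)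
    (hsum : Summable fun n => ∫ ω, f n (X n ω, U n ω) ^ 2 ∂P) :
    ∀ᵐ ω ∂P, ∃ c, Tendsto (fun n => ∑ k ∈ Finset.range n, f k (X k ω, U k ω)) atTop (𝓝 c) := by
  set ℱ := pastFiltration U hU
  set D : ℕ → Ω → ℝ := fun n ω => f n (X n ω, U n ω) with hD
  set S : ℕ → Ω → ℝ := fun n ω => ∑ k ∈ Finset.range n, D k ω with hS
  have hDmeas : ∀ n, Measurable[ℱ (n + 1)] (D n) := fun n =>
    (hf n).comp (((hX n).mono (ℱ.mono n.le_succ) le_rfl).prodMk (measurable_pastFiltration_succ n))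
  have hSmeas : ∀ n, Measurable[ℱ n] (S n) := fun n =>
    Finset.measurable_sum _ fun k hk =>
      (hDmeas k).mono (ℱ.mono (Finset.mem_range.1 hk)) le_rfl
  have hSL2 : ∀ n, MemLp (S n) 2 P := fun n => memLp_finsetSum _ fun k _ => hL2 k
  have hSint : ∀ n, Integrable (S n) P := fun n => (hSL2 n).integrable one_le_two
  -- Integrating first over the new input, with `Z` and `X n` fixed by the past, gives `0`.
  -- Indicators for `Z` give the martingale property, and `Z = S n` gives orthogonality of
  -- increments.
  have horth : ∀ n (Z : Ω → ℝ), Measurable[ℱ n] Z → Integrable (fun ω => Z ω * D n ω) P →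
      ∫ ω, Z ω * D n ω ∂P = 0 := by
    intro n Z hZ h_int
    have h := integral_prodMk_eq hind hlaw (Y := fun ω => (Z ω, X n ω)) (hZ.prodMk (hX n))
      (f := fun q => q.1.1 * f n (q.1.2, q.2)) (by have := hf n; fun_prop) h_int
    rw [h]
    simp only [integral_const_mul, hzero, mul_zero, integral_zero]
  have hmart : Martingale S ℱ P := by
    refine martingale_of_setIntegral_eq_succ (fun n => (hSmeas n).stronglyMeasurable) hSint
      fun n s hs => ?_
    have hs' : MeasurableSet s := ℱ.le n s hs
    have e : S (n + 1) = fun ω => S n ω + D n ω := by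
      funext ω
      simp only [hS, Finset.sum_range_succ]
    have hDint : Integrable (D n) P := (hL2 n).integrable one_le_two
    have e2 : ∀ ω, s.indicator (fun _ => (1 : ℝ)) ω * D n ω = s.indicator (D n) ω := fun ω => by
      by_cases h : ω ∈ s <;> simp [h]
    have h0 := horth n (s.indicator fun _ => (1 : ℝ)) (measurable_const.indicator hs) (by
      simp only [e2]
      exact hDint.indicator hs')
    simp only [e2] at h0
    rw [integral_indicator hs'] at h0
    rw [e, integral_add (hSint n).integrableOn hDint.integrableOn, h0, add_zero]
  have hsq : ∀ n, ∫ ω, S n ω ^ 2 ∂P = ∑ k ∈ Finset.range n, ∫ ω, D k ω ^ 2 ∂P := by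
    intro n
    induction n with
    | zero => simp [hS]
    | succ n ih =>
      have hprod : Integrable (fun ω => S n ω * D n ω) P := (hSL2 n).integrable_mul (hL2 n)
      have e : ∀ ω, S (n + 1) ω ^ 2 = S n ω ^ 2 + 2 * (S n ω * D n ω) + D n ω ^ 2 := fun ω => by
        simp only [hS, Finset.sum_range_succ]
        ring
      simp only [e]
      have hadd : Integrable (fun ω => S n ω ^ 2 + 2 * (S n ω * D n ω)) P :=
        (hSL2 n).integrable_sq.add (hprod.const_mul 2)
      have hDsq : Integrable (fun ω => D n ω ^ 2) P := (hL2 n).integrable_sq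
      rw [integral_add hadd hDsq, integral_add (hSL2 n).integrable_sq (hprod.const_mul 2),
        integral_const_mul,
        horth n (S n) (hSmeas n) hprod, Finset.sum_range_succ, ih]
      ring
  set C := ∑' k, ∫ ω, D k ω ^ 2 ∂P
  have hbound : ∀ n, ∫ ω, S n ω ^ 2 ∂P ≤ C := fun n => by
    rw [hsq]
    exact hsum.sum_le_tsum _ fun k _ => integral_nonneg fun ω => sq_nonneg _
  -- Boundedness in `L²` gives boundedness in `L¹` through `|S| ≤ 1 + S²`.
  refine hmart.submartingale.exists_ae_tendsto_of_bdd (R := Real.toNNReal (1 + C)) fun n => ?_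
  rw [eLpNorm_one_eq_lintegral_enorm, ← ofReal_integral_norm_eq_lintegral_enorm (hSint n)]
  refine ENNReal.ofReal_le_ofReal ?_
  calc ∫ ω, ‖S n ω‖ ∂P ≤ ∫ ω, (1 + S n ω ^ 2) ∂P := by
        refine integral_mono (hSint n).norm ((integrable_const 1).add (hSL2 n).integrable_sq)
          fun ω => ?_
        have h1 := sq_abs (S n ω)
        rw [Real.norm_eq_abs]
        dsimp only
        nlinarith [sq_nonneg (|S n ω| - 1), abs_nonneg (S n ω)]
    _ = 1 + ∫ ω, S n ω ^ 2 ∂P := by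
        rw [integral_add (integrable_const 1) (hSL2 n).integrable_sq]
        simp
    _ ≤ 1 + C := by linarith [hbound n]

theorem ae_summable_of_summable_integral {f : ℕ → Ω → ℝ} (hf : ∀ n ω, 0 ≤ f n ω)
    (h_int : ∀ n, Integrable (f n) P) (hsum : Summable fun n => ∫ ω, f n ω ∂P) :
    ∀ᵐ ω ∂P, Summable fun n => f n ω := by
  have h1 : ∫⁻ ω, ∑' n, ENNReal.ofReal (f n ω) ∂P ≠ ∞ := by
    rw [lintegral_tsum fun n => (h_int n).aestronglyMeasurable.aemeasurable.ennreal_ofReal]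
    simp_rw [fun n => (ofReal_integral_eq_lintegral_ofReal (h_int n)
      (Eventually.of_forall (hf n))).symm]
    exact hsum.tsum_ofReal_ne_top
  filter_upwards [ae_lt_top' (AEMeasurable.tsum fun n =>
    (h_int n).aestronglyMeasurable.aemeasurable.ennreal_ofReal) h1] with ω hω
  have h2 := ENNReal.summable_toReal hω.ne
  refine h2.congr fun n => ?_
  rw [ENNReal.toReal_ofReal (hf n ω)]

end IndependentSequence

end RandomMonotone

namespace RandomMonotone

/-! ### Deterministic estimates for one forward-backward step. -/

section OneStep

variable {E : Type*} [NormedAddCommGroup E] [InnerProductSpace ℝ E] [FiniteDimensional ℝ E]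
  {A : E → Set E} {g : ℝ}

/-- Coercivity of the forward-backward direction with respect to a point of the graph. -/
theorem IsMaximalMonotone.forward_coercive (hA : IsMaximalMonotone A) (hg : 0 < g) (x β : E)
    {y φ : E} (hφ : φ ∈ A y) :
    g * (‖yosida g A (x - g • β) - φ‖ ^ 2 + ⟪yosida g A (x - g • β) - φ, β + φ⟫)
      ≤ ⟪yosida g A (x - g • β) - φ, x - y⟫ := by
  -- The second point is chosen so that its Yosida value is exactly `φ`.
  have h := hA.yosida_cocoercive hg (x - g • β) (y + g • φ)
  rw [hA.yosida_add_smul hg hφ] at h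
  have e : x - g • β - (y + g • φ) = (x - y) - g • (β + φ) := by module
  rw [e, inner_sub_right, real_inner_smul_right] at h
  linarith

/-- The Fejér inequality. -/
theorem IsMaximalMonotone.fejer (hA : IsMaximalMonotone A) (hg : 0 < g) (x β : E) {y φ ψ : E}
    (hφ : φ ∈ A y) (hψ : 0 ≤ ⟪β - ψ, x - y⟫) :
    ‖resolvent g A (x - g • β) - y‖ ^ 2 + g ^ 2 * ‖yosida g A (x - g • β) - φ‖ ^ 2
      ≤ ‖x - y‖ ^ 2 - 2 * (g * ⟪φ + ψ, x - y⟫) + g ^ 2 * ‖β + φ‖ ^ 2 := by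
  have h := hA.forward_coercive hg x β hφ
  rw [resolvent_forward_eq hg]
  set a := yosida g A (x - g • β)
  -- In the expansion of the square, the cross term `2 g² ⟪a - φ, β + φ⟫` is cancelled by the
  -- coercivity bound, which leaves `-g² ‖a - φ‖²`.
  have e : x - g • (a + β) - y = (x - y) - g • ((a - φ) + (β + φ)) := by module
  have e2 : ⟪x - y, (a - φ) + (β + φ)⟫ = ⟪a - φ, x - y⟫ + ⟪φ + ψ, x - y⟫ + ⟪β - ψ, x - y⟫ := by
    rw [real_inner_comm, ← inner_add_left, ← inner_add_left]
    congr 1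
    abel
  rw [e, norm_sub_sq_real, real_inner_smul_right, e2, norm_smul, Real.norm_eq_abs, abs_of_pos hg,
    mul_pow, norm_add_sq_real]
  nlinarith [mul_le_mul_of_nonneg_left h hg.le, mul_nonneg hg.le hψ]

/-- Coercivity divided by `‖yosida g A (x - g • β) - φ‖`. For fixed `x` this dominates the increment
by the integrable data of a single graph point. -/
theorem IsMaximalMonotone.norm_forward_sub_le (hA : IsMaximalMonotone A) (hg : 0 < g) (x β : E)
    {y φ : E} (hφ : φ ∈ A y) :
    g * ‖yosida g A (x - g • β) - φ‖ ≤ ‖x - y‖ + g * ‖β + φ‖ := by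
  have h := hA.forward_coercive hg x β hφ
  set a := yosida g A (x - g • β)
  have h1 := real_inner_le_norm (a - φ) (x - y)
  have h2 := neg_le_of_abs_le (abs_real_inner_le_norm (a - φ) (β + φ))
  rcases (norm_nonneg (a - φ)).eq_or_lt with h0 | h0
  · rw [← h0]
    have := norm_nonneg (x - y)
    have := mul_nonneg hg.le (norm_nonneg (β + φ))
    linarith
  · refine le_of_mul_le_mul_left ?_ h0
    nlinarith [mul_le_mul_of_nonneg_left h2 hg.le]

/-- Lower bound of the drift with respect to a point of the graph. -/
theorem IsMaximalMonotone.drift_ge (hA : IsMaximalMonotone A) (hg : 0 < g) (x β : E)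
    {y φ : E} (hφ : φ ∈ A y) {K : ℝ} :
    ⟪φ, x - y⟫ - 2 * ({v : E | K < ‖v‖}.indicator (fun v => ‖v‖) φ) * ‖x - y‖
        - g * (‖β‖ ^ 2 + K ^ 2) ≤ ⟪yosida g A (x - g • β), x - y⟫ := by
  -- Coercivity at `φ` costs a multiple of `g ‖φ‖²`, too much for a selection that is only
  -- integrable. Large values are instead compared with the Yosida value at `y`, at a cost linear in
  -- `‖φ‖`.
  by_cases hK : K < ‖φ‖
  · rw [Set.indicator_of_mem (by exact hK)]
    have h := hA.yosida_cocoercive hg (x - g • β) y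
    set a := yosida g A (x - g • β)
    set c := yosida g A y
    have hc : ‖c‖ ≤ ‖φ‖ := hA.norm_yosida_le hg hφ
    have e : x - g • β - y = (x - y) - g • β := by module
    rw [e, inner_sub_right, real_inner_smul_right, inner_sub_left a c (x - y)] at h
    have h1 := neg_le_of_abs_le (abs_real_inner_le_norm c (x - y))
    have h2 := neg_le_of_abs_le (abs_real_inner_le_norm (a - c) β)
    have h3 := real_inner_le_norm φ (x - y)
    have h4 := mul_le_mul_of_nonneg_right hc (norm_nonneg (x - y))
    have h5 : -(‖β‖ ^ 2) ≤ ‖a - c‖ ^ 2 + ⟪a - c, β⟫ := by nlinarith [sq_nonneg (‖a - c‖ - ‖β‖)]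
    nlinarith [mul_le_mul_of_nonneg_left h5 hg.le, mul_nonneg hg.le (sq_nonneg K)]
  · rw [Set.indicator_of_notMem (by exact hK)]
    have h := hA.forward_coercive hg x β hφ
    set a := yosida g A (x - g • β)
    rw [inner_sub_left a φ (x - y)] at h
    have h2 := neg_le_of_abs_le (abs_real_inner_le_norm (a - φ) (β + φ))
    have h3 : ‖β + φ‖ ≤ ‖β‖ + K := (norm_add_le _ _).trans (by linarith [not_lt.1 hK])
    have h4 : ‖β + φ‖ ^ 2 ≤ 2 * (‖β‖ ^ 2 + K ^ 2) := by
      have : ‖β + φ‖ ^ 2 ≤ (‖β‖ + K) ^ 2 := by gcongr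
      nlinarith [sq_nonneg (‖β‖ - K)]
    have h5 : -(‖β‖ ^ 2 + K ^ 2) ≤ ‖a - φ‖ ^ 2 + ⟪a - φ, β + φ⟫ := by
      nlinarith [sq_nonneg (2 * ‖a - φ‖ - ‖β + φ‖)]
    nlinarith [mul_le_mul_of_nonneg_left h5 hg.le]

/-- One step of the algorithm brings the iterate closer to a closed convex subset of the closure
of the domain. -/
theorem IsMaximalMonotone.infDist_step_le (hA : IsMaximalMonotone A) (hg : 0 < g) (x β : E)
    {S : Set E} (hS : IsClosed S) (hne : S.Nonempty) (hSA : S ⊆ closure (dom A)) {δ : ℝ}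
    (hδ : 0 < δ) :
    Metric.infDist (resolvent g A (x - g • β)) S ^ 2 ≤
      (1 + δ) * (Metric.infDist x S ^ 2 - Metric.infDist x (dom A) ^ 2)
        + 2 * (1 + δ⁻¹) * (g ^ 2 * ‖β‖ ^ 2
          + ‖resolvent g A x - proj (closure (dom A)) x‖ ^ 2) := by
  obtain ⟨hp, hpd⟩ := proj_spec hS hne x
  set p := proj S x
  set q := proj (closure (dom A)) x with hq
  -- Projecting onto the larger set first saves the squared distance to `dom A`; this gain produces
  -- the contraction in mean.
  have h1 : ‖q - p‖ ^ 2 ≤ Metric.infDist x S ^ 2 - Metric.infDist x (dom A) ^ 2 := by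
    have := norm_proj_sub_sq_le isClosed_closure hA.convex_closure_dom x (hSA hp)
    rwa [hpd, Metric.infDist_closure] at this
  have h2 : ‖resolvent g A (x - g • β) - resolvent g A x‖ ≤ g * ‖β‖ := by
    refine (hA.norm_resolvent_sub_le hg _ _).trans ?_
    rw [sub_sub_cancel_left, norm_neg, norm_smul, Real.norm_eq_abs, abs_of_pos hg]
  have h3 : Metric.infDist (resolvent g A (x - g • β)) S ≤ ‖q - p‖
      + (g * ‖β‖ + ‖resolvent g A x - q‖) := by
    refine (Metric.infDist_le_dist_of_mem hp).trans ?_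
    rw [dist_eq_norm]
    have e : resolvent g A (x - g • β) - p = (q - p)
        + ((resolvent g A (x - g • β) - resolvent g A x) + (resolvent g A x - q)) := by abel
    rw [e]
    refine (norm_add_le _ _).trans ?_
    linarith [norm_add_le (resolvent g A (x - g • β) - resolvent g A x) (resolvent g A x - q)]
  set s := ‖q - p‖
  set t := g * ‖β‖ + ‖resolvent g A x - q‖ with ht
  have h4 : Metric.infDist (resolvent g A (x - g • β)) S ^ 2 ≤ (s + t) ^ 2 := by
    have := Metric.infDist_nonneg (x := resolvent g A (x - g • β)) (s := S)
    gcongr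
  have h5 : (s + t) ^ 2 ≤ (1 + δ) * s ^ 2 + (1 + δ⁻¹) * t ^ 2 := by
    have h6 : 2 * (s * t) ≤ δ * s ^ 2 + δ⁻¹ * t ^ 2 := by
      have h7 : 0 ≤ δ⁻¹ * (δ * s - t) ^ 2 := by positivity
      have h8 : δ⁻¹ * (δ * s - t) ^ 2 = δ * s ^ 2 + δ⁻¹ * t ^ 2 - 2 * (s * t) := by
        field_simp
        ring
      linarith
    nlinarith
  have h6 : t ^ 2 ≤ 2 * (g ^ 2 * ‖β‖ ^ 2 + ‖resolvent g A x - q‖ ^ 2) := by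
    rw [ht]
    nlinarith [sq_nonneg (g * ‖β‖ - ‖resolvent g A x - q‖)]
  have h7 : (1 + δ) * s ^ 2
      ≤ (1 + δ) * (Metric.infDist x S ^ 2 - Metric.infDist x (dom A) ^ 2) := by gcongr
  have h8 : (1 + δ⁻¹) * t ^ 2
      ≤ (1 + δ⁻¹) * (2 * (g ^ 2 * ‖β‖ ^ 2 + ‖resolvent g A x - q‖ ^ 2)) := by gcongr
  linarith

end OneStep

section Recursions

/-- A discrete Gronwall argument: `1 + v n` grows at most by the factors `1 + c n ≤ exp (c n)`.
Telescoping with this bound then sums `w`. -/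
theorem exists_bound_of_recursion {v w c : ℕ → ℝ} (hv : ∀ n, 0 ≤ v n) (hw : ∀ n, 0 ≤ w n)
    (hc : ∀ n, 0 ≤ c n) (hsum : Summable c)
    (h : ∀ n, v (n + 1) + w n ≤ v n + c n * (1 + v n)) :
    (∃ V, ∀ n, v n ≤ V) ∧ Summable w := by
  have h1 : ∀ n, 1 + v n ≤ Real.exp (∑ k ∈ Finset.range n, c k) * (1 + v 0) := by
    intro n
    induction n with
    | zero => simp
    | succ n ih =>
      rw [Finset.sum_range_succ, Real.exp_add, mul_right_comm]
      have h2 := Real.add_one_le_exp (c n)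
      have h3 : 1 + v (n + 1) ≤ (1 + v n) * (c n + 1) := by nlinarith [h n, hw n]
      have h4 : 0 ≤ 1 + v n := by linarith [hv n]
      exact h3.trans (mul_le_mul ih h2 (by linarith [hc n]) (h4.trans ih))
  set V := Real.exp (∑' k, c k) * (1 + v 0) with hV
  have h2 : ∀ n, 1 + v n ≤ V := fun n => by
    refine (h1 n).trans ?_
    have := hv 0
    rw [hV]
    gcongr
    exact hsum.sum_le_tsum _ fun k _ => hc k
  refine ⟨⟨V, fun n => by linarith [h2 n]⟩, ?_⟩
  refine summable_of_sum_range_le (c := v 0 + (∑' k, c k) * V) hw fun n => ?_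
  have h3 : ∀ n, ∑ k ∈ Finset.range n, w k ≤ v 0 - v n + (∑ k ∈ Finset.range n, c k) * V := by
    intro n
    induction n with
    | zero => simp
    | succ n ih =>
      rw [Finset.sum_range_succ, Finset.sum_range_succ, add_mul]
      nlinarith [h n, mul_le_mul_of_nonneg_left (h2 n) (hc n)]
  refine (h3 n).trans ?_
  have h4 := hsum.sum_le_tsum (Finset.range n) fun k _ => hc k
  have h5 : 0 ≤ V := by linarith [h2 0, hv 0]
  nlinarith [hv n, mul_le_mul_of_nonneg_right h4 h5]

/-- Summing the recursion gives `(1 - ρ) ∑ e ≤ e 0 + ∑ c`. -/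
theorem summable_of_contraction {e c : ℕ → ℝ} {ρ : ℝ} (he : ∀ n, 0 ≤ e n) (hc : ∀ n, 0 ≤ c n)
    (hρ : ρ < 1) (hsum : Summable c) (h : ∀ n, e (n + 1) ≤ ρ * e n + c n) : Summable e := by
  have h3 : ∀ n, (1 - ρ) * ∑ k ∈ Finset.range n, e k ≤ e 0 - e n + ∑ k ∈ Finset.range n, c k := by
    intro n
    induction n with
    | zero => simp
    | succ n ih =>
      rw [Finset.sum_range_succ, Finset.sum_range_succ]
      nlinarith [h n]
  refine summable_of_sum_range_le (c := (e 0 + ∑' k, c k) / (1 - ρ)) he fun n => ?_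
  rw [le_div_iff₀ (by linarith)]
  have h4 := hsum.sum_le_tsum (Finset.range n) fun k _ => hc k
  linarith [h3 n, he n]

end Recursions

end RandomMonotone

namespace RandomMonotone

/-! ### The random algorithm and its Fejér inequality. -/

section Directions

variable {E : Type*} [NormedAddCommGroup E] [InnerProductSpace ℝ E] {Ξ : Type*}
  {A : Ξ → E → Set E} {b : Ξ → E → E}

/-- The increment of the algorithm. -/
noncomputable def increment (A : Ξ → E → Set E) (b : Ξ → E → E) (g : ℝ) (q : E × Ξ) : E :=
  resolvent g (A q.2) (q.1 - g • b q.2 q.1) - q.1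

/-- The backward direction of the algorithm. -/
noncomputable def backward (A : Ξ → E → Set E) (b : Ξ → E → E) (g : ℝ) (q : E × Ξ) : E :=
  yosida g (A q.2) (q.1 - g • b q.2 q.1)

theorem increment_eq {γ : ℝ} (hγ : 0 < γ) (q : E × Ξ) :
    increment A b γ q = -(γ • (backward A b γ q + b q.2 q.1)) := by
  rw [increment, resolvent_forward_eq hγ, backward]
  abel

end Directions

section StochasticAlgorithm

variable {E : Type*} [NormedAddCommGroup E] [InnerProductSpace ℝ E]
  [MeasurableSpace E] {Ω Ξ : Type*} [MeasurableSpace Ω] [MeasurableSpace Ξ]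

/-- The sequence `X` is generated by the stochastic forward-backward algorithm with steps `g` and
independent inputs `U` of law `μ`. -/
structure IsForwardBackward (P : Measure Ω) (μ : Measure Ξ) (A : Ξ → E → Set E) (b : Ξ → E → E)
    (U : ℕ → Ω → Ξ) (g : ℕ → ℝ) (X : ℕ → Ω → E) : Prop where
  maximal : ∀ ξ, IsMaximalMonotone (A ξ)
  measurable_graph : MeasurableSetValued fun ξ => graph (A ξ)
  measurable_forward : Measurable (Function.uncurry b)
  measurable_input : ∀ n, Measurable (U n)
  indep : iIndepFun U P
  law : ∀ n, P.map (U n) = μ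
  pos : ∀ n, 0 < g n
  summable_sq : Summable fun n => g n ^ 2
  init : ∃ x₀, ∀ ω, X 0 ω = x₀
  step : ∀ n ω, X (n + 1) ω =
    resolvent (g n) (A (U n ω)) (X n ω - g n • b (U n ω) (X n ω))

/-- A zero of the mean operator with a square-integrable representation `(φ, ψ)`, together with a
square-integrable bound `M` of the linear growth of the forward selection. -/
structure IsReferencePoint (μ : Measure Ξ) (A : Ξ → E → Set E) (b : Ξ → E → E) (z : E)
    (φ ψ : Ξ → E) (M : Ξ → ℝ) : Prop where
  measurable_left : Measurable φ
  measurable_right : Measurable ψ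
  measurable_bound : Measurable M
  memLp_left : MemLp φ 2 μ
  memLp_right : MemLp ψ 2 μ
  memLp_bound : MemLp M 2 μ
  mem : ∀ᵐ ξ ∂μ, φ ξ ∈ A ξ z
  mono : ∀ x, ∀ᵐ ξ ∂μ, 0 ≤ ⟪b ξ x - ψ ξ, x - z⟫
  mean : ∫ ξ, φ ξ ∂μ + ∫ ξ, ψ ξ ∂μ = 0
  growth : ∀ x, ∀ᵐ ξ ∂μ, ‖b ξ x‖ ≤ M ξ * (1 + ‖x‖)

variable {P : Measure Ω} {μ : Measure Ξ} {A : Ξ → E → Set E} {b : Ξ → E → E}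
  {U : ℕ → Ω → Ξ} {g : ℕ → ℝ} {X : ℕ → Ω → E} {z : E} {φ ψ : Ξ → E} {M : Ξ → ℝ}

namespace IsForwardBackward

theorem measurable_b (h : IsForwardBackward P μ A b U g X) :
    Measurable fun q : E × Ξ => b q.2 q.1 :=
  h.measurable_forward.comp measurable_swap

theorem succ_eq (h : IsForwardBackward P μ A b U g X) (n : ℕ) (ω : Ω) :
    X (n + 1) ω = X n ω + increment A b (g n) (X n ω, U n ω) := by
  rw [h.step, increment]
  abel

theorem ae_input (h : IsForwardBackward P μ A b U g X) (n : ℕ) {p : Ξ → Prop}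
    (hp : ∀ᵐ ξ ∂μ, p ξ) : ∀ᵐ ω ∂P, p (U n ω) :=
  ae_of_ae_map (h.measurable_input n).aemeasurable (by rwa [h.law n])

theorem tendsto_step (h : IsForwardBackward P μ A b U g X) : Tendsto g atTop (𝓝 0) := by
  have h1 := h.summable_sq.tendsto_atTop_zero.sqrt
  simp only [Real.sqrt_zero] at h1
  exact h1.congr fun n => Real.sqrt_sq (h.pos n).le

variable [FiniteDimensional ℝ E] [BorelSpace E]

theorem measurable_increment (h : IsForwardBackward P μ A b U g X) (n : ℕ) :
    Measurable (increment A b (g n)) :=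
  ((measurable_uncurry_resolvent h.maximal h.measurable_graph (h.pos n)).comp
    ((measurable_fst.sub (h.measurable_b.const_smul (g n))).prodMk measurable_snd)).sub
    measurable_fst

theorem measurable_backward (h : IsForwardBackward P μ A b U g X) (n : ℕ) :
    Measurable (backward A b (g n)) :=
  (measurable_uncurry_yosida h.maximal h.measurable_graph (h.pos n)).comp
    ((measurable_fst.sub (h.measurable_b.const_smul (g n))).prodMk measurable_snd)

theorem adapted (h : IsForwardBackward P μ A b U g X) (n : ℕ) :
    Measurable[pastFiltration U h.measurable_input n] (X n) := by
  induction n with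
  | zero =>
    obtain ⟨x₀, hx₀⟩ := h.init
    rw [show X 0 = fun _ => x₀ from funext hx₀]
    exact measurable_const
  | succ n ih =>
    rw [show X (n + 1) = fun ω => X n ω + increment A b (g n) (X n ω, U n ω) from
      funext (h.succ_eq n)]
    have h1 := ih.mono ((pastFiltration U h.measurable_input).mono n.le_succ) le_rfl
    exact h1.add ((h.measurable_increment n).comp
      (h1.prodMk (measurable_pastFiltration_succ n)))

theorem measurable (h : IsForwardBackward P μ A b U g X) (n : ℕ) : Measurable (X n) :=
  (h.adapted n).mono ((pastFiltration U h.measurable_input).le n) le_rfl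

variable [IsProbabilityMeasure P] [IsProbabilityMeasure μ]

theorem ae_growth (h : IsForwardBackward P μ A b U g X) (r : IsReferencePoint μ A b z φ ψ M)
    (n : ℕ) : ∀ᵐ ω ∂P, ‖b (U n ω) (X n ω)‖ ≤ M (U n ω) * (1 + ‖X n ω‖) :=
  ae_of_forall_ae_prod h.indep h.law (h.adapted n)
    (p := fun q => ‖b q.2 q.1‖ ≤ M q.2 * (1 + ‖q.1‖))
    (measurableSet_le h.measurable_b.norm ((r.measurable_bound.comp measurable_snd).mul
      (measurable_const.add measurable_fst.norm))) r.growth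

theorem ae_mono (h : IsForwardBackward P μ A b U g X) (r : IsReferencePoint μ A b z φ ψ M)
    (n : ℕ) : ∀ᵐ ω ∂P, 0 ≤ ⟪b (U n ω) (X n ω) - ψ (U n ω), X n ω - z⟫ :=
  ae_of_forall_ae_prod h.indep h.law (h.adapted n)
    (p := fun q => 0 ≤ ⟪b q.2 q.1 - ψ q.2, q.1 - z⟫)
    (measurableSet_le measurable_const ((h.measurable_b.sub
      (r.measurable_right.comp measurable_snd)).inner (measurable_fst.sub_const z))) r.mono

/-- The bound of the squared forward direction. -/
theorem ae_forward_sq_le (h : IsForwardBackward P μ A b U g X)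
    (r : IsReferencePoint μ A b z φ ψ M) (n : ℕ) : ∀ᵐ ω ∂P, ‖b (U n ω) (X n ω) + φ (U n ω)‖ ^ 2 ≤
      2 * ((1 + ‖X n ω‖) ^ 2 * M (U n ω) ^ 2) + 2 * ‖φ (U n ω)‖ ^ 2 := by
  filter_upwards [h.ae_growth r n] with ω h1
  have h2 := norm_add_le (b (U n ω) (X n ω)) (φ (U n ω))
  have h3 : ‖b (U n ω) (X n ω) + φ (U n ω)‖ ^ 2
      ≤ (M (U n ω) * (1 + ‖X n ω‖) + ‖φ (U n ω)‖) ^ 2 := by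
    have : ‖b (U n ω) (X n ω) + φ (U n ω)‖ ≤ M (U n ω) * (1 + ‖X n ω‖) + ‖φ (U n ω)‖ := by linarith
    gcongr
  nlinarith [sq_nonneg (M (U n ω) * (1 + ‖X n ω‖) - ‖φ (U n ω)‖)]

theorem ae_fejer (h : IsForwardBackward P μ A b U g X) (r : IsReferencePoint μ A b z φ ψ M)
    (n : ℕ) : ∀ᵐ ω ∂P,
      ‖X (n + 1) ω - z‖ ^ 2 + g n ^ 2 * ‖backward A b (g n) (X n ω, U n ω) - φ (U n ω)‖ ^ 2 ≤
      ‖X n ω - z‖ ^ 2 - 2 * (g n * ⟪φ (U n ω) + ψ (U n ω), X n ω - z⟫)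
        + g n ^ 2 * (2 * ((1 + ‖X n ω‖) ^ 2 * M (U n ω) ^ 2) + 2 * ‖φ (U n ω)‖ ^ 2) := by
  filter_upwards [h.ae_forward_sq_le r n, h.ae_mono r n, h.ae_input n r.mem] with ω h1 h2 h3
  have h4 := (h.maximal (U n ω)).fejer (h.pos n) (X n ω) (b (U n ω) (X n ω)) h3 h2
  rw [h.step, backward]
  have := mul_le_mul_of_nonneg_left h1 (sq_nonneg (g n))
  linarith

/-- Integrability at time `n` of the terms in the Fejér inequality. -/
theorem integrable_terms (h : IsForwardBackward P μ A b U g X)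
    (r : IsReferencePoint μ A b z φ ψ M) (n : ℕ)
    (hn : Integrable (fun ω => ‖X n ω - z‖ ^ 2) P) :
    (Integrable (fun ω => ⟪φ (U n ω) + ψ (U n ω), X n ω - z⟫) P ∧
      ∫ ω, ⟪φ (U n ω) + ψ (U n ω), X n ω - z⟫ ∂P = 0) ∧
    (Integrable (fun ω => 2 * ((1 + ‖X n ω‖) ^ 2 * M (U n ω) ^ 2) + 2 * ‖φ (U n ω)‖ ^ 2) P ∧
      ∫ ω, (2 * ((1 + ‖X n ω‖) ^ 2 * M (U n ω) ^ 2) + 2 * ‖φ (U n ω)‖ ^ 2) ∂P ≤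
        (4 * (1 + ‖z‖) ^ 2 * (∫ ξ, M ξ ^ 2 ∂μ) + 4 * (∫ ξ, M ξ ^ 2 ∂μ) + 2 * ∫ ξ, ‖φ ξ‖ ^ 2 ∂μ) *
          (1 + ∫ ω, ‖X n ω - z‖ ^ 2 ∂P)) := by
  have hXm := h.adapted n
  have hXm' := h.measurable n
  have hMint : Integrable (fun ξ => M ξ ^ 2) μ := r.memLp_bound.integrable_sq
  have hφint : Integrable (fun ξ => ‖φ ξ‖ ^ 2) μ := r.memLp_left.norm.integrable_sq
  have hXL : MemLp (fun ω => X n ω - z) 2 P :=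
    (memLp_two_iff_integrable_sq_norm (hXm'.sub_const z).aestronglyMeasurable).2 hn
  constructor
  · have hφψ : Integrable (fun ξ => φ ξ + ψ ξ) μ :=
      (r.memLp_left.integrable one_le_two).add (r.memLp_right.integrable one_le_two)
    have hnorm : Measurable fun x : E => ‖x - z‖ := (measurable_id.sub_const z).norm
    have hprod := (integrable_mul_of_past h.indep h.law (Z := fun ω => ‖X n ω - z‖)
      (hnorm.comp hXm) (hXL.integrable one_le_two).norm (h := fun ξ => ‖φ ξ + ψ ξ‖)
      (r.measurable_left.add r.measurable_right).norm hφψ.norm).1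
    have hmeas : Measurable fun q : E × Ξ => ⟪φ q.2 + ψ q.2, q.1 - z⟫ :=
      ((r.measurable_left.comp measurable_snd).add (r.measurable_right.comp measurable_snd)).inner
        (measurable_fst.sub_const z)
    have h_int : Integrable (fun ω => ⟪φ (U n ω) + ψ (U n ω), X n ω - z⟫) P := by
      refine hprod.mono (hmeas.comp (hXm'.prodMk (h.measurable_input n))).aestronglyMeasurable ?_
      refine Eventually.of_forall fun ω => ?_
      rw [Real.norm_eq_abs, Real.norm_eq_abs,
        abs_of_nonneg (mul_nonneg (norm_nonneg _) (norm_nonneg _)), mul_comm]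
      exact abs_real_inner_le_norm _ _
    refine ⟨h_int, ?_⟩
    rw [integral_prodMk_eq h.indep h.law hXm hmeas h_int]
    -- The linear term is centred at every fixed `x`, since the representation of the zero has total
    -- mean `0`.
    have h0 : ∀ x : E, ∫ ξ, ⟪φ ξ + ψ ξ, x - z⟫ ∂μ = 0 := by
      intro x
      have e : ∫ ξ, ⟪x - z, φ ξ + ψ ξ⟫ ∂μ = ⟪x - z, ∫ ξ, (φ ξ + ψ ξ) ∂μ⟫ :=
        integral_inner hφψ (x - z)
      simp_rw [real_inner_comm (x - z)]
      rw [e, integral_add (r.memLp_left.integrable one_le_two)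
        (r.memLp_right.integrable one_le_two), r.mean, inner_zero_right]
    simp only [h0, integral_zero]
  · have hdom : ∀ ω, (1 + ‖X n ω‖) ^ 2 ≤ 2 * (1 + ‖z‖) ^ 2 + 2 * ‖X n ω - z‖ ^ 2 := by
      intro ω
      have h1 := norm_le_norm_add_norm_sub' (X n ω) z
      have h2 : (1 + ‖X n ω‖) ^ 2 ≤ ((1 + ‖z‖) + ‖X n ω - z‖) ^ 2 := by
        have : 1 + ‖X n ω‖ ≤ (1 + ‖z‖) + ‖X n ω - z‖ := by linarith
        gcongr
      nlinarith [sq_nonneg ((1 + ‖z‖) - ‖X n ω - z‖)]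
    have hZm : Measurable[pastFiltration U h.measurable_input n] fun ω => (1 + ‖X n ω‖) ^ 2 :=
      (show Measurable fun x : E => (1 + ‖x‖) ^ 2 from
        (measurable_const.add measurable_norm).pow_const 2).comp hXm
    have hdomint : Integrable (fun ω => 2 * (1 + ‖z‖) ^ 2 + 2 * ‖X n ω - z‖ ^ 2) P :=
      (integrable_const _).add (hn.const_mul 2)
    have hZint : Integrable (fun ω => (1 + ‖X n ω‖) ^ 2) P := by
      refine hdomint.mono
        ((hZm.mono ((pastFiltration U h.measurable_input).le n) le_rfl).aestronglyMeasurable) ?_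
      refine Eventually.of_forall fun ω => ?_
      rw [Real.norm_eq_abs, Real.norm_eq_abs, abs_of_nonneg (by positivity),
        abs_of_nonneg (by positivity)]
      exact hdom ω
    obtain ⟨hp1, hp2⟩ := integrable_mul_of_past h.indep h.law hZm hZint (h := fun ξ => M ξ ^ 2)
      (r.measurable_bound.pow_const 2) hMint
    have hq1 : Integrable (fun ω => ‖φ (U n ω)‖ ^ 2) P := by
      rw [← h.law n] at hφint
      exact (integrable_map_measure (r.measurable_left.norm.pow_const 2).aestronglyMeasurable
        (h.measurable_input n).aemeasurable).1 hφint
    have hq2 : ∫ ω, ‖φ (U n ω)‖ ^ 2 ∂P = ∫ ξ, ‖φ ξ‖ ^ 2 ∂μ := by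
      rw [← h.law n, integral_map (h.measurable_input n).aemeasurable
        (r.measurable_left.norm.pow_const 2).aestronglyMeasurable]
    refine ⟨(hp1.const_mul 2).add (hq1.const_mul 2), ?_⟩
    rw [integral_add (hp1.const_mul 2) (hq1.const_mul 2), integral_const_mul, integral_const_mul,
      hp2, hq2]
    have hZle : ∫ ω, (1 + ‖X n ω‖) ^ 2 ∂P
        ≤ 2 * (1 + ‖z‖) ^ 2 + 2 * ∫ ω, ‖X n ω - z‖ ^ 2 ∂P := by
      refine (integral_mono hZint hdomint hdom).trans_eq ?_
      rw [integral_add (integrable_const _) (hn.const_mul 2), integral_const, integral_const_mul]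
      simp
    have hM0 : 0 ≤ ∫ ξ, M ξ ^ 2 ∂μ := integral_nonneg fun ξ => sq_nonneg _
    have hφ0 : 0 ≤ ∫ ξ, ‖φ ξ‖ ^ 2 ∂μ := integral_nonneg fun ξ => sq_nonneg _
    have hv0 : 0 ≤ ∫ ω, ‖X n ω - z‖ ^ 2 ∂P := integral_nonneg fun ω => sq_nonneg _
    have h1 := mul_le_mul_of_nonneg_right hZle hM0
    have h2 := mul_nonneg hM0 hv0
    have h3 := mul_nonneg hφ0 hv0
    have h4 := mul_nonneg (mul_nonneg (sq_nonneg (1 + ‖z‖)) hM0) hv0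
    nlinarith

end IsForwardBackward

end StochasticAlgorithm

end RandomMonotone

namespace RandomMonotone

/-! ### Moment bounds and almost sure boundedness of the iterates. -/

section ErrorTerm

variable {E Ξ : Type*} [NormedAddCommGroup E]

/-- The second order term of the Fejér inequality. -/
noncomputable def errorTerm (φ : Ξ → E) (M : Ξ → ℝ) (q : E × Ξ) : ℝ :=
  2 * ((1 + ‖q.1‖) ^ 2 * M q.2 ^ 2) + 2 * ‖φ q.2‖ ^ 2

theorem errorTerm_nonneg {φ : Ξ → E} {M : Ξ → ℝ} (q : E × Ξ) : 0 ≤ errorTerm φ M q := by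
  unfold errorTerm
  positivity

end ErrorTerm

section StochasticAlgorithm

variable {E : Type*} [NormedAddCommGroup E] [InnerProductSpace ℝ E]
  [MeasurableSpace E] {Ω Ξ : Type*} [MeasurableSpace Ω] [MeasurableSpace Ξ]
  [FiniteDimensional ℝ E] [BorelSpace E]
  {P : Measure Ω} {μ : Measure Ξ} {A : Ξ → E → Set E} {b : Ξ → E → E}
  {U : ℕ → Ω → Ξ} {g : ℕ → ℝ} {X : ℕ → Ω → E} {z : E} {φ ψ : Ξ → E} {M : Ξ → ℝ}
  [IsProbabilityMeasure P] [IsProbabilityMeasure μ]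

namespace IsForwardBackward

/-- By induction: the Fejér inequality bounds the next square by terms integrable at the current
time. -/
theorem integrable_sq_sub (h : IsForwardBackward P μ A b U g X)
    (r : IsReferencePoint μ A b z φ ψ M) (n : ℕ) :
    Integrable (fun ω => ‖X n ω - z‖ ^ 2) P := by
  induction n with
  | zero =>
    obtain ⟨x₀, hx₀⟩ := h.init
    simp only [hx₀]
    exact integrable_const _
  | succ n ih =>
    obtain ⟨⟨h1, -⟩, h2, -⟩ := h.integrable_terms r n ih
    refine Integrable.mono' ((ih.sub ((h1.const_mul (g n)).const_mul 2)).add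
      (h2.const_mul (g n ^ 2)))
      (((h.measurable (n + 1)).sub_const z).norm.pow_const 2).aestronglyMeasurable ?_
    filter_upwards [h.ae_fejer r n] with ω hω
    rw [Real.norm_eq_abs, abs_of_nonneg (sq_nonneg _)]
    refine le_trans ?_ hω
    have := mul_nonneg (sq_nonneg (g n))
      (sq_nonneg ‖backward A b (g n) (X n ω, U n ω) - φ (U n ω)‖)
    linarith

theorem integrable_backward_sq (h : IsForwardBackward P μ A b U g X)
    (r : IsReferencePoint μ A b z φ ψ M) (n : ℕ) :
    Integrable (fun ω => g n ^ 2 * ‖backward A b (g n) (X n ω, U n ω) - φ (U n ω)‖ ^ 2) P := by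
  have ih := h.integrable_sq_sub r n
  obtain ⟨⟨h1, -⟩, h2, -⟩ := h.integrable_terms r n ih
  have hm : Measurable fun ω => g n ^ 2 *
      ‖backward A b (g n) (X n ω, U n ω) - φ (U n ω)‖ ^ 2 :=
    ((((h.measurable_backward n).comp ((h.measurable n).prodMk (h.measurable_input n))).sub
      (r.measurable_left.comp (h.measurable_input n))).norm.pow_const 2).const_mul (g n ^ 2)
  refine Integrable.mono' ((ih.sub ((h1.const_mul (g n)).const_mul 2)).add
    (h2.const_mul (g n ^ 2))) hm.aestronglyMeasurable ?_
  filter_upwards [h.ae_fejer r n] with ω hω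
  rw [Real.norm_eq_abs, abs_of_nonneg (mul_nonneg (sq_nonneg _) (sq_nonneg _))]
  refine le_trans ?_ hω
  have := sq_nonneg ‖X (n + 1) ω - z‖
  linarith

/-- In the expectation of the Fejér inequality the centred term disappears, leaving a recursion with
relative errors `g n ^ 2 * C`, which are summable. -/
theorem exists_moment_bound (h : IsForwardBackward P μ A b U g X)
    (r : IsReferencePoint μ A b z φ ψ M) :
    (∃ V, ∀ n, ∫ ω, ‖X n ω - z‖ ^ 2 ∂P ≤ V) ∧
      Summable fun n =>
        ∫ ω, g n ^ 2 * ‖backward A b (g n) (X n ω, U n ω) - φ (U n ω)‖ ^ 2 ∂P := by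
  set C := 4 * (1 + ‖z‖) ^ 2 * (∫ ξ, M ξ ^ 2 ∂μ) + 4 * (∫ ξ, M ξ ^ 2 ∂μ)
    + 2 * ∫ ξ, ‖φ ξ‖ ^ 2 ∂μ with hC
  have hC0 : 0 ≤ C := by
    have hM0 : 0 ≤ ∫ ξ, M ξ ^ 2 ∂μ := integral_nonneg fun ξ => sq_nonneg _
    have hφ0 : 0 ≤ ∫ ξ, ‖φ ξ‖ ^ 2 ∂μ := integral_nonneg fun ξ => sq_nonneg _
    positivity
  refine exists_bound_of_recursion (c := fun n => g n ^ 2 * C)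
    (fun n => integral_nonneg fun ω => sq_nonneg _)
    (fun n => integral_nonneg fun ω => mul_nonneg (sq_nonneg _) (sq_nonneg _))
    (fun n => mul_nonneg (sq_nonneg _) hC0) (h.summable_sq.mul_right C) fun n => ?_
  have ih := h.integrable_sq_sub r n
  obtain ⟨⟨h1, h1'⟩, h2, h2'⟩ := h.integrable_terms r n ih
  have hi := (h1.const_mul (g n)).const_mul 2
  rw [← integral_add (h.integrable_sq_sub r (n + 1)) (h.integrable_backward_sq r n)]
  have e : ∫ ω, (‖X n ω - z‖ ^ 2 - 2 * (g n * ⟪φ (U n ω) + ψ (U n ω), X n ω - z⟫) + g n ^ 2 *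
        (2 * ((1 + ‖X n ω‖) ^ 2 * M (U n ω) ^ 2) + 2 * ‖φ (U n ω)‖ ^ 2)) ∂P =
      ∫ ω, ‖X n ω - z‖ ^ 2 ∂P - 2 * (g n * ∫ ω, ⟪φ (U n ω) + ψ (U n ω), X n ω - z⟫ ∂P) + g n ^ 2 *
        ∫ ω, (2 * ((1 + ‖X n ω‖) ^ 2 * M (U n ω) ^ 2) + 2 * ‖φ (U n ω)‖ ^ 2) ∂P := by
    have hs : Integrable (fun ω => ‖X n ω - z‖ ^ 2 -
        2 * (g n * ⟪φ (U n ω) + ψ (U n ω), X n ω - z⟫)) P := ih.sub hi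
    rw [integral_add hs (h2.const_mul (g n ^ 2)), integral_sub ih hi,
      integral_const_mul, integral_const_mul, integral_const_mul]
  refine (integral_mono_ae ((h.integrable_sq_sub r (n + 1)).add (h.integrable_backward_sq r n))
    ((ih.sub hi).add (h2.const_mul (g n ^ 2))) (h.ae_fejer r n)).trans (e.trans_le ?_)
  rw [h1']
  have := mul_le_mul_of_nonneg_left h2' (sq_nonneg (g n))
  nlinarith

theorem integrable_errorTerm (h : IsForwardBackward P μ A b U g X)
    (r : IsReferencePoint μ A b z φ ψ M) (n : ℕ) :
    Integrable (fun ω => g n ^ 2 * errorTerm φ M (X n ω, U n ω)) P :=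
  (h.integrable_terms r n (h.integrable_sq_sub r n)).2.1.const_mul _

theorem summable_errorTerm (h : IsForwardBackward P μ A b U g X)
    (r : IsReferencePoint μ A b z φ ψ M) :
    Summable fun n => ∫ ω, g n ^ 2 * errorTerm φ M (X n ω, U n ω) ∂P := by
  obtain ⟨⟨V, hV⟩, -⟩ := h.exists_moment_bound r
  have hM0 : 0 ≤ ∫ ξ, M ξ ^ 2 ∂μ := integral_nonneg fun ξ => sq_nonneg _
  have hφ0 : 0 ≤ ∫ ξ, ‖φ ξ‖ ^ 2 ∂μ := integral_nonneg fun ξ => sq_nonneg _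
  refine Summable.of_nonneg_of_le
    (fun n => integral_nonneg fun ω => mul_nonneg (sq_nonneg _) (errorTerm_nonneg _)) (fun n => ?_)
    (h.summable_sq.mul_right ((4 * (1 + ‖z‖) ^ 2 * (∫ ξ, M ξ ^ 2 ∂μ) + 4 * (∫ ξ, M ξ ^ 2 ∂μ)
      + 2 * ∫ ξ, ‖φ ξ‖ ^ 2 ∂μ) * (1 + V)))
  rw [integral_const_mul]
  refine mul_le_mul_of_nonneg_left ?_ (sq_nonneg _)
  refine (h.integrable_terms r n (h.integrable_sq_sub r n)).2.2.trans ?_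
  have := hV n
  gcongr

theorem ae_increment_sq_le (h : IsForwardBackward P μ A b U g X)
    (r : IsReferencePoint μ A b z φ ψ M) (n : ℕ) :
    ∀ᵐ ω ∂P, ‖increment A b (g n) (X n ω, U n ω)‖ ^ 2 ≤
      2 * (g n ^ 2 * ‖backward A b (g n) (X n ω, U n ω) - φ (U n ω)‖ ^ 2)
        + 2 * (g n ^ 2 * errorTerm φ M (X n ω, U n ω)) := by
  filter_upwards [h.ae_forward_sq_le r n] with ω hω
  set a := backward A b (g n) (X n ω, U n ω)
  have e : increment A b (g n) (X n ω, U n ω) =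
      -(g n • ((a - φ (U n ω)) + (b (U n ω) (X n ω) + φ (U n ω)))) := by
    rw [increment_eq (h.pos n)]
    congr 2
    abel
  rw [e, norm_neg, norm_smul, mul_pow, Real.norm_eq_abs, sq_abs]
  have h1 : ‖(a - φ (U n ω)) + (b (U n ω) (X n ω) + φ (U n ω))‖ ^ 2 ≤
      2 * ‖a - φ (U n ω)‖ ^ 2 + 2 * errorTerm φ M (X n ω, U n ω) := by
    have h2 : ‖b (U n ω) (X n ω) + φ (U n ω)‖ ^ 2 ≤ errorTerm φ M (X n ω, U n ω) := hω
    have h3 := norm_add_le (a - φ (U n ω)) (b (U n ω) (X n ω) + φ (U n ω))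
    have h4 := pow_le_pow_left₀ (norm_nonneg _) h3 2
    nlinarith [sq_nonneg (‖a - φ (U n ω)‖ - ‖b (U n ω) (X n ω) + φ (U n ω)‖)]
  nlinarith [mul_le_mul_of_nonneg_left h1 (sq_nonneg (g n))]

theorem integrable_increment_sq (h : IsForwardBackward P μ A b U g X)
    (r : IsReferencePoint μ A b z φ ψ M) (n : ℕ) :
    Integrable (fun ω => ‖increment A b (g n) (X n ω, U n ω)‖ ^ 2) P := by
  refine Integrable.mono' (((h.integrable_backward_sq r n).const_mul 2).add
    ((h.integrable_errorTerm r n).const_mul 2))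
    (((h.measurable_increment n).comp
      ((h.measurable n).prodMk (h.measurable_input n))).norm.pow_const 2).aestronglyMeasurable ?_
  filter_upwards [h.ae_increment_sq_le r n] with ω hω
  rwa [Real.norm_eq_abs, abs_of_nonneg (sq_nonneg _)]

theorem summable_increment_sq (h : IsForwardBackward P μ A b U g X)
    (r : IsReferencePoint μ A b z φ ψ M) :
    Summable fun n => ∫ ω, ‖increment A b (g n) (X n ω, U n ω)‖ ^ 2 ∂P := by
  refine Summable.of_nonneg_of_le (fun n => integral_nonneg fun ω => sq_nonneg _) (fun n => ?_)
    (((h.exists_moment_bound r).2.mul_left 2).add ((h.summable_errorTerm r).mul_left 2))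
  rw [← integral_const_mul, ← integral_const_mul, ← integral_add
    ((h.integrable_backward_sq r n).const_mul 2) ((h.integrable_errorTerm r n).const_mul 2)]
  exact integral_mono_ae (h.integrable_increment_sq r n)
    (((h.integrable_backward_sq r n).const_mul 2).add
      ((h.integrable_errorTerm r n).const_mul 2)) (h.ae_increment_sq_le r n)

/-- The noise of the reference point defines a convergent series. -/
theorem ae_tendsto_reference_noise (h : IsForwardBackward P μ A b U g X)
    (r : IsReferencePoint μ A b z φ ψ M) :
    ∀ᵐ ω ∂P, ∃ c, Tendsto (fun n => ∑ k ∈ Finset.range n,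
      g k * ⟪φ (U k ω) + ψ (U k ω), X k ω - z⟫) atTop (𝓝 c) := by
  have hL : MemLp (fun ξ => φ ξ + ψ ξ) 2 μ := r.memLp_left.add r.memLp_right
  have h_int : Integrable (fun ξ => ‖φ ξ + ψ ξ‖ ^ 2) μ := hL.norm.integrable_sq
  have hmeas : ∀ n, Measurable fun q : E × Ξ => g n * ⟪φ q.2 + ψ q.2, q.1 - z⟫ := fun n =>
    (((r.measurable_left.comp measurable_snd).add (r.measurable_right.comp measurable_snd)).inner
      (measurable_fst.sub_const z)).const_mul (g n)
  have hnorm : Measurable fun x : E => ‖x - z‖ ^ 2 := (measurable_id.sub_const z).norm.pow_const 2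
  have hprod (n : ℕ) := integrable_mul_of_past h.indep h.law (Z := fun ω => ‖X n ω - z‖ ^ 2)
    (hnorm.comp (h.adapted n)) (h.integrable_sq_sub r n) (h := fun ξ => ‖φ ξ + ψ ξ‖ ^ 2)
    ((r.measurable_left.add r.measurable_right).norm.pow_const 2) h_int
  have hle : ∀ n ω, (g n * ⟪φ (U n ω) + ψ (U n ω), X n ω - z⟫) ^ 2 ≤
      g n ^ 2 * (‖X n ω - z‖ ^ 2 * ‖φ (U n ω) + ψ (U n ω)‖ ^ 2) := by
    intro n ω
    rw [mul_pow, ← mul_pow ‖X n ω - z‖]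
    refine mul_le_mul_of_nonneg_left ?_ (sq_nonneg _)
    rw [← sq_abs, mul_comm ‖X n ω - z‖]
    exact pow_le_pow_left₀ (abs_nonneg _) (abs_real_inner_le_norm _ _) 2
  have hm : ∀ n, Measurable fun ω => g n * ⟪φ (U n ω) + ψ (U n ω), X n ω - z⟫ := fun n =>
    (hmeas n).comp ((h.measurable n).prodMk (h.measurable_input n))
  have hsq : ∀ n, Integrable (fun ω => (g n * ⟪φ (U n ω) + ψ (U n ω), X n ω - z⟫) ^ 2) P := by
    intro n
    refine Integrable.mono' ((hprod n).1.const_mul (g n ^ 2))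
      ((hm n).pow_const 2).aestronglyMeasurable (Eventually.of_forall fun ω => ?_)
    rw [Real.norm_eq_abs, abs_of_nonneg (sq_nonneg _)]
    exact hle n ω
  obtain ⟨⟨V, hV⟩, -⟩ := h.exists_moment_bound r
  refine ae_exists_tendsto_sum h.indep h.law h.adapted
    (f := fun n q => g n * ⟪φ q.2 + ψ q.2, q.1 - z⟫) hmeas (fun n x => ?_) (fun n => ?_) ?_
  · have e : ∫ ξ, ⟪x - z, φ ξ + ψ ξ⟫ ∂μ = ⟪x - z, ∫ ξ, (φ ξ + ψ ξ) ∂μ⟫ :=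
      integral_inner (hL.integrable one_le_two) (x - z)
    simp_rw [real_inner_comm (x - z)]
    rw [integral_const_mul, e, integral_add (r.memLp_left.integrable one_le_two)
      (r.memLp_right.integrable one_le_two), r.mean, inner_zero_right, mul_zero]
  · exact (memLp_two_iff_integrable_sq (hm n).aestronglyMeasurable).2 (hsq n)
  · refine Summable.of_nonneg_of_le (fun n => integral_nonneg fun ω => sq_nonneg _) (fun n => ?_)
      (h.summable_sq.mul_right (V * ∫ ξ, ‖φ ξ + ψ ξ‖ ^ 2 ∂μ))
    refine (integral_mono (hsq n) ((hprod n).1.const_mul (g n ^ 2)) (hle n)).trans ?_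
    rw [integral_const_mul, (hprod n).2]
    refine mul_le_mul_of_nonneg_left ?_ (sq_nonneg _)
    exact mul_le_mul_of_nonneg_right (hV n) (integral_nonneg fun ξ => sq_nonneg _)

/-- The Fejér inequality is summed along each path: the centred terms form a convergent series by
the martingale theorem, and the second order terms have finite expected sum. -/
theorem ae_bounded (h : IsForwardBackward P μ A b U g X)
    (r : IsReferencePoint μ A b z φ ψ M) : ∀ᵐ ω ∂P, ∃ R, ∀ n, ‖X n ω‖ ≤ R := by
  have hsum := ae_summable_of_summable_integral
    (fun n ω => mul_nonneg (sq_nonneg (g n)) (errorTerm_nonneg (X n ω, U n ω)))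
    (h.integrable_errorTerm r) (h.summable_errorTerm r)
  filter_upwards [hsum, h.ae_tendsto_reference_noise r, ae_all_iff.2 (h.ae_fejer r)]
    with ω h1 ⟨c, hc⟩ h3
  obtain ⟨K, hK⟩ := hc.abs.bddAbove_range
  set T := ∑' n, g n ^ 2 * errorTerm φ M (X n ω, U n ω)
  have h4 : ∀ n, ‖X n ω - z‖ ^ 2 ≤ ‖X 0 ω - z‖ ^ 2 - 2 * ∑ k ∈ Finset.range n,
      g k * ⟪φ (U k ω) + ψ (U k ω), X k ω - z⟫ + ∑ k ∈ Finset.range n,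
      g k ^ 2 * errorTerm φ M (X k ω, U k ω) := by
    intro n
    induction n with
    | zero => simp
    | succ n ih =>
      rw [Finset.sum_range_succ, Finset.sum_range_succ]
      have h5 := h3 n
      have h6 := mul_nonneg (sq_nonneg (g n))
        (sq_nonneg ‖backward A b (g n) (X n ω, U n ω) - φ (U n ω)‖)
      simp only [errorTerm] at ih ⊢
      linarith
  refine ⟨‖z‖ + (1 + (‖X 0 ω - z‖ ^ 2 + 2 * K + T)), fun n => ?_⟩
  have h5 := h1.sum_le_tsum (Finset.range n)
    fun k _ => mul_nonneg (sq_nonneg (g k)) (errorTerm_nonneg (X k ω, U k ω))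
  have h6 := neg_le_of_abs_le (hK ⟨n, rfl⟩)
  have h7 := norm_le_norm_add_norm_sub' (X n ω) z
  have h8 := h4 n
  nlinarith [sq_nonneg (‖X n ω - z‖ - 1)]

theorem ae_summable_increment_sq (h : IsForwardBackward P μ A b U g X)
    (r : IsReferencePoint μ A b z φ ψ M) :
    ∀ᵐ ω ∂P, Summable fun n => ‖increment A b (g n) (X n ω, U n ω)‖ ^ 2 :=
  ae_summable_of_summable_integral (fun _ _ => sq_nonneg _) (h.integrable_increment_sq r)
    (h.summable_increment_sq r)

end IsForwardBackward

end StochasticAlgorithm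

end RandomMonotone

namespace RandomMonotone

/-! ### Drift, noise and the test inequality along the iterates. -/

section Auxiliary

theorem norm_integral_sq_le {Ξ E : Type*} [MeasurableSpace Ξ] [NormedAddCommGroup E]
    [NormedSpace ℝ E] {μ : Measure Ξ} [IsProbabilityMeasure μ] {f : Ξ → E} (hf : MemLp f 2 μ) :
    ‖∫ ξ, f ξ ∂μ‖ ^ 2 ≤ ∫ ξ, ‖f ξ‖ ^ 2 ∂μ := by
  have h1 := variance_nonneg (fun ξ => ‖f ξ‖) μ
  rw [variance_eq_sub hf.norm] at h1
  have h2 := pow_le_pow_left₀ (norm_nonneg _) (norm_integral_le_integral_norm (μ := μ) f) 2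
  have h3 : ∫ ξ, ((fun ξ => ‖f ξ‖) ^ 2) ξ ∂μ = ∫ ξ, ‖f ξ‖ ^ 2 ∂μ := rfl
  rw [h3] at h1
  linarith

theorem _root_.MeasureTheory.Integrable.indicator_norm {Ξ E : Type*} [MeasurableSpace Ξ]
    [NormedAddCommGroup E] [MeasurableSpace E] [BorelSpace E] {μ : Measure Ξ} {f : Ξ → E}
    (hf : Integrable f μ) (K : ℝ) :
    Integrable (fun ξ => {v : E | K < ‖v‖}.indicator (fun v => ‖v‖) (f ξ)) μ := by
  refine Integrable.mono' hf.norm ?_ (Eventually.of_forall fun ξ => ?_)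
  · have := (measurable_norm (α := E)).indicator
      (measurableSet_lt (measurable_const (a := K)) measurable_norm)
    obtain ⟨f', hf'm, hf'⟩ := hf.aestronglyMeasurable
    exact ((this.comp hf'm.measurable).aestronglyMeasurable).congr
      (hf'.symm.mono fun ξ hξ => by simp only [Function.comp_apply, hξ])
  · rw [Real.norm_eq_abs, abs_of_nonneg (Set.indicator_nonneg (fun _ _ => norm_nonneg _) _)]
    exact Set.indicator_le_self' (fun _ _ => norm_nonneg _) _

theorem tendsto_integral_indicator_norm {Ξ E : Type*} [MeasurableSpace Ξ] [NormedAddCommGroup E]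
    [MeasurableSpace E] [BorelSpace E] {μ : Measure Ξ} {f : Ξ → E} (hf : Integrable f μ) :
    Tendsto (fun K : ℕ => ∫ ξ, {v : E | (K : ℝ) < ‖v‖}.indicator (fun v => ‖v‖) (f ξ) ∂μ)
      atTop (𝓝 0) := by
  have h := tendsto_integral_of_dominated_convergence (μ := μ)
    (F := fun (K : ℕ) ξ => {v : E | (K : ℝ) < ‖v‖}.indicator (fun v => ‖v‖) (f ξ))
    (f := fun _ => (0 : ℝ)) (fun ξ => ‖f ξ‖)
    (fun K => (hf.indicator_norm K).aestronglyMeasurable) hf.norm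
    (fun K => Eventually.of_forall fun ξ => ?_) (Eventually.of_forall fun ξ => ?_)
  · simpa using h
  · rw [Real.norm_eq_abs, abs_of_nonneg (Set.indicator_nonneg (fun _ _ => norm_nonneg _) _)]
    exact Set.indicator_le_self' (fun _ _ => norm_nonneg _) _
  · obtain ⟨n, hn⟩ := exists_nat_ge ‖f ξ‖
    refine tendsto_const_nhds.congr' ?_
    filter_upwards [eventually_ge_atTop n] with K hK
    rw [Set.indicator_of_notMem]
    simp only [Set.mem_ofPred_eq, not_lt]
    exact hn.trans (by exact_mod_cast hK)

theorem eventually_abs_sum_Ico_lt {a : ℕ → ℝ} {c ε : ℝ}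
    (h : Tendsto (fun n => ∑ k ∈ Finset.range n, a k) atTop (𝓝 c)) (hε : 0 < ε) :
    ∀ᶠ n in atTop, ∀ m, n ≤ m → |∑ k ∈ Finset.Ico n m, a k| < ε := by
  obtain ⟨N, hN⟩ := Metric.cauchySeq_iff.1 h.cauchySeq ε hε
  filter_upwards [eventually_ge_atTop N] with n hn m hm
  rw [Finset.sum_Ico_eq_sub _ hm]
  exact hN m (hn.trans hm) n hn

/-- The test inequality for a sequence whose increments have a drift controlled by `w` and whose
noise defines convergent series. -/
theorem eventually_test_of_drift {E : Type*} [NormedAddCommGroup E] [InnerProductSpace ℝ E]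
    {x d m : ℕ → E} {g : ℕ → ℝ} {y w : E} {η : ℝ}
    (hx : ∀ n, x (n + 1) = x n + d n) (hd : Summable fun n => ‖d n‖ ^ 2)
    (hnoise : ∃ c, Tendsto (fun n => ∑ k ∈ Finset.range n, ⟪d k - m k, x k⟫) atTop (𝓝 c))
    (hnoise' : ∃ c, Tendsto (fun n => ∑ k ∈ Finset.range n, ⟪d k - m k, y⟫) atTop (𝓝 c))
    (hη : 0 < η) (hdrift : ∀ᶠ n in atTop, ⟪m n, x n - y⟫ ≤ g n * (⟪w, y - x n⟫ + η)) :
    ∀ᶠ n in atTop, ∀ k, n ≤ k → ‖x k - y‖ ^ 2 / 2 ≤ ‖x n - y‖ ^ 2 / 2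
      + ∑ j ∈ Finset.Ico n k, g j * ⟪w, y - x j⟫ + η * (1 + ∑ j ∈ Finset.Ico n k, g j) := by
  obtain ⟨c, hc⟩ := hnoise
  obtain ⟨c', hc'⟩ := hnoise'
  obtain ⟨N, hN⟩ := eventually_atTop.1 hdrift
  have hη3 : 0 < η / 3 := by linarith
  filter_upwards [eventually_abs_sum_Ico_lt hc hη3, eventually_abs_sum_Ico_lt hc' hη3,
    eventually_abs_sum_Ico_lt hd.hasSum.tendsto_sum_nat hη3, eventually_ge_atTop N]
    with n h1 h2 h3 hn k hk
  have key : ∀ k, n ≤ k → ‖x k - y‖ ^ 2 / 2 ≤ ‖x n - y‖ ^ 2 / 2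
      + ∑ j ∈ Finset.Ico n k, g j * ⟪w, y - x j⟫ + η * ∑ j ∈ Finset.Ico n k, g j
      + ∑ j ∈ Finset.Ico n k, ⟪d j - m j, x j⟫ - ∑ j ∈ Finset.Ico n k, ⟪d j - m j, y⟫
      + (∑ j ∈ Finset.Ico n k, ‖d j‖ ^ 2) / 2 := by
    intro k hk
    induction k, hk using Nat.le_induction with
    | base => simp
    | succ k hk ih =>
      simp only [Finset.sum_Ico_succ_top hk]
      have e : x (k + 1) - y = (x k - y) + d k := by rw [hx]; abel
      rw [e, norm_add_sq_real, real_inner_comm]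
      -- The noise is split so that `y` occurs only in a constant direction; the other direction `x
      -- k` does not depend on the tested point.
      have e2 : ⟪d k, x k - y⟫ = ⟪m k, x k - y⟫ + ⟪d k - m k, x k⟫ - ⟪d k - m k, y⟫ := by
        simp only [inner_sub_left, inner_sub_right]
        ring
      rw [e2]
      have := hN k (hn.trans hk)
      linarith
  have h1' := (abs_lt.1 (h1 k hk)).2
  have h2' := (abs_lt.1 (h2 k hk)).1
  have h3' := (abs_lt.1 (h3 k hk)).2
  have := key k hk
  linarith

end Auxiliary

section StochasticAlgorithm

variable {E : Type*} [NormedAddCommGroup E] [InnerProductSpace ℝ E]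
  [MeasurableSpace E] {Ω Ξ : Type*} [MeasurableSpace Ω] [MeasurableSpace Ξ]

/-- The mean increment of the algorithm. -/
noncomputable def meanIncrement (μ : Measure Ξ) (A : Ξ → E → Set E) (b : Ξ → E → E) (g : ℝ)
    (x : E) : E :=
  ∫ ξ, increment A b g (x, ξ) ∂μ

variable [FiniteDimensional ℝ E] [BorelSpace E]
  {P : Measure Ω} {μ : Measure Ξ} {A : Ξ → E → Set E} {b : Ξ → E → E}
  {U : ℕ → Ω → Ξ} {g : ℕ → ℝ} {X : ℕ → Ω → E} {z : E} {φ ψ : Ξ → E} {M : Ξ → ℝ}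
  [IsProbabilityMeasure μ]

namespace IsForwardBackward

theorem memLp_increment (h : IsForwardBackward P μ A b U g X)
    (r : IsReferencePoint μ A b z φ ψ M) (n : ℕ) (x : E) :
    MemLp (fun ξ => increment A b (g n) (x, ξ)) 2 μ := by
  have hM : MemLp (fun ξ => (1 + ‖x‖) * M ξ) 2 μ := r.memLp_bound.const_mul _
  have hMφ : MemLp (fun ξ => (1 + ‖x‖) * M ξ + ‖φ ξ‖) 2 μ := hM.add r.memLp_left.norm
  have hMφ' : MemLp (fun ξ => 2 * g n * ((1 + ‖x‖) * M ξ + ‖φ ξ‖)) 2 μ := hMφ.const_mul _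
  have hdom : MemLp (fun ξ => ‖x - z‖ + 2 * g n * ((1 + ‖x‖) * M ξ + ‖φ ξ‖)) 2 μ :=
    (memLp_const ‖x - z‖).add hMφ'
  have hmeas : Measurable fun ξ => increment A b (g n) (x, ξ) :=
    (h.measurable_increment n).comp measurable_prodMk_left
  refine hdom.mono hmeas.aestronglyMeasurable ?_
  filter_upwards [r.growth x, r.mem] with ξ h1 h2
  have h3 := (h.maximal ξ).norm_forward_sub_le (h.pos n) x (b ξ x) h2
  have e : increment A b (g n) (x, ξ) =
      -(g n • ((yosida (g n) (A ξ) (x - g n • b ξ x) - φ ξ) + (b ξ x + φ ξ))) := by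
    rw [increment_eq (h.pos n), backward]
    congr 2
    abel
  rw [e, norm_neg, norm_smul, Real.norm_eq_abs, abs_of_pos (h.pos n)]
  refine le_trans ?_ (Real.le_norm_self _)
  have h4 := norm_add_le (yosida (g n) (A ξ) (x - g n • b ξ x) - φ ξ) (b ξ x + φ ξ)
  have h5 := norm_add_le (b ξ x) (φ ξ)
  have h6 : ‖b ξ x + φ ξ‖ ≤ (1 + ‖x‖) * M ξ + ‖φ ξ‖ := by linarith
  have h7 := mul_le_mul_of_nonneg_left h4 (h.pos n).le
  have h8 := mul_le_mul_of_nonneg_left h6 (h.pos n).le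
  linarith

theorem measurable_meanIncrement (h : IsForwardBackward P μ A b U g X) (n : ℕ) :
    Measurable (meanIncrement μ A b (g n)) :=
  (h.measurable_increment n).stronglyMeasurable.integral_prod_right'.measurable

/-- `IsMaximalMonotone.drift_ge` integrated over `ξ`, together with monotonicity of the forward
selection relative to `ψ'`. The level `K` separates a small `L¹` tail of `φ'` from a bounded part,
which costs only `g n * K²`. -/
theorem inner_meanIncrement_le (h : IsForwardBackward P μ A b U g X)
    (r : IsReferencePoint μ A b z φ ψ M) {y : E} {φ' ψ' : Ξ → E} (hφ' : Integrable φ' μ)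
    (hψ' : Integrable ψ' μ) (hmem : ∀ᵐ ξ ∂μ, φ' ξ ∈ A ξ y)
    {x : E} (hmono : ∀ᵐ ξ ∂μ, 0 ≤ ⟪b ξ x - ψ' ξ, x - y⟫) (n K : ℕ) :
    ⟪meanIncrement μ A b (g n) x, x - y⟫ ≤ g n * (⟪∫ ξ, φ' ξ ∂μ + ∫ ξ, ψ' ξ ∂μ, y - x⟫ +
      2 * (∫ ξ, {v : E | (K : ℝ) < ‖v‖}.indicator (fun v => ‖v‖) (φ' ξ) ∂μ) * ‖x - y‖ +
      g n * ((1 + ‖x‖) ^ 2 * (∫ ξ, M ξ ^ 2 ∂μ) + (K : ℝ) ^ 2)) := by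
  have hi := (h.memLp_increment r n x).integrable one_le_two
  have hind := hφ'.indicator_norm (K : ℝ)
  have hM : Integrable (fun ξ => M ξ ^ 2) μ := r.memLp_bound.integrable_sq
  have hφψ : Integrable (fun ξ => φ' ξ + ψ' ξ) μ := hφ'.add hψ'
  have hin : Integrable (fun ξ => ⟪y - x, φ' ξ + ψ' ξ⟫) μ := hφψ.const_inner (y - x)
  have hr1 := (hind.const_mul 2).mul_const ‖x - y‖
  have hr2 : Integrable (fun ξ => g n * ((1 + ‖x‖) ^ 2 * M ξ ^ 2 + (K : ℝ) ^ 2)) μ :=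
    ((hM.const_mul ((1 + ‖x‖) ^ 2)).add (integrable_const ((K : ℝ) ^ 2))).const_mul (g n)
  have e1 : ⟪meanIncrement μ A b (g n) x, x - y⟫ =
      ∫ ξ, ⟪x - y, increment A b (g n) (x, ξ)⟫ ∂μ := by
    rw [integral_inner hi, real_inner_comm, meanIncrement]
  have e2 : g n * (⟪∫ ξ, φ' ξ ∂μ + ∫ ξ, ψ' ξ ∂μ, y - x⟫ +
      2 * (∫ ξ, {v : E | (K : ℝ) < ‖v‖}.indicator (fun v => ‖v‖) (φ' ξ) ∂μ) * ‖x - y‖ +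
      g n * ((1 + ‖x‖) ^ 2 * (∫ ξ, M ξ ^ 2 ∂μ) + (K : ℝ) ^ 2)) =
      ∫ ξ, g n * (⟪y - x, φ' ξ + ψ' ξ⟫ +
        2 * ({v : E | (K : ℝ) < ‖v‖}.indicator (fun v => ‖v‖) (φ' ξ)) * ‖x - y‖ +
        g n * ((1 + ‖x‖) ^ 2 * M ξ ^ 2 + (K : ℝ) ^ 2)) ∂μ := by
    have i12 : Integrable (fun ξ => ⟪y - x, φ' ξ + ψ' ξ⟫ +
        2 * ({v : E | (K : ℝ) < ‖v‖}.indicator (fun v => ‖v‖) (φ' ξ)) * ‖x - y‖) μ := hin.add hr1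
    rw [integral_const_mul, integral_add i12 hr2, integral_add hin hr1, integral_inner hφψ,
      integral_add hφ' hψ', integral_mul_const, integral_const_mul, integral_const_mul,
      integral_add (hM.const_mul _) (integrable_const _), integral_const_mul, integral_const,
      probReal_univ, one_smul, real_inner_comm]
  rw [e1, e2]
  refine integral_mono_ae (hi.const_inner _) (((hin.add hr1).add hr2).const_mul (g n)) ?_
  filter_upwards [hmono, hmem, r.growth x] with ξ h1 h2 h3
  have h4 := (h.maximal ξ).drift_ge (h.pos n) x (b ξ x) h2 (K := K)
  have h5 : ‖b ξ x‖ ^ 2 ≤ (1 + ‖x‖) ^ 2 * M ξ ^ 2 := by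
    rw [← mul_pow, mul_comm]
    exact pow_le_pow_left₀ (norm_nonneg _) h3 2
  rw [increment_eq (h.pos n), backward, inner_neg_right, real_inner_smul_right, ← mul_neg]
  refine mul_le_mul_of_nonneg_left ?_ (h.pos n).le
  have h6 := mul_le_mul_of_nonneg_left h5 (h.pos n).le
  have e3 : ⟪y - x, φ' ξ + ψ' ξ⟫ = -(⟪φ' ξ, x - y⟫ + ⟪ψ' ξ, x - y⟫) := by
    rw [← neg_sub x y, inner_neg_left, inner_add_right, real_inner_comm, real_inner_comm (ψ' ξ)]
  rw [inner_sub_left] at h1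
  rw [e3, inner_add_right, real_inner_comm, real_inner_comm (b ξ x)]
  dsimp only
  linarith

/-- The order of choices matters: the truncation level `K` makes the tail small first, then the step
makes the remaining error small. -/
theorem eventually_inner_meanIncrement_le (h : IsForwardBackward P μ A b U g X)
    (r : IsReferencePoint μ A b z φ ψ M) {y : E} {φ' ψ' : Ξ → E} (hφ' : Integrable φ' μ)
    (hψ' : Integrable ψ' μ) (hmem : ∀ᵐ ξ ∂μ, φ' ξ ∈ A ξ y)
    (hmono : ∀ x, ∀ᵐ ξ ∂μ, 0 ≤ ⟪b ξ x - ψ' ξ, x - y⟫) (R : ℝ) {η : ℝ} (hη : 0 < η) :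
    ∀ᶠ n in atTop, ∀ x, ‖x‖ ≤ R → ⟪meanIncrement μ A b (g n) x, x - y⟫ ≤
      g n * (⟪∫ ξ, φ' ξ ∂μ + ∫ ξ, ψ' ξ ∂μ, y - x⟫ + η) := by
  have h1 := ((tendsto_integral_indicator_norm hφ').const_mul 2).mul_const (R + ‖y‖)
  rw [mul_zero, zero_mul] at h1
  obtain ⟨K, hK⟩ := (h1.eventually (gt_mem_nhds (half_pos hη))).exists
  have h2 := h.tendsto_step.mul_const ((1 + R) ^ 2 * (∫ ξ, M ξ ^ 2 ∂μ) + (K : ℝ) ^ 2)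
  rw [zero_mul] at h2
  filter_upwards [h2.eventually (gt_mem_nhds (half_pos hη))] with n hn x hx
  refine (h.inner_meanIncrement_le r hφ' hψ' hmem (hmono x) n K).trans
    (mul_le_mul_of_nonneg_left ?_ (h.pos n).le)
  have hI : 0 ≤ ∫ ξ, {v : E | (K : ℝ) < ‖v‖}.indicator (fun v => ‖v‖) (φ' ξ) ∂μ :=
    integral_nonneg fun ξ => Set.indicator_nonneg (fun _ _ => norm_nonneg _) _
  have hM : 0 ≤ ∫ ξ, M ξ ^ 2 ∂μ := integral_nonneg fun ξ => sq_nonneg _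
  have h3 : ‖x - y‖ ≤ R + ‖y‖ := (norm_sub_le _ _).trans (by linarith)
  have h4 := mul_le_mul_of_nonneg_left h3 (mul_nonneg zero_le_two hI)
  have h5 : g n * ((1 + ‖x‖) ^ 2 * (∫ ξ, M ξ ^ 2 ∂μ) + (K : ℝ) ^ 2) ≤
      g n * ((1 + R) ^ 2 * (∫ ξ, M ξ ^ 2 ∂μ) + (K : ℝ) ^ 2) := by
    have := (h.pos n).le
    gcongr
  linarith

variable [IsProbabilityMeasure P]

/-- Jensen's inequality in `ξ` at the current iterate, then independence of the new input. -/
theorem integrable_meanIncrement_sq (h : IsForwardBackward P μ A b U g X)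
    (r : IsReferencePoint μ A b z φ ψ M) (n : ℕ) :
    Integrable (fun ω => ‖meanIncrement μ A b (g n) (X n ω)‖ ^ 2) P ∧
      ∫ ω, ‖meanIncrement μ A b (g n) (X n ω)‖ ^ 2 ∂P
        ≤ ∫ ω, ‖increment A b (g n) (X n ω, U n ω)‖ ^ 2 ∂P := by
  have hm : Measurable fun q : E × Ξ => ‖increment A b (g n) q‖ ^ 2 :=
    (h.measurable_increment n).norm.pow_const 2
  have h_int := integrable_integral_prodMk h.indep h.law (h.adapted n) hm
    (h.integrable_increment_sq r n)
  have hle : ∀ ω, ‖meanIncrement μ A b (g n) (X n ω)‖ ^ 2 ≤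
      ∫ ξ, ‖increment A b (g n) (X n ω, ξ)‖ ^ 2 ∂μ := fun ω =>
    norm_integral_sq_le (h.memLp_increment r n (X n ω))
  have hi : Integrable (fun ω => ‖meanIncrement μ A b (g n) (X n ω)‖ ^ 2) P := by
    refine Integrable.mono' h_int (((h.measurable_meanIncrement n).comp
      (h.measurable n)).norm.pow_const 2).aestronglyMeasurable (Eventually.of_forall fun ω => ?_)
    rw [Real.norm_eq_abs, abs_of_nonneg (sq_nonneg _)]
    exact hle ω
  refine ⟨hi, ?_⟩
  rw [integral_prodMk_eq h.indep h.law (h.adapted n) hm (h.integrable_increment_sq r n)]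
  exact integral_mono hi h_int hle

/-- The noise of the algorithm in bounded directions defines a convergent series. -/
theorem ae_tendsto_noise (h : IsForwardBackward P μ A b U g X)
    (r : IsReferencePoint μ A b z φ ψ M) {q : E → E} (hq : Measurable q) {K : ℝ}
    (hK : ∀ x, ‖q x‖ ≤ K) :
    ∀ᵐ ω ∂P, ∃ c, Tendsto (fun n => ∑ k ∈ Finset.range n,
      ⟪increment A b (g k) (X k ω, U k ω) - meanIncrement μ A b (g k) (X k ω), q (X k ω)⟫)
        atTop (𝓝 c) := by
  have hmeas : ∀ n, Measurable fun s : E × Ξ =>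
      ⟪increment A b (g n) s - meanIncrement μ A b (g n) s.1, q s.1⟫ := fun n =>
    ((h.measurable_increment n).sub ((h.measurable_meanIncrement n).comp measurable_fst)).inner
      (hq.comp measurable_fst)
  have hm : ∀ n, Measurable fun ω => ⟪increment A b (g n) (X n ω, U n ω)
      - meanIncrement μ A b (g n) (X n ω), q (X n ω)⟫ := fun n =>
    (hmeas n).comp ((h.measurable n).prodMk (h.measurable_input n))
  have hle : ∀ n ω, ⟪increment A b (g n) (X n ω, U n ω)
      - meanIncrement μ A b (g n) (X n ω), q (X n ω)⟫ ^ 2 ≤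
      2 * K ^ 2 * (‖increment A b (g n) (X n ω, U n ω)‖ ^ 2
        + ‖meanIncrement μ A b (g n) (X n ω)‖ ^ 2) := by
    intro n ω
    set d := increment A b (g n) (X n ω, U n ω)
    set m := meanIncrement μ A b (g n) (X n ω)
    have h1 : |⟪d - m, q (X n ω)⟫| ≤ (‖d‖ + ‖m‖) * K :=
      (abs_real_inner_le_norm _ _).trans (mul_le_mul (norm_sub_le _ _) (hK _) (norm_nonneg _)
        (add_nonneg (norm_nonneg _) (norm_nonneg _)))
    have h2 := pow_le_pow_left₀ (abs_nonneg _) h1 2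
    rw [sq_abs, mul_pow] at h2
    nlinarith [mul_nonneg (sq_nonneg K) (sq_nonneg (‖d‖ - ‖m‖))]
  have hdom : ∀ n, Integrable (fun ω => 2 * K ^ 2 * (‖increment A b (g n) (X n ω, U n ω)‖ ^ 2
        + ‖meanIncrement μ A b (g n) (X n ω)‖ ^ 2)) P := fun n =>
    ((h.integrable_increment_sq r n).add (h.integrable_meanIncrement_sq r n).1).const_mul _
  have hsq : ∀ n, Integrable (fun ω => ⟪increment A b (g n) (X n ω, U n ω)
      - meanIncrement μ A b (g n) (X n ω), q (X n ω)⟫ ^ 2) P := by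
    intro n
    refine Integrable.mono' (hdom n) ((hm n).pow_const 2).aestronglyMeasurable
      (Eventually.of_forall fun ω => ?_)
    rw [Real.norm_eq_abs, abs_of_nonneg (sq_nonneg _)]
    exact hle n ω
  refine ae_exists_tendsto_sum h.indep h.law h.adapted
    (f := fun n s => ⟪increment A b (g n) s - meanIncrement μ A b (g n) s.1, q s.1⟫) hmeas
    (fun n x => ?_) (fun n => ?_) ?_
  · have hi := (h.memLp_increment r n x).integrable one_le_two
    have hi' : Integrable (fun ξ => increment A b (g n) (x, ξ) - meanIncrement μ A b (g n) x) μ :=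
      hi.sub (integrable_const _)
    simp_rw [real_inner_comm (q x)]
    rw [integral_inner hi', integral_sub hi (integrable_const _), integral_const, probReal_univ,
      one_smul, meanIncrement, sub_self, inner_zero_right]
  · exact (memLp_two_iff_integrable_sq (hm n).aestronglyMeasurable).2 (hsq n)
  · refine Summable.of_nonneg_of_le (fun n => integral_nonneg fun ω => sq_nonneg _) (fun n => ?_)
      ((h.summable_increment_sq r).mul_left (4 * K ^ 2))
    refine (integral_mono (hsq n) (hdom n) (hle n)).trans ?_
    rw [integral_const_mul, integral_add (h.integrable_increment_sq r n)
      (h.integrable_meanIncrement_sq r n).1]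
    nlinarith [mul_le_mul_of_nonneg_left (h.integrable_meanIncrement_sq r n).2 (sq_nonneg K)]

/-- Almost surely, the iterates satisfy the test inequality at every point of the graph of the
mean operator. -/
theorem ae_test (h : IsForwardBackward P μ A b U g X) (r : IsReferencePoint μ A b z φ ψ M) :
    ∀ᵐ ω ∂P, ∀ (y : E) (φ' ψ' : Ξ → E), Integrable φ' μ → Integrable ψ' μ →
      (∀ᵐ ξ ∂μ, φ' ξ ∈ A ξ y) → (∀ x, ∀ᵐ ξ ∂μ, 0 ≤ ⟪b ξ x - ψ' ξ, x - y⟫) → ∀ η > 0,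
      ∀ᶠ n in atTop, ∀ m, n ≤ m → ‖X m ω - y‖ ^ 2 / 2 ≤ ‖X n ω - y‖ ^ 2 / 2
        + ∑ k ∈ Finset.Ico n m, g k * ⟪∫ ξ, φ' ξ ∂μ + ∫ ξ, ψ' ξ ∂μ, y - X k ω⟫
        + η * (1 + ∑ k ∈ Finset.Ico n m, g k) := by
  set e := stdOrthonormalBasis ℝ E
  -- The exceptional sets come from countably many noise series: basis directions, from which every
  -- `y` is obtained by linearity, and the iterate truncated to balls of integer radius. None
  -- depends on the graph point; on a bounded path a large truncation is inactive.
  have hbasis := ae_all_iff.2 fun i => h.ae_tendsto_noise r (q := fun _ => e i) measurable_const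
    (K := 1) fun _ => (e.orthonormal.1 i).le
  have hball := ae_all_iff.2 fun R : ℕ => h.ae_tendsto_noise r
    (q := (Metric.closedBall (0 : E) R).indicator id)
    (measurable_id.indicator Metric.isClosed_closedBall.measurableSet) (K := R) fun x => by
      by_cases hx : x ∈ Metric.closedBall (0 : E) R
      · rw [Set.indicator_of_mem hx]
        exact mem_closedBall_zero_iff.1 hx
      · rw [Set.indicator_of_notMem hx, norm_zero]
        exact Nat.cast_nonneg R
  filter_upwards [hbasis, hball, h.ae_bounded r, h.ae_summable_increment_sq r]
    with ω h1 h2 ⟨R, hR⟩ h4 y φ' ψ' hφ' hψ' hmem hmono η hη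
  refine eventually_test_of_drift (d := fun n => increment A b (g n) (X n ω, U n ω))
    (m := fun n => meanIncrement μ A b (g n) (X n ω)) (x := fun n => X n ω)
    (fun n => h.succ_eq n ω) h4 ?_ ?_ hη ?_
  · obtain ⟨R', hR'⟩ := exists_nat_ge R
    obtain ⟨c, hc⟩ := h2 R'
    refine ⟨c, hc.congr fun n => Finset.sum_congr rfl fun k _ => ?_⟩
    rw [Set.indicator_of_mem (mem_closedBall_zero_iff.2 ((hR k).trans hR')), id]
  · choose c hc using h1
    refine ⟨∑ i, ⟪e i, y⟫ * c i, (tendsto_finsetSum _ fun i _ =>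
      (hc i).const_mul ⟪e i, y⟫).congr fun n => ?_⟩
    simp_rw [Finset.mul_sum]
    rw [Finset.sum_comm]
    refine Finset.sum_congr rfl fun k _ => ?_
    rw [← e.sum_inner_mul_inner]
    exact Finset.sum_congr rfl fun i _ => mul_comm _ _
  · filter_upwards [h.eventually_inner_meanIncrement_le r hφ' hψ' hmem hmono R hη] with n hn
    exact hn _ (hR n)

end IsForwardBackward

end StochasticAlgorithm

end RandomMonotone

namespace RandomMonotone

/-! ### Convergence of the distance to the essential domain. -/

section EssentialDomain

variable {E : Type*} [NormedAddCommGroup E]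

theorem infDist_dom_le_of_subset {A : E → Set E} {S : Set E} (hS : S.Nonempty)
    (h : closure S ⊆ closure (dom A)) (x : E) :
    Metric.infDist x (dom A) ≤ Metric.infDist x S := by
  rw [← Metric.infDist_closure (s := dom A), ← Metric.infDist_closure (s := S)]
  exact Metric.infDist_le_infDist_of_subset h hS.closure

variable [InnerProductSpace ℝ E] [FiniteDimensional ℝ E] {Ξ : Type*} [MeasurableSpace Ξ]

/-- Each point of the essential domain has its own null set; a countable dense subset yields a
common one, and closures recover the rest. -/
theorem ae_closure_essDom_subset (μ : Measure Ξ) (A : Ξ → E → Set E) :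
    ∀ᵐ ξ ∂μ, closure (essDom μ A) ⊆ closure (dom (A ξ)) := by
  obtain ⟨t, hts, htc, hst⟩ :=
    (TopologicalSpace.IsSeparable.of_separableSpace (essDom μ A)).exists_countable_dense_subset
  have h : ∀ᵐ ξ ∂μ, ∀ x ∈ t, x ∈ dom (A ξ) := (ae_ball_iff htc).2 fun x hx => hts hx
  filter_upwards [h] with ξ hξ
  refine closure_minimal (hst.trans (closure_mono fun x hx => hξ x hx)) isClosed_closure

end EssentialDomain

section DistanceToDomain

variable {E : Type*} [NormedAddCommGroup E] [InnerProductSpace ℝ E]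
  [MeasurableSpace E] {Ω Ξ : Type*} [MeasurableSpace Ω] [MeasurableSpace Ξ]

/-- The bound of the squared distance to the essential domain after one step. -/
noncomputable def distBound (μ : Measure Ξ) (A : Ξ → E → Set E) (b : Ξ → E → E) (C γ : ℝ)
    (q : E × Ξ) : ℝ :=
  (1 + C) * (Metric.infDist q.1 (essDom μ A) ^ 2 - Metric.infDist q.1 (dom (A q.2)) ^ 2)
    + 2 * (1 + C⁻¹) * (γ ^ 2 * ‖b q.2 q.1‖ ^ 2
      + ‖resolvent γ (A q.2) q.1 - proj (closure (dom (A q.2))) q.1‖ ^ 2)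

variable [FiniteDimensional ℝ E] {P : Measure Ω} {μ : Measure Ξ} {A : Ξ → E → Set E}
  {b : Ξ → E → E} {U : ℕ → Ω → Ξ} {g : ℕ → ℝ} {X : ℕ → Ω → E} {z : E} {φ ψ : Ξ → E} {M : Ξ → ℝ}

namespace IsForwardBackward

theorem infDist_succ_sq_le (h : IsForwardBackward P μ A b U g X)
    (hne : (essDom μ A).Nonempty) {C γ : ℝ} (hC : 0 < C) (hγ : 0 < γ) (x : E) {ξ : Ξ}
    (hξ : closure (essDom μ A) ⊆ closure (dom (A ξ))) :
    Metric.infDist (resolvent γ (A ξ) (x - γ • b ξ x)) (essDom μ A) ^ 2 ≤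
      distBound μ A b C γ (x, ξ) := by
  have h1 := (h.maximal ξ).infDist_step_le hγ x (b ξ x) isClosed_closure hne.closure hξ hC
  rwa [Metric.infDist_closure, Metric.infDist_closure] at h1

variable [BorelSpace E]

theorem measurable_distBound (h : IsForwardBackward P μ A b U g X) (C : ℝ) {γ : ℝ} (hγ : 0 < γ) :
    Measurable (distBound μ A b C γ) := by
  have h1 : Measurable fun q : E × Ξ => Metric.infDist q.1 (essDom μ A) :=
    (Metric.continuous_infDist_pt _).measurable.comp measurable_fst
  have h2 := measurable_uncurry_infDist_dom h.maximal h.measurable_graph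
  have h3 := h.measurable_b
  have h4 := (measurable_uncurry_resolvent h.maximal h.measurable_graph hγ).sub
    (measurable_uncurry_proj h.maximal h.measurable_graph)
  exact (((h1.pow_const 2).sub (h2.pow_const 2)).const_mul _).add
    ((((h3.norm.pow_const 2).const_mul _).add (h4.norm.pow_const 2)).const_mul _)

variable [IsProbabilityMeasure μ]

theorem integrable_infDist_dom_sq (h : IsForwardBackward P μ A b U g X)
    (hne : (essDom μ A).Nonempty) (x : E) :
    Integrable (fun ξ => Metric.infDist x (dom (A ξ)) ^ 2) μ := by
  have hm : Measurable fun ξ => Metric.infDist x (dom (A ξ)) ^ 2 :=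
    ((measurable_uncurry_infDist_dom h.maximal h.measurable_graph).comp
      measurable_prodMk_left).pow_const 2
  refine Integrable.mono' (integrable_const (Metric.infDist x (essDom μ A) ^ 2))
    hm.aestronglyMeasurable ?_
  filter_upwards [ae_closure_essDom_subset μ A] with ξ hξ
  rw [Real.norm_eq_abs, abs_of_nonneg (sq_nonneg _)]
  exact pow_le_pow_left₀ Metric.infDist_nonneg (infDist_dom_le_of_subset hne hξ x) 2

/-- The comparison of distances with constant `C`, and Young's parameter also equal to `C`, give the
factor `(1 + C) (1 - C) = 1 - C²`. -/
theorem integral_distBound_le (h : IsForwardBackward P μ A b U g X)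
    (r : IsReferencePoint μ A b z φ ψ M) (hne : (essDom μ A).Nonempty) {C γ K R : ℝ} (hC : 0 < C)
    {x : E} (hx : ‖x‖ ≤ R)
    (hdist : C * Metric.infDist x (essDom μ A) ^ 2 ≤ ∫ ξ, Metric.infDist x (dom (A ξ)) ^ 2 ∂μ)
    (hJ : Integrable
      (fun ξ => ‖resolvent γ (A ξ) x - proj (closure (dom (A ξ))) x‖ ^ 2) μ)
    (hJle : ∫ ξ, ‖resolvent γ (A ξ) x - proj (closure (dom (A ξ))) x‖ ^ 2 ∂μ ≤ γ ^ 2 * K) :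
    Integrable (fun ξ => distBound μ A b C γ (x, ξ)) μ ∧
    ∫ ξ, distBound μ A b C γ (x, ξ) ∂μ ≤ (1 - C ^ 2) * Metric.infDist x (essDom μ A) ^ 2
      + γ ^ 2 * (2 * (1 + C⁻¹) * ((1 + R) ^ 2 * (∫ ξ, M ξ ^ 2 ∂μ) + K)) := by
  have hd := h.integrable_infDist_dom_sq hne x
  have hM : Integrable (fun ξ => M ξ ^ 2) μ := r.memLp_bound.integrable_sq
  have hbm : Measurable fun ξ => ‖b ξ x‖ ^ 2 :=
    (h.measurable_b.comp measurable_prodMk_left).norm.pow_const 2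
  have hble : ∀ᵐ ξ ∂μ, ‖b ξ x‖ ^ 2 ≤ (1 + R) ^ 2 * M ξ ^ 2 := by
    filter_upwards [r.growth x] with ξ hξ
    have h1 := pow_le_pow_left₀ (norm_nonneg _) hξ 2
    rw [mul_pow] at h1
    have h2 : (1 + ‖x‖) ^ 2 ≤ (1 + R) ^ 2 := by gcongr
    nlinarith [mul_le_mul_of_nonneg_left h2 (sq_nonneg (M ξ))]
  have hb : Integrable (fun ξ => ‖b ξ x‖ ^ 2) μ := by
    refine Integrable.mono' (hM.const_mul ((1 + R) ^ 2)) hbm.aestronglyMeasurable ?_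
    filter_upwards [hble] with ξ hξ
    rwa [Real.norm_eq_abs, abs_of_nonneg (sq_nonneg _)]
  have hbint : ∫ ξ, ‖b ξ x‖ ^ 2 ∂μ ≤ (1 + R) ^ 2 * ∫ ξ, M ξ ^ 2 ∂μ := by
    rw [← integral_const_mul]
    exact integral_mono_ae hb (hM.const_mul _) hble
  have i1 : Integrable (fun ξ => Metric.infDist x (essDom μ A) ^ 2
      - Metric.infDist x (dom (A ξ)) ^ 2) μ := (integrable_const _).sub hd
  have i2 : Integrable (fun ξ => γ ^ 2 * ‖b ξ x‖ ^ 2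
      + ‖resolvent γ (A ξ) x - proj (closure (dom (A ξ))) x‖ ^ 2) μ := (hb.const_mul _).add hJ
  refine ⟨(i1.const_mul (1 + C)).add (i2.const_mul (2 * (1 + C⁻¹))), ?_⟩
  simp only [distBound]
  rw [integral_add (i1.const_mul (1 + C)) (i2.const_mul (2 * (1 + C⁻¹))), integral_const_mul,
    integral_const_mul, integral_sub (integrable_const _) hd, integral_const, probReal_univ,
    one_smul, integral_add (hb.const_mul _) hJ, integral_const_mul]
  have h1 : (1 + C) * (Metric.infDist x (essDom μ A) ^ 2
      - ∫ ξ, Metric.infDist x (dom (A ξ)) ^ 2 ∂μ) ≤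
      (1 + C) * ((1 - C) * Metric.infDist x (essDom μ A) ^ 2) :=
    mul_le_mul_of_nonneg_left (by linarith) (by linarith)
  have h2 : 2 * (1 + C⁻¹) * (γ ^ 2 * ∫ ξ, ‖b ξ x‖ ^ 2 ∂μ
      + ∫ ξ, ‖resolvent γ (A ξ) x - proj (closure (dom (A ξ))) x‖ ^ 2 ∂μ) ≤
      2 * (1 + C⁻¹) * (γ ^ 2 * ((1 + R) ^ 2 * ∫ ξ, M ξ ^ 2 ∂μ) + γ ^ 2 * K) := by
    refine mul_le_mul_of_nonneg_left (add_le_add ?_ hJle) (by positivity)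
    exact mul_le_mul_of_nonneg_left hbint (sq_nonneg γ)
  linarith

variable [IsProbabilityMeasure P]

/-- The iterates approach the essential domain. -/
theorem ae_tendsto_infDist (h : IsForwardBackward P μ A b U g X)
    (r : IsReferencePoint μ A b z φ ψ M) (hne : (essDom μ A).Nonempty) {C : ℝ} (hC : 0 < C)
    (hC1 : C ≤ 1) (hdist : ∀ x,
      C * Metric.infDist x (essDom μ A) ^ 2 ≤ ∫ ξ, Metric.infDist x (dom (A ξ)) ^ 2 ∂μ)
    (hJ : ∀ R : ℝ, ∃ K, 0 ≤ K ∧ ∀ x, ‖x‖ ≤ R → ∀ γ, 0 < γ →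
      Integrable (fun ξ => ‖resolvent γ (A ξ) x - proj (closure (dom (A ξ))) x‖ ^ 2) μ ∧
      ∫ ξ, ‖resolvent γ (A ξ) x - proj (closure (dom (A ξ))) x‖ ^ 2 ∂μ ≤ γ ^ 2 * K) :
    ∀ᵐ ω ∂P, Tendsto (fun n => Metric.infDist (X n ω) (essDom μ A)) atTop (𝓝 0) := by
  set ℱ := pastFiltration U h.measurable_input with hℱ
  set D : E → ℝ := fun x => Metric.infDist x (essDom μ A) with hD
  have hDm : Measurable D := (Metric.continuous_infDist_pt _).measurable
  have hD0 : ∀ x, 0 ≤ D x := fun x => Metric.infDist_nonneg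
  obtain ⟨s, hs⟩ := hne
  have hloc : ∀ R : ℕ, ∀ᵐ ω ∂P, (∀ n, ‖X n ω‖ ≤ R) → Tendsto (fun n => D (X n ω)) atTop (𝓝 0) := by
    intro R
    obtain ⟨K, hK0, hK⟩ := hJ R
    set L := 2 * (1 + C⁻¹) * ((1 + (R : ℝ)) ^ 2 * (∫ ξ, M ξ ^ 2 ∂μ) + K) with hL
    have hL0 : 0 ≤ L := by
      have hM0 : 0 ≤ ∫ ξ, M ξ ^ 2 ∂μ := integral_nonneg fun ξ => sq_nonneg _
      positivity
    -- Localisation to paths that have stayed in the ball of radius `R`. The events decrease and are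
    -- known from the past, so their indicators can be carried through the recursion.
    set S : ℕ → Set Ω := fun n => {ω | ∀ k ≤ n, ‖X k ω‖ ≤ R} with hS
    have hSm : ∀ n, MeasurableSet[ℱ n] (S n) := by
      intro n
      have e : S n = ⋂ k ∈ Set.Iic n, X k ⁻¹' Metric.closedBall 0 R := by
        ext ω
        simp [hS]
      rw [e]
      exact MeasurableSet.biInter (Set.to_countable _) fun k hk =>
        ((h.adapted k).mono (ℱ.mono hk) le_rfl) Metric.isClosed_closedBall.measurableSet
    set Z : ℕ → Ω → ℝ := fun n => (S n).indicator fun _ => 1 with hZ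
    have hZm : ∀ n, Measurable[ℱ n] (Z n) := fun n => measurable_const.indicator (hSm n)
    have hZm' : ∀ n, Measurable (Z n) := fun n => (hZm n).mono (ℱ.le n) le_rfl
    have hZ0 : ∀ n ω, 0 ≤ Z n ω := fun n ω => Set.indicator_nonneg (fun _ _ => zero_le_one) ω
    have hZ1 : ∀ n ω, Z n ω ≤ 1 := fun n ω => Set.indicator_le_self' (fun _ _ => zero_le_one) ω
    have hZle : ∀ n ω, Z (n + 1) ω ≤ Z n ω := fun n ω =>
      Set.indicator_le_indicator_of_subset
        (show S (n + 1) ⊆ S n from fun ω hω k hk => hω k (hk.trans n.le_succ))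
        (fun _ => zero_le_one) ω
    have hDX : ∀ n, Measurable fun ω => D (X n ω) ^ 2 := fun n =>
      (hDm.comp (h.measurable n)).pow_const 2
    have h_int : ∀ n, Integrable (fun ω => Z n ω * D (X n ω) ^ 2) P := by
      intro n
      refine Integrable.mono' (integrable_const ((R + ‖s‖) ^ 2))
        ((hZm' n).mul (hDX n)).aestronglyMeasurable (Eventually.of_forall fun ω => ?_)
      rw [Real.norm_eq_abs, abs_of_nonneg (mul_nonneg (hZ0 n ω) (sq_nonneg _))]
      by_cases hω : ω ∈ S n
      · simp only [hZ, Set.indicator_of_mem hω, one_mul]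
        refine pow_le_pow_left₀ (hD0 _) ((Metric.infDist_le_dist_of_mem hs).trans ?_) 2
        rw [dist_eq_norm]
        exact (norm_sub_le _ _).trans (add_le_add_left (hω n le_rfl) _)
      · simp only [hZ, Set.indicator_of_notMem hω, zero_mul]
        positivity
    have hZint : ∀ n, Integrable (Z n) P := fun n =>
      (integrable_const (1 : ℝ)).mono' (hZm' n).aestronglyMeasurable
        (Eventually.of_forall fun ω => by
          rw [Real.norm_eq_abs, abs_of_nonneg (hZ0 n ω)]
          exact hZ1 n ω)
    have hrec : ∀ n, ∫ ω, Z (n + 1) ω * D (X (n + 1) ω) ^ 2 ∂P ≤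
        (1 - C ^ 2) * ∫ ω, Z n ω * D (X n ω) ^ 2 ∂P + g n ^ 2 * L := by
      intro n
      have hsub := h.ae_input n (ae_closure_essDom_subset μ A)
      -- Lower integrals allow the new input to be integrated first, without joint integrability of
      -- `distBound`, which is controlled only at fixed bounded points.
      have hpt : ∀ᵐ ω ∂P, ENNReal.ofReal (Z (n + 1) ω * D (X (n + 1) ω) ^ 2) ≤
          ENNReal.ofReal (Z n ω) * ENNReal.ofReal (distBound μ A b C (g n) (X n ω, U n ω)) := by
        filter_upwards [hsub] with ω hω
        rw [← ENNReal.ofReal_mul (hZ0 n ω)]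
        refine ENNReal.ofReal_le_ofReal (mul_le_mul (hZle n ω) ?_ (sq_nonneg _) (hZ0 n ω))
        rw [h.step]
        exact h.infDist_succ_sq_le ⟨s, hs⟩ hC (h.pos n) (X n ω) hω
      have hin : ∀ ω, ENNReal.ofReal (Z n ω) *
          ∫⁻ ξ, ENNReal.ofReal (distBound μ A b C (g n) (X n ω, ξ)) ∂μ ≤
          ENNReal.ofReal (Z n ω * ((1 - C ^ 2) * D (X n ω) ^ 2 + g n ^ 2 * L)) := by
        intro ω
        by_cases hω : ω ∈ S n
        · have hx : ‖X n ω‖ ≤ R := hω n le_rfl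
          obtain ⟨j1, j2⟩ := hK _ hx (g n) (h.pos n)
          obtain ⟨i1, i2⟩ := h.integral_distBound_le r ⟨s, hs⟩ hC hx (hdist _) j1 j2
          have hnn : 0 ≤ᵐ[μ] fun ξ => distBound μ A b C (g n) (X n ω, ξ) := by
            filter_upwards [ae_closure_essDom_subset μ A] with ξ hξ
            exact (sq_nonneg _).trans (h.infDist_succ_sq_le ⟨s, hs⟩ hC (h.pos n) (X n ω) hξ)
          rw [← ofReal_integral_eq_lintegral_ofReal i1 hnn, ← ENNReal.ofReal_mul (hZ0 n ω)]
          exact ENNReal.ofReal_le_ofReal (mul_le_mul_of_nonneg_left i2 (hZ0 n ω))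
        · simp [hZ, Set.indicator_of_notMem hω]
      have hC2 : 0 ≤ 1 - C ^ 2 := by nlinarith
      have hnn' : ∀ ω, 0 ≤ Z n ω * ((1 - C ^ 2) * D (X n ω) ^ 2 + g n ^ 2 * L) := fun ω =>
        mul_nonneg (hZ0 n ω) (add_nonneg (mul_nonneg hC2 (sq_nonneg _))
          (mul_nonneg (sq_nonneg _) hL0))
      have hsplit : ∀ ω, Z n ω * ((1 - C ^ 2) * D (X n ω) ^ 2 + g n ^ 2 * L) =
          (1 - C ^ 2) * (Z n ω * D (X n ω) ^ 2) + Z n ω * (g n ^ 2 * L) := fun ω => by ring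
      have hrint : Integrable
          (fun ω => Z n ω * ((1 - C ^ 2) * D (X n ω) ^ 2 + g n ^ 2 * L)) P := by
        simp only [hsplit]
        exact ((h_int n).const_mul _).add ((hZint n).mul_const _)
      have hfm : Measurable fun q : (ℝ × E) × Ξ => ENNReal.ofReal q.1.1 *
          ENNReal.ofReal (distBound μ A b C (g n) (q.1.2, q.2)) :=
        (measurable_fst.comp measurable_fst).ennreal_ofReal.mul
          ((h.measurable_distBound C (h.pos n)).comp
            ((measurable_snd.comp measurable_fst).prodMk measurable_snd)).ennreal_ofReal
      have hprod := lintegral_prodMk_eq h.indep h.law (Y := fun ω => (Z n ω, X n ω))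
        ((hZm n).prodMk (h.adapted n)) hfm
      have hchain : ENNReal.ofReal (∫ ω, Z (n + 1) ω * D (X (n + 1) ω) ^ 2 ∂P) ≤
          ENNReal.ofReal (∫ ω, Z n ω * ((1 - C ^ 2) * D (X n ω) ^ 2 + g n ^ 2 * L) ∂P) := by
        rw [ofReal_integral_eq_lintegral_ofReal (h_int (n + 1)) (Eventually.of_forall fun ω =>
          mul_nonneg (hZ0 _ ω) (sq_nonneg _)),
          ofReal_integral_eq_lintegral_ofReal hrint (Eventually.of_forall hnn')]
        refine (lintegral_mono_ae hpt).trans (hprod.trans_le (lintegral_mono fun ω => ?_))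
        dsimp only
        rw [lintegral_const_mul' _ _ ENNReal.ofReal_ne_top]
        exact hin ω
      rw [ENNReal.ofReal_le_ofReal_iff (integral_nonneg hnn')] at hchain
      refine hchain.trans ?_
      simp only [hsplit]
      rw [integral_add ((h_int n).const_mul _) ((hZint n).mul_const _), integral_const_mul,
        integral_mul_const]
      have h1 : ∫ ω, Z n ω ∂P ≤ 1 := by
        have := integral_mono (hZint n) (integrable_const (1 : ℝ)) (hZ1 n)
        simpa using this
      have := mul_le_mul_of_nonneg_right h1 (mul_nonneg (sq_nonneg (g n)) hL0)
      linarith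
    have hsummable := summable_of_contraction (ρ := 1 - C ^ 2)
      (e := fun n => ∫ ω, Z n ω * D (X n ω) ^ 2 ∂P)
      (fun n => integral_nonneg fun ω => mul_nonneg (hZ0 n ω) (sq_nonneg _))
      (fun n => mul_nonneg (sq_nonneg (g n)) hL0) (by nlinarith) (h.summable_sq.mul_right L) hrec
    filter_upwards [ae_summable_of_summable_integral
      (fun n ω => mul_nonneg (hZ0 n ω) (sq_nonneg _)) h_int hsummable] with ω hω hbd
    have h1 := hω.tendsto_atTop_zero.sqrt
    rw [Real.sqrt_zero] at h1
    refine h1.congr fun n => ?_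
    have : ω ∈ S n := fun k _ => hbd k
    simp only [hZ, Set.indicator_of_mem this, one_mul]
    exact Real.sqrt_sq (hD0 _)
  filter_upwards [h.ae_bounded r, ae_all_iff.2 hloc] with ω ⟨R, hR⟩ hω
  obtain ⟨R', hR'⟩ := exists_nat_ge R
  exact hω R' fun n => (hR n).trans hR'

end IsForwardBackward

end DistanceToDomain

end RandomMonotone

namespace RandomMonotone

/-! ### Integrability reductions and the main theorem. -/

section Integrability

variable {Ξ : Type*} [MeasurableSpace Ξ] {μ : Measure Ξ} [IsProbabilityMeasure μ]

/-- Uses `t² ≤ 1 + t⁴` at `t = ‖f ξ‖ / γ`, which keeps the factor `γ²`. -/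
theorem integral_sq_le_of_lintegral_pow_four {E : Type*} [NormedAddCommGroup E] {f : Ξ → E}
    (hf : AEStronglyMeasurable f μ) {γ K : ℝ} (hγ : 0 < γ) (hK : 0 ≤ K)
    (h : ENNReal.ofReal (1 / γ ^ 4) * ∫⁻ ξ, ‖f ξ‖ₑ ^ 4 ∂μ ≤ ENNReal.ofReal K) :
    Integrable (fun ξ => ‖f ξ‖ ^ 2) μ ∧ ∫ ξ, ‖f ξ‖ ^ 2 ∂μ ≤ γ ^ 2 * (1 + K) := by
  have hγ4 : 0 < 1 / γ ^ 4 := by positivity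
  have e : ∀ ξ, ‖f ξ‖ₑ ^ 4 = ENNReal.ofReal (‖f ξ‖ ^ 4) := fun ξ => by
    rw [← ofReal_norm, ENNReal.ofReal_pow (norm_nonneg _)]
  simp only [e] at h
  have hfin : ∫⁻ ξ, ENNReal.ofReal (‖f ξ‖ ^ 4) ∂μ ≠ ∞ := by
    intro htop
    rw [htop, ENNReal.mul_top (ENNReal.ofReal_pos.2 hγ4).ne'] at h
    exact absurd h (by simp)
  have h_int : Integrable (fun ξ => ‖f ξ‖ ^ 4) μ :=
    (lintegral_ofReal_ne_top_iff_integrable (hf.norm.pow 4)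
      (Eventually.of_forall fun ξ => pow_nonneg (norm_nonneg _) 4)).1 hfin
  rw [← ofReal_integral_eq_lintegral_ofReal h_int
    (Eventually.of_forall fun ξ => pow_nonneg (norm_nonneg _) 4),
    ← ENNReal.ofReal_mul hγ4.le, ENNReal.ofReal_le_ofReal_iff hK] at h
  have hle : ∀ ξ, ‖f ξ‖ ^ 2 ≤ γ ^ 2 * (1 + 1 / γ ^ 4 * ‖f ξ‖ ^ 4) := by
    intro ξ
    have h1 : ‖f ξ‖ ^ 2 = γ ^ 2 * (‖f ξ‖ / γ) ^ 2 := by field_simp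
    have h2 : 1 / γ ^ 4 * ‖f ξ‖ ^ 4 = ((‖f ξ‖ / γ) ^ 2) ^ 2 := by
      rw [← pow_mul, div_pow]
      ring
    rw [h1, h2]
    refine mul_le_mul_of_nonneg_left ?_ (sq_nonneg γ)
    nlinarith [sq_nonneg ((‖f ξ‖ / γ) ^ 2 - 1), sq_nonneg (‖f ξ‖ / γ)]
  have hdom : Integrable (fun ξ => γ ^ 2 * (1 + 1 / γ ^ 4 * ‖f ξ‖ ^ 4)) μ :=
    ((integrable_const 1).add (h_int.const_mul _)).const_mul _
  have hsq : Integrable (fun ξ => ‖f ξ‖ ^ 2) μ := by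
    refine Integrable.mono' hdom (hf.norm.pow 2) (Eventually.of_forall fun ξ => ?_)
    rw [Real.norm_eq_abs, abs_of_nonneg (sq_nonneg _)]
    exact hle ξ
  refine ⟨hsq, (integral_mono hsq hdom hle).trans ?_⟩
  rw [integral_const_mul, integral_add (integrable_const 1) (h_int.const_mul _), integral_const_mul,
    integral_const, probReal_univ, one_smul]
  exact mul_le_mul_of_nonneg_left (by linarith) (sq_nonneg γ)

/-- Measurability of `M` comes back from its power by a root, as `M ≥ 0`; integrability follows from
`M² ≤ 1 + M ^ (2 * p)`. -/
theorem memLp_two_of_integrable_pow {M : Ξ → ℝ} (hM : ∀ ξ, 0 ≤ M ξ) {p : ℕ} (hp : 1 ≤ p)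
    (h_int : Integrable (fun ξ => M ξ ^ (2 * p)) μ) : MemLp M 2 μ := by
  have hm : AEMeasurable M μ := by
    have h1 := h_int.aestronglyMeasurable.aemeasurable.pow_const (((2 * p : ℕ) : ℝ)⁻¹)
    refine h1.congr (Eventually.of_forall fun ξ => ?_)
    exact Real.pow_rpow_inv_natCast (hM ξ) (by omega)
  refine (memLp_two_iff_integrable_sq hm.aestronglyMeasurable).2 ?_
  refine Integrable.mono' ((integrable_const (1 : ℝ)).add h_int)
    (hm.pow_const 2).aestronglyMeasurable (Eventually.of_forall fun ξ => ?_)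
  rw [Real.norm_eq_abs, abs_of_nonneg (sq_nonneg _)]
  simp only [Pi.add_apply]
  rcases le_total (M ξ) 1 with h | h
  · have := pow_le_one₀ (hM ξ) h (n := 2)
    have := pow_nonneg (hM ξ) (2 * p)
    linarith
  · have := pow_le_pow_right₀ h (show 2 ≤ 2 * p by omega)
    linarith

end Integrability

section SumOfMeans

variable {E : Type*} [NormedAddCommGroup E] [InnerProductSpace ℝ E] {Ξ : Type*}
  [MeasurableSpace Ξ] {μ : Measure Ξ} {A B : Ξ → E → Set E}

/-- Identifies the set on which the semiflow lives with the one to which the distance estimate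
applies. -/
theorem dom_add_meanOperator_eq (hA : ∀ x ∈ essDom μ A, (selections μ 1 fun ξ => A ξ x).Nonempty)
    (hB : ∀ x, (selections μ 1 fun ξ => B ξ x).Nonempty) :
    dom (fun x => meanOperator μ A x + meanOperator μ B x) = essDom μ A := by
  ext x
  constructor
  · rintro ⟨v, hv⟩
    obtain ⟨_, ⟨φ, hφ, rfl⟩, -⟩ := Set.mem_add.1 hv
    exact hφ.2.mono fun ξ hξ => ⟨φ ξ, hξ⟩
  · intro hx
    obtain ⟨φ, hφ⟩ := hA x hx
    obtain ⟨ψ, hψ⟩ := hB x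
    exact ⟨_, Set.add_mem_add ⟨φ, hφ, rfl⟩ ⟨ψ, hψ, rfl⟩⟩

end SumOfMeans

end RandomMonotone

theorem theorem1 {N : ℕ}
    -- the complete probability space `(Ξ, μ)` and the random operators `A` and `B`
    {Ξ : Type*} [MeasurableSpace Ξ] (μ : Measure Ξ) [IsProbabilityMeasure μ] [μ.IsComplete]
    (A B : Ξ → EuclideanSpace ℝ (Fin N) → Set (EuclideanSpace ℝ (Fin N)))
    (hA : ∀ ξ, IsMaximalMonotone (A ξ))
    (hAmeas : MeasurableSetValued fun ξ => graph (A ξ))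
    (hD : (essDom μ A).Nonempty)
    (hAint : ∀ x ∈ essDom μ A, (selections μ 1 fun ξ => A ξ x).Nonempty)
    (hB : ∀ ξ, IsMaximalMonotone (B ξ))
    (hBmeas : MeasurableSetValued fun ξ => graph (B ξ))
    (hBdom : ∀ᵐ ξ ∂μ, dom (B ξ) = Set.univ)
    (hBint : ∀ x, (selections μ 1 fun ξ => B ξ x).Nonempty)
    -- the forward selection `b`
    (b : Ξ → EuclideanSpace ℝ (Fin N) → EuclideanSpace ℝ (Fin N))
    (hbmeas : Measurable (Function.uncurry b))
    (hbsel : ∀ x, (fun ξ => b ξ x) ∈ selections μ 1 fun ξ => B ξ x)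
    -- the step sizes `(γ_n)_{n ≥ 1}`, positive, in `ℓ² \ ℓ¹`
    (γ : ℕ → ℝ) (hγpos : ∀ n, 1 ≤ n → 0 < γ n)
    (hγ2 : Summable fun n => γ n ^ 2) (hγ1 : ¬ Summable γ)
    -- the iid sequence `(u_n)_{n ≥ 1}` with distribution `μ`
    {Ω : Type*} [MeasurableSpace Ω] (P : Measure Ω) [IsProbabilityMeasure P]
    (u : ℕ → Ω → Ξ) (humeas : ∀ n, 1 ≤ n → Measurable (u n))
    (hulaw : ∀ n, 1 ≤ n → P.map (u n) = μ)
    (huindep : iIndepFun (fun n => u (n + 1)) P)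
    (x₀ : EuclideanSpace ℝ (Fin N))
    -- the mean operator of `A` is maximal
    (hAmax : IsMaximalMonotone (meanOperator μ A))
    -- a zero with a `2p`-integrable representation
    (p : ℕ) (hp : 1 ≤ p) (xstar : EuclideanSpace ℝ (Fin N))
    (hzero : xstar ∈ zeros fun x => meanOperator μ A x + meanOperator μ B x)
    (hrep : (representations μ ((2 * p : ℕ) : ℝ≥0∞) A B xstar).Nonempty)
    -- moments of the least norm selection of `A`
    (hA0 : ∀ K : Set (EuclideanSpace ℝ (Fin N)), IsCompact K →
      ∃ ε : ℝ, 0 < ε ∧ ε ≤ 1 ∧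
        (⨆ x ∈ K ∩ essDom μ A, ∫⁻ ξ, ‖minSelection (A ξ) x‖ₑ ^ (1 + ε) ∂μ) < ∞ ∧
        ∃ y₀ ∈ essDom μ A, ∫⁻ ξ, ‖minSelection (A ξ) y₀‖ₑ ^ (1 + 1 / ε) ∂μ < ∞)
    -- distances to the domains, and slow variation of the steps
    (hdist : ∃ C : ℝ, 0 < C ∧ ∀ x : EuclideanSpace ℝ (Fin N),
      ENNReal.ofReal (C * Metric.infDist x (essDom μ A) ^ 2) ≤
        ∫⁻ ξ, ENNReal.ofReal (Metric.infDist x (dom (A ξ)) ^ 2) ∂μ)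
    (hγratio : Tendsto (fun n => γ (n + 1) / γ n) atTop (𝓝 1))
    -- rate of convergence of the resolvents to the projections
    (hJ : ∃ C : ℝ, 0 < C ∧ ∀ (x : EuclideanSpace ℝ (Fin N)) (g : ℝ), 0 < g →
      ENNReal.ofReal (1 / g ^ 4) *
          ∫⁻ ξ, ‖resolvent g (A ξ) x - proj (closure (dom (A ξ))) x‖ₑ ^ 4 ∂μ ≤
        ENNReal.ofReal (C * (1 + ‖x‖ ^ (2 * p))))
    -- growth of the forward selection
    (hbM : ∃ M : Ξ → ℝ, (∀ ξ, 0 ≤ M ξ) ∧ Integrable (fun ξ => M ξ ^ (2 * p)) μ ∧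
      ∀ x, ∀ᵐ ξ ∂μ, ‖b ξ x‖ ≤ M ξ * (1 + ‖x‖))
    (hb4 : ∃ C : ℝ, 0 < C ∧ ∀ x : EuclideanSpace ℝ (Fin N),
      ∫⁻ ξ, ‖b ξ x‖ₑ ^ 4 ∂μ ≤ ENNReal.ofReal (C * (1 + ‖x‖ ^ (2 * p)))) :
    IsMaximalMonotone (fun x => meanOperator μ A x + meanOperator μ B x) ∧
    (∃ Φ, IsSemiflow (fun x => meanOperator μ A x + meanOperator μ B x) Φ) ∧
    ∀ Φ, IsSemiflow (fun x => meanOperator μ A x + meanOperator μ B x) Φ →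
      ∀ᵐ ω ∂P,
        Bornology.IsBounded
          (interpolate γ (iterates A b γ u x₀ ω) '' Set.Ici (0 : ℝ)) ∧
        IsAPT (closure (dom fun x => meanOperator μ A x + meanOperator μ B x)) Φ
          (interpolate γ (iterates A b γ u x₀ ω)) := by
  obtain ⟨⟨φ₁, ψ₁⟩, ⟨hφL, hφmem⟩, ⟨hψL, hψmem⟩, hmean⟩ := hrep
  obtain ⟨M₁, hM0, hMint, hgrowth⟩ := hbM
  have h2p : (2 : ℝ≥0∞) ≤ ((2 * p : ℕ) : ℝ≥0∞) := by
    exact_mod_cast (show 2 ≤ 2 * p by omega)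
  have hφ2 : MemLp φ₁ 2 μ := hφL.mono_exponent h2p
  have hψ2 : MemLp ψ₁ 2 μ := hψL.mono_exponent h2p
  have hM2 : MemLp M₁ 2 μ := memLp_two_of_integrable_pow hM0 hp hMint
  -- Measurable modifications are taken so that composition with the inputs stays measurable; the
  -- defining properties hold almost everywhere and are preserved.
  obtain ⟨φ, hφm, hφe⟩ := hφ2.aestronglyMeasurable
  obtain ⟨ψ, hψm, hψe⟩ := hψ2.aestronglyMeasurable
  obtain ⟨M, hMm, hMe⟩ := hM2.aestronglyMeasurable
  have hBmono : ∀ (y : EuclideanSpace ℝ (Fin N)) (ψ' : Ξ → EuclideanSpace ℝ (Fin N)),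
      (∀ᵐ ξ ∂μ, ψ' ξ ∈ B ξ y) → ∀ x, ∀ᵐ ξ ∂μ, 0 ≤ ⟪b ξ x - ψ' ξ, x - y⟫ := by
    intro y ψ' hψ' x
    filter_upwards [hψ', (hbsel x).2] with ξ h1 h2
    exact (hB ξ).inner_nonneg h2 h1
  have href : IsReferencePoint μ A b xstar φ ψ M :=
    { measurable_left := hφm.measurable
      measurable_right := hψm.measurable
      measurable_bound := hMm.measurable
      memLp_left := hφ2.ae_eq hφe
      memLp_right := hψ2.ae_eq hψe
      memLp_bound := hM2.ae_eq hMe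
      mem := by
        filter_upwards [hφmem, hφe] with ξ h1 h2
        rwa [← h2]
      mono := hBmono xstar ψ (by
        filter_upwards [hψmem, hψe] with ξ h1 h2
        rwa [← h2])
      mean := by rwa [← integral_congr_ae hφe, ← integral_congr_ae hψe]
      growth := fun x => by
        filter_upwards [hgrowth x, hMe] with ξ h1 h2
        rwa [← h2] }
  -- Steps and inputs are shifted by one: time `n` of the abstract scheme uses `γ (n + 1)` and `u (n
  -- + 1)`.
  have hfb : IsForwardBackward P μ A b (fun n => u (n + 1)) (fun n => γ (n + 1))
      (fun n ω => iterates A b γ u x₀ ω n) :=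
    { maximal := hA
      measurable_graph := hAmeas
      measurable_forward := hbmeas
      measurable_input := fun n => humeas _ (Nat.le_add_left 1 n)
      indep := huindep
      law := fun n => hulaw _ (Nat.le_add_left 1 n)
      pos := fun n => hγpos _ (Nat.le_add_left 1 n)
      summable_sq := (summable_nat_add_iff 1).2 hγ2
      init := ⟨x₀, fun _ => rfl⟩
      step := fun _ _ => rfl }
  -- The growth bound by the square-integrable `M₁` makes `b` itself a square-integrable selection.
  have hsel2 : ∀ x, (selections μ 2 fun ξ => B ξ x).Nonempty := by
    intro x
    refine ⟨fun ξ => b ξ x, ?_, (hbsel x).2⟩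
    refine (hM2.const_mul (1 + ‖x‖)).mono (hbsel x).1.aestronglyMeasurable ?_
    filter_upwards [hgrowth x] with ξ hξ
    refine le_trans ?_ (Real.le_norm_self _)
    rwa [mul_comm]
  have hmax : IsMaximalMonotone (fun x => meanOperator μ A x + meanOperator μ B x) :=
    hAmax.add_meanOperator hB hBmeas hBdom hsel2
  refine ⟨hmax, hmax.exists_semiflow, fun Φ hΦ => ?_⟩
  have hdomeq := dom_add_meanOperator_eq (μ := μ) hAint hBint
  obtain ⟨C, hC0, hC⟩ := hdist
  -- The constant is capped at `1` so that the contraction factor `1 - C²` is nonnegative.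
  have hdist' : ∀ x, min C 1 * Metric.infDist x (essDom μ A) ^ 2 ≤
      ∫ ξ, Metric.infDist x (dom (A ξ)) ^ 2 ∂μ := by
    intro x
    have h1 := hC x
    rw [← ofReal_integral_eq_lintegral_ofReal (hfb.integrable_infDist_dom_sq hD x)
      (Eventually.of_forall fun ξ => sq_nonneg _),
      ENNReal.ofReal_le_ofReal_iff (integral_nonneg fun ξ => sq_nonneg _)] at h1
    exact (mul_le_mul_of_nonneg_right (min_le_left _ _) (sq_nonneg _)).trans h1
  obtain ⟨CJ, hCJ0, hCJ⟩ := hJ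
  have hJ' : ∀ R : ℝ, ∃ K, 0 ≤ K ∧ ∀ x, ‖x‖ ≤ R → ∀ g, 0 < g →
      Integrable (fun ξ => ‖resolvent g (A ξ) x - proj (closure (dom (A ξ))) x‖ ^ 2) μ ∧
      ∫ ξ, ‖resolvent g (A ξ) x - proj (closure (dom (A ξ))) x‖ ^ 2 ∂μ ≤ g ^ 2 * K := by
    intro R
    refine ⟨1 + CJ * (1 + |R| ^ (2 * p)), by positivity, fun x hx g hg => ?_⟩
    have hm : Measurable fun ξ => resolvent g (A ξ) x - proj (closure (dom (A ξ))) x :=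
      ((measurable_uncurry_resolvent hA hAmeas hg).sub
        (measurable_uncurry_proj hA hAmeas)).comp measurable_prodMk_left
    refine integral_sq_le_of_lintegral_pow_four hm.aestronglyMeasurable hg (by positivity)
      ((hCJ x g hg).trans (ENNReal.ofReal_le_ofReal ?_))
    have := hx.trans (le_abs_self R)
    gcongr
  filter_upwards [hfb.ae_bounded href, hfb.ae_summable_increment_sq href, hfb.ae_test href,
    hfb.ae_tendsto_infDist href hD (lt_min hC0 one_pos) (min_le_right _ _) hdist' hJ']
    with ω ⟨R, hR⟩ hsq htest hinf
  refine isAPT_interpolate hmax hγpos hγ1 ((tendsto_add_atTop_iff_nat 1).1 hfb.tendsto_step) hR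
    ?_ (by rwa [hdomeq]) ?_ hΦ
  · have h1 := hsq.tendsto_atTop_zero.sqrt
    rw [Real.sqrt_zero] at h1
    refine h1.congr fun n => ?_
    rw [Real.sqrt_sq (norm_nonneg _)]
    have := hfb.succ_eq n ω
    rw [this, add_sub_cancel_left]
  · rintro y w hw η hη
    obtain ⟨_, ⟨φ', hφ', rfl⟩, _, ⟨ψ', hψ', rfl⟩, rfl⟩ := Set.mem_add.1 hw
    filter_upwards [htest y φ' ψ' (memLp_one_iff_integrable.1 hφ'.1)
      (memLp_one_iff_integrable.1 hψ'.1) hφ'.2 (hBmono y ψ' hψ'.2) η hη] with n hn m hm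
    rw [← sum_Ico_stepTime γ hm]
    exact hn m hm
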